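/- **Theorem 4.20 (Tannakian duality).** Fix $N\in\mathbb N$ and let $H=\mathbb C^N$ with its canonical basis $(e_i)$. *Woronowicz algebras.* A Woronowicz algebra is a pair $(A,u)$, where $A$ is a unital $C^*$-algebra and $u\in M_N(A)$ is a unitary matrix whose entries generate $A$ as a $C^*$-algebra, such that there are morphisms of $C^*$-algebras $\Delta:A\to A\otimes A$, $\varepsilon:A\to\mathbb C$, $S:A\to A^{opp}$ with $\Delta(u_{ij})=\sum_ku_{ik}\otimes u_{kj}$, $\varepsilon(u_{ij})=\delta_{ij}$, $S(u_{ij})=u_{ji}^*$. Here $A\otimes A$ is the universal $C^*$-completion of the algebraic tensor product, and morphisms are unital $*$-homomorphisms. Let $\mathcal A=\langle u_{ij}\rangle\subset A$ be the unital $*$-algebra generated by the entries $u_{ij}$. Two Woronowicz algebras $(A,u),(B,v)$ with $u\in M_N(A)$, $v\in M_N(B)$ are identified, written $A\simeq B$, if there is a $*$-algebra isomorphism $\mathcal A\simeq\mathcal B$ with $u_{ij}\mapsto v_{ij}$ for all $i,j$ (so that full and reduced versions are identified). *Tensor categories.* Colored integers $k,l,\ldots$ are words in the letters $\circ,\bullet$.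 Put $u^{\otimes\emptyset}=1$, $u^{\otimes\circ}=u$, $u^{\otimes\bullet}=\bar u=(u_{ij}^*)$, $u^{\otimes kl}=u^{\otimes k}\otimes u^{\otimes l}$, where $(v\otimes w)_{ia,jb}=v_{ij}w_{ab}$. Accordingly, $H^{\otimes k}$ is $H^{\otimes|k|}$, where $|k|$ is the length of $k$ and $\bar H\simeq H$ via the basis. A tensor category over $H$ is a collection $C=(C(k,l))$ of linear subspaces $C(k,l)\subset\mathcal L(H^{\otimes k},H^{\otimes l})$, for all colored integers $k,l$, which is closed under tensor products, under composition of composable maps and under adjoints, such that each $C(k,k)$ contains the identity, and such that $C(\emptyset,\circ\bullet)$ and $C(\emptyset,\bullet\circ)$ contain $R:1\mapsto\sum_ie_i\otimes e_i$. *The two constructions.* To a Woronowicz algebra $(A,u)$ we associate $C_A=(C_A(k,l))$, with $$C_A(k,l)=Hom(u^{\otimes k},u^{\otimes l})=\{T\mid Tu^{\otimes k}=u^{\otimes l}T\}.$$ To a tensor category $C$ we associate the $C^*$-algebra $$A_C=C(U_N^+)\big/\big\langle T\in Hom(u^{\otimes k},u^{\otimes l})\,\big|\,\forall k,l,\ \forall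 T\in C(k,l)\big\rangle,$$ with the image of $u$ as its matrix of coordinates. Here $C(U_N^+)$ is the universal $C^*$-algebra generated by the entries of an $N\times N$ matrix $u$ such that both $u$ and $u^t$ are unitary, and we divide by the closed two-sided $*$-ideal generated by the entries of the matrices $Tu^{\otimes k}-u^{\otimes l}T$. *Statement.* The constructions $C\mapsto A_C$ and $A\mapsto C_A$ are well defined and inverse to each other, modulo the above identification: 1. For any tensor category $C$ over $\mathbb C^N$, the algebra $A_C$ is a Woronowicz algebra, and $C_{A_C}=C$. 2. For any Woronowicz algebra $(A,u)$ with $u\in M_N(A)$, the collection $C_A$ is a tensor category over $\mathbb C^N$, and $A_{C_A}\simeq A$. 3. For any two Woronowicz algebras $(A,u),(B,v)$ with $u\in M_N(A)$, $v\in M_N(B)$, we have $A\simeq B$ if and only if $C_A=C_B$. -/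

import Mathlib

open scoped TensorProduct

namespace Tannaka

noncomputable section

/-! ### Universal C⋆-algebras -/

/-- A C⋆-seminorm on a complex unital ⋆-algebra. -/
structure CStarSeminorm (𝒜 : Type*) [Ring 𝒜] [StarRing 𝒜] [Algebra ℂ 𝒜] extends
    Seminorm ℂ 𝒜 where
  mul_le_mul' : ∀ a b : 𝒜, toFun (a * b) ≤ toFun a * toFun b
  star_mul_self' : ∀ a : 𝒜, toFun (star a * a) = toFun a ^ 2

namespace CStarSeminorm

variable {𝒜 : Type*} [Ring 𝒜] [StarRing 𝒜] [Algebra ℂ 𝒜]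

instance : CoeFun (CStarSeminorm 𝒜) (fun _ => 𝒜 → ℝ) := ⟨fun p => p.toSeminorm⟩

theorem mul_le (p : CStarSeminorm 𝒜) (a b : 𝒜) : p (a * b) ≤ p a * p b := p.mul_le_mul' a b

theorem star_mul_self (p : CStarSeminorm 𝒜) (a : 𝒜) : p (star a * a) = p a ^ 2 :=
  p.star_mul_self' a

theorem nonneg (p : CStarSeminorm 𝒜) (a : 𝒜) : 0 ≤ p a := apply_nonneg p.toSeminorm a

theorem le_star (p : CStarSeminorm 𝒜) (a : 𝒜) : p a ≤ p (star a) := by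
  rcases (p.nonneg a).eq_or_lt with h | h
  · rw [← h]; exact p.nonneg _
  · have h1 := p.star_mul_self a
    have h2 := p.mul_le (star a) a
    rw [h1, sq] at h2
    exact le_of_mul_le_mul_right h2 h

theorem apply_star (p : CStarSeminorm 𝒜) (a : 𝒜) : p (star a) = p a :=
  le_antisymm (by simpa using p.le_star (star a)) (p.le_star a)

theorem map_one_le (p : CStarSeminorm 𝒜) : p 1 ≤ 1 := by
  have h := p.star_mul_self 1
  rw [star_one, one_mul, sq] at h
  rcases (p.nonneg 1).eq_or_lt with h0 | h0
  · rw [← h0]; exact zero_le_one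
  · exact (mul_right_cancel₀ h0.ne' (by rw [one_mul]; exact h)).ge

/-- The zero seminorm. -/
instance : Zero (CStarSeminorm 𝒜) :=
  ⟨{ (0 : Seminorm ℂ 𝒜) with
      mul_le_mul' := fun _ _ => by
        change (0 : ℝ) ≤ 0 * 0
        simp
      star_mul_self' := fun _ => by
        change (0 : ℝ) = 0 ^ 2
        simp }⟩

/-- The algebra `𝒜`, regarded as a seminormed algebra with the seminorm `p`. -/
def Space (_p : CStarSeminorm 𝒜) : Type _ := 𝒜

variable (p : CStarSeminorm 𝒜)

instance : SeminormedRing p.Space :=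
  { (inferInstance : Ring 𝒜), p.toSeminorm.toAddGroupSeminorm.toSeminormedAddCommGroup with
    norm_mul_le := p.mul_le }

theorem norm_def (a : p.Space) : ‖a‖ = p (show 𝒜 from a) := rfl

instance : StarRing p.Space := inferInstanceAs (StarRing 𝒜)

instance : NormedAlgebra ℂ p.Space :=
  { (inferInstance : Algebra ℂ 𝒜) with
    norm_smul_le := fun c a => (map_smul_eq_mul p.toSeminorm c a).le }

instance [StarModule ℂ 𝒜] : StarModule ℂ p.Space := inferInstanceAs (StarModule ℂ 𝒜)

instance : NormedStarGroup p.Space where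
  norm_star_le a := (p.apply_star (show 𝒜 from a)).le

theorem norm_star_mul_self_space (a : p.Space) : ‖star a * a‖ = ‖a‖ * ‖a‖ :=
  (p.star_mul_self (show 𝒜 from a)).trans (sq _)

/-- The C⋆-algebra obtained from `𝒜` by separation and completion with respect to the
C⋆-seminorm `p`. -/
def Completion : Type _ := UniformSpace.Completion p.Space

instance : NormedRing p.Completion :=
  inferInstanceAs (NormedRing (UniformSpace.Completion p.Space))

instance : CompleteSpace p.Completion :=
  inferInstanceAs (CompleteSpace (UniformSpace.Completion p.Space))

instance : NormedAlgebra ℂ p.Completion :=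
  { (inferInstance : Algebra ℂ (UniformSpace.Completion p.Space)) with
    norm_smul_le := norm_smul_le (α := ℂ) (β := UniformSpace.Completion p.Space) }

/-- The canonical map from `𝒜` to its completion. -/
def toCompletion (a : 𝒜) : p.Completion :=
  ((show p.Space from a : p.Space) : UniformSpace.Completion p.Space)

theorem norm_toCompletion (a : 𝒜) : ‖p.toCompletion a‖ = p a :=
  UniformSpace.Completion.norm_coe (E := p.Space) a

theorem induction_on {P : p.Completion → Prop} (x : p.Completion) (hc : IsClosed {x | P x})
    (h : ∀ a : 𝒜, P (p.toCompletion a)) : P x :=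
  UniformSpace.Completion.induction_on (α := p.Space) x hc h

theorem toCompletion_add (a b : 𝒜) :
    p.toCompletion (a + b) = p.toCompletion a + p.toCompletion b :=
  UniformSpace.Completion.coe_add (α := p.Space) a b

theorem toCompletion_mul (a b : 𝒜) :
    p.toCompletion (a * b) = p.toCompletion a * p.toCompletion b :=
  UniformSpace.Completion.coe_mul (α := p.Space) a b

theorem toCompletion_one : p.toCompletion 1 = 1 := rfl

theorem toCompletion_zero : p.toCompletion 0 = 0 := rfl

theorem toCompletion_algebraMap (c : ℂ) :
    p.toCompletion (algebraMap ℂ 𝒜 c) = algebraMap ℂ p.Completion c := rfl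

theorem toCompletion_smul (c : ℂ) (a : 𝒜) :
    p.toCompletion (c • a) = c • p.toCompletion a := by
  rw [Algebra.smul_def, toCompletion_mul, toCompletion_algebraMap, ← Algebra.smul_def]

instance : Star p.Completion :=
  ⟨UniformSpace.Completion.map (star : p.Space → p.Space)⟩

instance : ContinuousStar p.Completion :=
  ⟨UniformSpace.Completion.continuous_map (f := (star : p.Space → p.Space))⟩

theorem toCompletion_star (a : 𝒜) : p.toCompletion (star a) = star (p.toCompletion a) :=
  (UniformSpace.Completion.map_coe (f := (star : p.Space → p.Space))
    star_isometry.uniformContinuous a).symm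

theorem induction_on₂ {P : p.Completion → p.Completion → Prop} (x y : p.Completion)
    (hc : IsClosed {x : p.Completion × p.Completion | P x.1 x.2})
    (h : ∀ a b : 𝒜, P (p.toCompletion a) (p.toCompletion b)) : P x y :=
  UniformSpace.Completion.induction_on₂ (α := p.Space) (β := p.Space) x y hc h

instance : StarRing p.Completion where
  star_involutive x := by
    refine p.induction_on (P := fun x => star (star x) = x) x
      (isClosed_eq (by fun_prop) (by fun_prop)) fun a => ?_
    rw [← toCompletion_star, ← toCompletion_star, star_star]
  star_mul x y := by
    refine p.induction_on₂ (P := fun x y => star (x * y) = star y * star x) x y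
      (isClosed_eq (by fun_prop) (by fun_prop)) fun a b => ?_
    simp only [← toCompletion_star, ← toCompletion_mul, star_mul]
  star_add x y := by
    refine p.induction_on₂ (P := fun x y => star (x + y) = star x + star y) x y
      (isClosed_eq (by fun_prop) (by fun_prop)) fun a b => ?_
    simp only [← toCompletion_star, ← toCompletion_add, star_add]

/-- The canonical map from `𝒜` to its completion, as a morphism of ⋆-algebras. -/
def mkHom : 𝒜 →⋆ₐ[ℂ] p.Completion where
  toFun := p.toCompletion
  map_one' := p.toCompletion_one
  map_mul' := p.toCompletion_mul
  map_zero' := p.toCompletion_zero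
  map_add' := p.toCompletion_add
  commutes' := p.toCompletion_algebraMap
  map_star' := p.toCompletion_star

theorem norm_mkHom (a : 𝒜) : ‖p.mkHom a‖ = p a := p.norm_toCompletion a

variable [StarModule ℂ 𝒜]

instance : StarModule ℂ p.Completion where
  star_smul c x := by
    have h1 : Continuous fun x : p.Completion => c • x := continuous_const_smul c
    have h2 : Continuous fun x : p.Completion => star c • x := continuous_const_smul (star c)
    have h3 : Continuous fun x : p.Completion => star x := continuous_star
    refine p.induction_on (P := fun x => star (c • x) = star c • star x) x
      (isClosed_eq (h3.comp h1) (h2.comp h3)) fun a => ?_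
    rw [← toCompletion_smul, ← toCompletion_star, ← toCompletion_star, ← toCompletion_smul,
      star_smul]

instance : CStarAlgebra p.Completion where
  norm_mul_self_le x := by
    refine p.induction_on (P := fun x => ‖x‖ * ‖x‖ ≤ ‖star x * x‖) x
      (isClosed_le (by fun_prop) (by fun_prop)) fun a => ?_
    rw [← toCompletion_star, ← toCompletion_mul, norm_toCompletion, norm_toCompletion,
      star_mul_self, sq]

end CStarSeminorm

section UniversalQuotient

variable {𝒜 : Type*} [Ring 𝒜] [StarRing 𝒜] [Algebra ℂ 𝒜]

/-- The values at `a` of the C⋆-seminorms for which the relations `r = 0`, `r ∈ R`, hold are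
bounded, for every `a`. This is the condition for the existence of the universal C⋆-algebra. -/
def HasMaxSeminorm (R : Set 𝒜) : Prop :=
  ∀ a : 𝒜, ∃ M : ℝ, ∀ p : CStarSeminorm 𝒜, (∀ r ∈ R, p r = 0) → p a ≤ M

instance (R : Set 𝒜) : Nonempty {p : CStarSeminorm 𝒜 // ∀ r ∈ R, p r = 0} :=
  ⟨⟨0, fun _ _ => rfl⟩⟩

theorem HasMaxSeminorm.bddAbove {R : Set 𝒜} (h : HasMaxSeminorm R) (a : 𝒜) :
    BddAbove (Set.range fun p : {p : CStarSeminorm 𝒜 // ∀ r ∈ R, p r = 0} => p.1 a) := by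
  obtain ⟨M, hM⟩ := h a
  exact ⟨M, by rintro _ ⟨p, rfl⟩; exact hM p.1 p.2⟩

/-- The largest C⋆-seminorm for which the relations `r = 0`, `r ∈ R`, hold. -/
def maxSeminorm (R : Set 𝒜) (h : HasMaxSeminorm R) : CStarSeminorm 𝒜 where
  toFun a := ⨆ p : {p : CStarSeminorm 𝒜 // ∀ r ∈ R, p r = 0}, p.1 a
  map_zero' := by
    simp only [map_zero, ciSup_const]
  add_le' a b := ciSup_le fun p => (map_add_le_add p.1.toSeminorm a b).trans
    (add_le_add (le_ciSup (h.bddAbove a) p) (le_ciSup (h.bddAbove b) p))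
  neg' a := by simp only [map_neg_eq_map]
  smul' c a := by
    simp only [map_smul_eq_mul]
    rw [Real.mul_iSup_of_nonneg (norm_nonneg c)]
  mul_le_mul' a b := ciSup_le fun p => (p.1.mul_le a b).trans
    (mul_le_mul (le_ciSup (h.bddAbove a) p) (le_ciSup (h.bddAbove b) p) (p.1.nonneg b)
      ((p.1.nonneg a).trans (le_ciSup (h.bddAbove a) p)))
  star_mul_self' a := by
    refine le_antisymm (ciSup_le fun p => ?_) ?_
    · rw [p.1.star_mul_self]
      exact pow_le_pow_left₀ (p.1.nonneg a) (le_ciSup (h.bddAbove a) p) 2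
    · have h0 : 0 ≤ ⨆ p : {p : CStarSeminorm 𝒜 // ∀ r ∈ R, p r = 0}, p.1 (star a * a) :=
        Real.iSup_nonneg fun p => p.1.nonneg _
      have h1 : (⨆ p : {p : CStarSeminorm 𝒜 // ∀ r ∈ R, p r = 0}, p.1 a) ≤
          √(⨆ p : {p : CStarSeminorm 𝒜 // ∀ r ∈ R, p r = 0}, p.1 (star a * a)) := by
        refine ciSup_le fun p => Real.le_sqrt_of_sq_le ?_
        rw [← p.1.star_mul_self]
        exact le_ciSup (h.bddAbove (star a * a)) p
      have h2 : 0 ≤ ⨆ p : {p : CStarSeminorm 𝒜 // ∀ r ∈ R, p r = 0}, p.1 a :=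
        Real.iSup_nonneg fun p => p.1.nonneg _
      calc _ ≤ _ := pow_le_pow_left₀ h2 h1 2
        _ = _ := Real.sq_sqrt h0

theorem le_maxSeminorm {R : Set 𝒜} (h : HasMaxSeminorm R) (p : CStarSeminorm 𝒜)
    (hp : ∀ r ∈ R, p r = 0) (a : 𝒜) : p a ≤ maxSeminorm R h a :=
  le_ciSup (h.bddAbove a) (⟨p, hp⟩ : {p : CStarSeminorm 𝒜 // ∀ r ∈ R, p r = 0})

theorem maxSeminorm_rel {R : Set 𝒜} (h : HasMaxSeminorm R) {r : 𝒜} (hr : r ∈ R) :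
    maxSeminorm R h r = 0 :=
  le_antisymm (ciSup_le fun p => (p.2 r hr).le) ((maxSeminorm R h).nonneg r)

end UniversalQuotient

/-! ### The maximal tensor product -/

section MaxTensor

variable (A B : Type*) [CStarAlgebra A] [CStarAlgebra B]

theorem hasMaxSeminorm_tensor : HasMaxSeminorm (∅ : Set (A ⊗[ℂ] B)) := by
  intro x
  have key : ∀ (a : A) (b : B) (p : CStarSeminorm (A ⊗[ℂ] B)), p (a ⊗ₜ b) ≤ ‖a‖ * ‖b‖ := by
    intro a b p
    let f : A →⋆ₐ[ℂ] p.Completion := p.mkHom.comp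
      { (Algebra.TensorProduct.includeLeft : A →ₐ[ℂ] A ⊗[ℂ] B) with
        map_star' := fun a => by simp }
    let g : B →⋆ₐ[ℂ] p.Completion := p.mkHom.comp
      { (Algebra.TensorProduct.includeRight : B →ₐ[ℂ] A ⊗[ℂ] B) with
        map_star' := fun a => by simp }
    have hf : p (a ⊗ₜ 1) ≤ ‖a‖ := by
      rw [← p.norm_mkHom]
      exact NonUnitalStarAlgHom.norm_apply_le f a
    have hg : p (1 ⊗ₜ b) ≤ ‖b‖ := by
      rw [← p.norm_mkHom]
      exact NonUnitalStarAlgHom.norm_apply_le g b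
    have : a ⊗ₜ[ℂ] b = (a ⊗ₜ 1) * (1 ⊗ₜ b) := by simp
    rw [this]
    exact (p.mul_le _ _).trans (mul_le_mul hf hg (p.nonneg _) (norm_nonneg _))
  induction x with
  | zero => exact ⟨0, fun p _ => (map_zero p.toSeminorm).le⟩
  | tmul a b => exact ⟨‖a‖ * ‖b‖, fun p _ => key a b p⟩
  | add x y hx hy =>
    obtain ⟨M, hM⟩ := hx
    obtain ⟨M', hM'⟩ := hy
    exact ⟨M + M', fun p hp => (map_add_le_add p.toSeminorm x y).trans
      (add_le_add (hM p hp) (hM' p hp))⟩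

/-- The universal C⋆-algebraic completion of the algebraic tensor product, that is, the
completion with respect to the largest C⋆-seminorm. -/
abbrev MaxTensor : Type _ := (maxSeminorm ∅ (hasMaxSeminorm_tensor A B)).Completion

variable {A B}

/-- The elementary tensor `a ⊗ b` in the universal tensor product. -/
def MaxTensor.tmul (a : A) (b : B) : MaxTensor A B :=
  (maxSeminorm ∅ (hasMaxSeminorm_tensor A B)).mkHom (a ⊗ₜ[ℂ] b)

end MaxTensor

/-! ### Woronowicz algebras -/

section Woronowicz

variable {N : ℕ} {A : Type*} [CStarAlgebra A]

/-- The ⋆-algebra `𝒜 = ⟨u_ij⟩` generated by the entries of `u`. -/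
def smooth (u : Matrix (Fin N) (Fin N) A) : StarSubalgebra ℂ A :=
  StarAlgebra.adjoin ℂ (Set.range fun ij : Fin N × Fin N => u ij.1 ij.2)

theorem entry_mem_smooth (u : Matrix (Fin N) (Fin N) A) (i j : Fin N) : u i j ∈ smooth u :=
  StarAlgebra.subset_adjoin ℂ _ ⟨(i, j), rfl⟩

/-- `(A, u)` is a Woronowicz algebra: `u` is a unitary matrix, its entries generate the
C⋆-algebra `A`, and the comultiplication `A → A ⊗ A`, the counit `A → ℂ` and the antipode
`A → A^opp` exist as morphisms of C⋆-algebras. -/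
structure IsWoronowicz (u : Matrix (Fin N) (Fin N) A) : Prop where
  unitary : u ∈ unitary (Matrix (Fin N) (Fin N) A)
  generates : (smooth u).topologicalClosure = ⊤
  comul : ∃ Δ : A →⋆ₐ[ℂ] MaxTensor A A,
    ∀ i j, Δ (u i j) = ∑ k, MaxTensor.tmul (u i k) (u k j)
  counit : ∃ ε : A →⋆ₐ[ℂ] ℂ, ∀ i j, ε (u i j) = if i = j then 1 else 0
  antipode : ∃ S : A →⋆ₐ[ℂ] Aᵐᵒᵖ, ∀ i j, S (u i j) = MulOpposite.op (star (u j i))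

/-- Equivalence of Woronowicz algebras, identifying the various (full, reduced, ...) completions
of a given ⋆-algebra of smooth elements: there is an isomorphism of ⋆-algebras
`⟨u_ij⟩ ≃ ⟨v_ij⟩` which maps `u_ij` to `v_ij`. -/
def Equivalent {B : Type*} [CStarAlgebra B] (u : Matrix (Fin N) (Fin N) A)
    (v : Matrix (Fin N) (Fin N) B) : Prop :=
  ∃ e : smooth u ≃⋆ₐ[ℂ] smooth v,
    ∀ i j, e ⟨u i j, entry_mem_smooth u i j⟩ = ⟨v i j, entry_mem_smooth v i j⟩

end Woronowicz

/-! ### Colored integers, intertwiners and tensor categories -/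

/-- The two colors: white is `∘`, black is `•`. -/
inductive Color
  | white
  | black

/-- A colored integer: a word in the two colors. -/
abbrev Word : Type := List Color

/-- The indices of the canonical basis of `H^⊗k`, where `H = ℂ^N`: this basis is formed by the
tensors `e_{i_1} ⊗ ... ⊗ e_{i_s}`, where `s` is the length of `k`. -/
abbrev Idx (N : ℕ) (k : Word) : Type := Fin k.length → Fin N

/-- The linear maps `H^⊗k → H^⊗l`, written as matrices in the canonical bases. -/
abbrev Op (N : ℕ) (k l : Word) : Type := Matrix (Idx N l) (Idx N k) ℂ

/-- The first part of a multi-index for the concatenation of two words. -/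
def Idx.fst {N : ℕ} {k l : Word} (i : Idx N (k ++ l)) : Idx N k :=
  fun t => i ⟨t, by have := t.2; rw [List.length_append]; omega⟩

/-- The second part of a multi-index for the concatenation of two words. -/
def Idx.snd {N : ℕ} {k l : Word} (i : Idx N (k ++ l)) : Idx N l :=
  fun t => i ⟨k.length + t, by have := t.2; rw [List.length_append]; omega⟩

/-- The tensor product `S ⊗ T : H^⊗kp → H^⊗lq` of `S : H^⊗k → H^⊗l` and `T : H^⊗p → H^⊗q`. -/
def Op.tensor {N : ℕ} {k l p q : Word} (S : Op N k l) (T : Op N p q) :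
    Op N (k ++ p) (l ++ q) :=
  Matrix.of fun i j => S i.fst j.fst * T i.snd j.snd

/-- The map `R : ℂ → H ⊗ H`, `R(1) = ∑ e_i ⊗ e_i`, as a map `H^⊗∅ → H^⊗ab`. -/
def opR (N : ℕ) (a b : Color) : Op N [] [a, b] :=
  Matrix.of fun i _ => if i 0 = i 1 then 1 else 0

/-- A collection of linear spaces of maps `H^⊗k → H^⊗l`, for all colored integers `k`, `l`. -/
abbrev HomSpaces (N : ℕ) : Type := ∀ k l : Word, Submodule ℂ (Op N k l)

/-- Tensor categories over the Hilbert space `H = ℂ^N`. -/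
structure IsTensorCategory {N : ℕ} (C : HomSpaces N) : Prop where
  tensor_mem : ∀ {k l p q : Word} {S : Op N k l} {T : Op N p q},
    S ∈ C k l → T ∈ C p q → S.tensor T ∈ C (k ++ p) (l ++ q)
  comp_mem : ∀ {k l m : Word} {S : Op N l m} {T : Op N k l},
    S ∈ C l m → T ∈ C k l → S * T ∈ C k m
  adjoint_mem : ∀ {k l : Word} {T : Op N k l}, T ∈ C k l → T.conjTranspose ∈ C l k
  id_mem : ∀ k : Word, (1 : Op N k k) ∈ C k k
  opR_white_black_mem : opR N .white .black ∈ C [] [.white, .black]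
  opR_black_white_mem : opR N .black .white ∈ C [] [.black, .white]

section Intertwiners

variable {N : ℕ} {A : Type*} [Ring A] [StarRing A] [Algebra ℂ A]

/-- The entries of `u` (for the color `∘`) and of its conjugate `ū = (u_ij^*)` (for `•`). -/
def colored (u : Matrix (Fin N) (Fin N) A) : Color → Matrix (Fin N) (Fin N) A
  | .white => u
  | .black => u.map star

/-- The tensor power `u^⊗k`, with entries
`(u^⊗k)_{i_1...i_s, j_1...j_s} = u^{k_1}_{i_1 j_1} ... u^{k_s}_{i_s j_s}`. -/
def tensorPower (u : Matrix (Fin N) (Fin N) A) (k : Word) : Matrix (Idx N k) (Idx N k) A :=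
  Matrix.of fun i j => (List.ofFn fun t => colored u (k.get t) (i t) (j t)).prod

/-- The matrix `T u^⊗k - u^⊗l T`, whose vanishing means that `T` intertwines `u^⊗k`, `u^⊗l`. -/
def defect (u : Matrix (Fin N) (Fin N) A) {k l : Word} (T : Op N k l) :
    Matrix (Idx N l) (Idx N k) A :=
  T.map (algebraMap ℂ A) * tensorPower u k - tensorPower u l * T.map (algebraMap ℂ A)

/-- The spaces `Hom(u^⊗k, u^⊗l) = {T | T u^⊗k = u^⊗l T}`. -/
def homSpaces (u : Matrix (Fin N) (Fin N) A) : HomSpaces N := fun k l =>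
  { carrier := {T | T.map (algebraMap ℂ A) * tensorPower u k =
      tensorPower u l * T.map (algebraMap ℂ A)}
    add_mem' := by
      intro S T hS hT
      simp only [Set.mem_ofPred_eq] at *
      rw [Matrix.map_add _ (map_add _), Matrix.add_mul, Matrix.mul_add, hS, hT]
    zero_mem' := by
      simp [Matrix.map_zero]
    smul_mem' := by
      intro c T hT
      simp only [Set.mem_ofPred_eq] at *
      have : (c • T).map (algebraMap ℂ A) = c • T.map (algebraMap ℂ A) := by
        ext i j
        simp [Algebra.smul_def]
      rw [this, Matrix.smul_mul, Matrix.mul_smul, hT] }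

end Intertwiners

/-! ### The free ⋆-algebra and the algebra `C(U_N^+)` -/

/-- The free complex unital ⋆-algebra on a set `X`, the algebra of noncommutative polynomials in
the variables `x` and `x^*`, for `x ∈ X`: here `(x, false)` stands for `x` and `(x, true)`
for `x^*`. -/
abbrev FreeStarAlgebra (X : Type*) : Type _ := MonoidAlgebra ℂ (FreeMonoid (X × Bool))

namespace FreeStarAlgebra

variable {X : Type*}

/-- The free generators, and their adjoints. -/
def gen (x : X × Bool) : FreeStarAlgebra X := MonoidAlgebra.single (FreeMonoid.of x) 1

/-- The involution, as a ring morphism into the opposite algebra. -/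
def starHom : FreeStarAlgebra X →+* (FreeStarAlgebra X)ᵐᵒᵖ :=
  MonoidAlgebra.liftNCRingHom
    ((algebraMap ℂ (FreeStarAlgebra X)ᵐᵒᵖ).comp (starRingEnd ℂ))
    (FreeMonoid.lift fun x => MulOpposite.op (gen (x.1, !x.2)))
    (fun c _ => Algebra.commute_algebraMap_left (starRingEnd ℂ c) _)

theorem starHom_algebraMap (c : ℂ) :
    starHom (algebraMap ℂ (FreeStarAlgebra X) c) =
      MulOpposite.op (algebraMap ℂ (FreeStarAlgebra X) (star c)) := by
  rw [MonoidAlgebra.coe_algebraMap]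
  simp [starHom, MonoidAlgebra.liftNCRingHom_single]

theorem starHom_gen (x : X × Bool) :
    starHom (gen x) = MulOpposite.op (gen (x.1, !x.2)) := by
  simp [starHom, gen, MonoidAlgebra.liftNCRingHom_single, ← MonoidAlgebra.one_def]

theorem ringHom_ext {S : Type*} [Semiring S] {f g : FreeStarAlgebra X →+* S}
    (h1 : ∀ c : ℂ, f (algebraMap ℂ _ c) = g (algebraMap ℂ _ c))
    (h2 : ∀ x, f (gen x) = g (gen x)) : f = g := by
  refine MonoidAlgebra.ringHom_ext' ?_ ?_
  · ext c
    exact h1 c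
  · refine FreeMonoid.hom_eq fun x => ?_
    exact h2 x

instance : StarRing (FreeStarAlgebra X) where
  star a := (starHom a).unop
  star_involutive a := by
    have h : (RingEquiv.opOp (FreeStarAlgebra X)).symm.toRingHom.comp
        ((RingHom.op starHom).comp starHom) = RingHom.id (FreeStarAlgebra X) := by
      refine ringHom_ext (fun c => ?_) (fun x => ?_)
      · change (starHom (starHom (algebraMap ℂ (FreeStarAlgebra X) c)).unop).unop = _
        rw [starHom_algebraMap, MulOpposite.unop_op, starHom_algebraMap, MulOpposite.unop_op,
          star_star, RingHom.id_apply]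
      · change (starHom (starHom (gen x)).unop).unop = _
        rw [starHom_gen, MulOpposite.unop_op, starHom_gen, MulOpposite.unop_op, Bool.not_not,
          RingHom.id_apply]
    exact RingHom.congr_fun h a
  star_mul a b := by rw [map_mul, MulOpposite.unop_mul]
  star_add a b := by rw [map_add, MulOpposite.unop_add]

theorem star_algebraMap (c : ℂ) :
    star (algebraMap ℂ (FreeStarAlgebra X) c) = algebraMap ℂ (FreeStarAlgebra X) (star c) := by
  change (starHom _).unop = _
  rw [starHom_algebraMap, MulOpposite.unop_op]

theorem star_gen (x : X) : star (gen (x, false)) = gen (x, true) := by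
  change (starHom _).unop = _
  rw [starHom_gen, MulOpposite.unop_op, Bool.not_false]

instance : StarModule ℂ (FreeStarAlgebra X) where
  star_smul c a := by
    rw [Algebra.smul_def, Algebra.smul_def, star_mul, star_algebraMap]
    exact (Algebra.commutes _ _).symm

/-- A family of C⋆-seminorms which is bounded on the generators is bounded on every element. -/
theorem exists_bound (s : Set (CStarSeminorm (FreeStarAlgebra X)))
    (h : ∀ p ∈ s, ∀ x, p (gen (x, false)) ≤ 1) (a : FreeStarAlgebra X) :
    ∃ M : ℝ, ∀ p ∈ s, p a ≤ M := by
  have hgen : ∀ p ∈ s, ∀ x : X × Bool, p (gen x) ≤ 1 := by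
    rintro p hp ⟨x, _ | _⟩
    · exact h p hp x
    · rw [← star_gen, p.apply_star]
      exact h p hp x
  have hword : ∀ p ∈ s, ∀ m : FreeMonoid (X × Bool),
      p (MonoidAlgebra.single m 1 : FreeStarAlgebra X) ≤ 1 := by
    intro p hp m
    induction m using FreeMonoid.recOn with
    | one => exact p.map_one_le
    | of_mul x m hm =>
      have : (MonoidAlgebra.single (FreeMonoid.of x * m) 1 : FreeStarAlgebra X) =
          gen x * MonoidAlgebra.single m 1 := by
        simp [gen, MonoidAlgebra.single_mul_single]
      rw [this]
      exact (p.mul_le _ _).trans (mul_le_one₀ (hgen p hp x) (p.nonneg _) hm)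
  induction a using MonoidAlgebra.induction_linear with
  | zero => exact ⟨0, fun p _ => (map_zero p.toSeminorm).le⟩
  | add a b ha hb =>
    obtain ⟨M, hM⟩ := ha
    obtain ⟨M', hM'⟩ := hb
    exact ⟨M + M', fun p hp => (map_add_le_add p.toSeminorm a b).trans
      (add_le_add (hM p hp) (hM' p hp))⟩
  | single m c =>
    refine ⟨‖c‖, fun p hp => ?_⟩
    have : (MonoidAlgebra.single m c : FreeStarAlgebra X) =
        c • (MonoidAlgebra.single m 1 : FreeStarAlgebra X) := by
      simp [MonoidAlgebra.smul_single]
    rw [this, map_smul_eq_mul]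
    exact mul_le_of_le_one_right (norm_nonneg c) (hword p hp m)

end FreeStarAlgebra

/-- The relations `u u^* = u^* u = 1`, `ū u^t = u^t ū = 1` expressing that the square matrix `u`
is biunitary, written as a set of elements required to vanish. -/
def biunitaryRelations {N : ℕ} {𝒜 : Type*} [Ring 𝒜] [StarRing 𝒜]
    (u : Matrix (Fin N) (Fin N) 𝒜) : Set 𝒜 :=
  {r | ∃ i j, r = (u * u.conjTranspose - 1) i j ∨ r = (u.conjTranspose * u - 1) i j ∨
    r = (u.map star * u.transpose - 1) i j ∨ r = (u.transpose * u.map star - 1) i j}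

/-- The matrix formed by the `N²` free generators of the free ⋆-algebra. -/
def freeMatrix (N : ℕ) : Matrix (Fin N) (Fin N) (FreeStarAlgebra (Fin N × Fin N)) :=
  Matrix.of fun i j => FreeStarAlgebra.gen ((i, j), false)

theorem hasMaxSeminorm_biunitary (N : ℕ) :
    HasMaxSeminorm (biunitaryRelations (freeMatrix N)) := by
  refine FreeStarAlgebra.exists_bound {p | ∀ r ∈ biunitaryRelations (freeMatrix N), p r = 0} ?_
  rintro p hp ⟨i, j⟩
  let := CStarAlgebra.spectralOrder p.Completion
  have := CStarAlgebra.spectralOrderedRing p.Completion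
  let a : Fin N → p.Completion := fun k => p.mkHom (freeMatrix N k j)
  have h1 : ∑ k, star (a k) * a k = 1 := by
    have h2 : p ((star (freeMatrix N) * freeMatrix N - 1) j j) = 0 :=
      hp _ ⟨j, j, Or.inr (Or.inl rfl)⟩
    rw [← p.norm_mkHom, norm_eq_zero, Matrix.sub_apply, Matrix.one_apply_eq, map_sub, map_one,
      sub_eq_zero, Matrix.mul_apply, map_sum] at h2
    rw [← h2]
    refine Finset.sum_congr rfl fun k _ => ?_
    rw [map_mul, Matrix.star_apply, map_star]
  have h3 : star (a i) * a i ≤ 1 := by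
    rw [← h1]
    exact Finset.single_le_sum (f := fun k => star (a k) * a k)
      (fun k _ => star_mul_self_nonneg (a k)) (Finset.mem_univ i)
  have h4 : ‖star (a i) * a i‖ ≤ 1 :=
    (CStarAlgebra.norm_le_one_iff_of_nonneg _ (star_mul_self_nonneg (a i))).2 h3
  rw [CStarRing.norm_star_mul_self] at h4
  have h5 : ‖a i‖ ≤ 1 := by nlinarith [norm_nonneg (a i)]
  exact (p.norm_mkHom _).symm.le.trans h5

/-- The algebra `C(U_N^+)`, the universal C⋆-algebra generated by the entries of a biunitary
`N × N` matrix. -/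
abbrev FreeUnitary (N : ℕ) : Type :=
  (maxSeminorm (biunitaryRelations (freeMatrix N)) (hasMaxSeminorm_biunitary N)).Completion

/-- The fundamental corepresentation of `C(U_N^+)`. -/
def FreeUnitary.u (N : ℕ) : Matrix (Fin N) (Fin N) (FreeUnitary N) :=
  (freeMatrix N).map (CStarSeminorm.mkHom _)

/-! ### The algebra `A_C` -/

theorem hasMaxSeminorm_quotient {D : Type*} [CStarAlgebra D] (R : Set D) : HasMaxSeminorm R :=
  fun a => ⟨‖a‖, fun p _ => by
    rw [← p.norm_mkHom]
    exact NonUnitalStarAlgHom.norm_apply_le p.mkHom a⟩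

/-- The quotient of a C⋆-algebra `D` by the closed two-sided ⋆-ideal generated by a set `R`,
constructed as the separation and completion of `D` with respect to the largest C⋆-seminorm which
vanishes on `R`. -/
abbrev CStarQuotient {D : Type*} [CStarAlgebra D] (R : Set D) : Type _ :=
  (maxSeminorm R (hasMaxSeminorm_quotient R)).Completion

/-- The relations `T ∈ Hom(u^⊗k, u^⊗l)` for all `k`, `l` and all `T ∈ C(k,l)`, where `u` is the
fundamental corepresentation of `C(U_N^+)`, written as a set of elements required to vanish. -/
def intertwiningRelations {N : ℕ} (C : HomSpaces N) : Set (FreeUnitary N) :=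
  {r | ∃ (k l : Word), ∃ T ∈ C k l, ∃ i j, r = defect (FreeUnitary.u N) T i j}

/-- The algebra `A_C = C(U_N^+) / ⟨T ∈ Hom(u^⊗k, u^⊗l) | ∀ k, l, ∀ T ∈ C(k,l)⟩`. -/
abbrev TannakaAlgebra {N : ℕ} (C : HomSpaces N) : Type :=
  CStarQuotient (intertwiningRelations C)

/-- The fundamental corepresentation of `A_C`, the image of that of `C(U_N^+)`. -/
def TannakaAlgebra.u {N : ℕ} (C : HomSpaces N) : Matrix (Fin N) (Fin N) (TannakaAlgebra C) :=
  (FreeUnitary.u N).map (CStarSeminorm.mkHom _)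

end

end Tannaka

/-! Two facts carry the theorem: equality of the Hom spaces forces equivalence
(`IsWoronowicz.equivalent_iff`), and `C_{A_C} = C` (`IsTensorCategory.homSpaces_eq`). The
equivalence `A_{C_A} ≃ A` follows, since both sides then have the same Hom spaces. That `A_C` is a
Woronowicz algebra comes from its universal property, and that `C_A` is a tensor category comes from
biunitarity, where the antipode supplies the unitarity of `u^t`.

Hom spaces determine the algebra. Both ⋆-algebras of coefficients are quotients of the free
⋆-algebra, so it suffices to compare the linear relations between the entries of a direct sum `w` of
tensor powers. The scalar matrices satisfying all these relations form a ⋆-algebra: comultiplication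
gives products, the counit gives the unit, the antipode gives adjoints. The commutant of this
⋆-algebra is `End(w)`, so by the bicommutant theorem (`mem_of_commute_commutant`) it equals
`End(w)'`. Thus the relations can be read off from `End(w)`, that is, from the Hom spaces between
the summands (`IsCorepresentation.pairing_eq_zero_iff`). A relation obtained in the maximal tensor
product is exploited through products of positive functionals.

The equality `C_{A_C} = C`. The inclusion `C ⊂ C_{A_C}` holds by construction. For the converse, a
Haar functional `h` is built from `C` alone, on the free ⋆-algebra: `h` maps the matrix `u^⊗k` to
the orthogonal projection onto `C(∅,k)`. It vanishes on the ideal of the relations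
(`haar_mul_defect_mul`). By Frobenius reciprocity, for `x = ∑ a_pq w_pq` one has `h(x^* x) = Tr(a^*
∑ X a X^*)`, where `X` runs over a Parseval frame of the ⋆-algebra `E` of matrices with transposed
blocks in `C` (`haar_star_pairing_mul`). The map `a ↦ ∑ X a X^*` averages into the commutant `E'`,
so this form is positive, and it vanishes only when `a` is orthogonal to `E'`
(`IsParsevalFrame.average_nonneg`).

The GNS construction for `h` gives a C⋆-algebra in which the relations of `C` hold, hence a
representation of `A_C`. If `T` is an intertwiner over `A_C`, the entries of `T u^⊗k - u^⊗l T` are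
therefore null for `h`, so their coefficients are orthogonal to `E'`. This orthogonality says that
`T`, placed as a transposed block, commutes with `E'`; by the bicommutant theorem it lies in `E`, so
`T ∈ C`. -/

open scoped TensorProduct

namespace Tannaka

noncomputable section

/-! ### Universal properties -/

namespace FreeStarAlgebra

variable {X B : Type*} [Ring B] [StarRing B] [Algebra ℂ B]

/-- The morphism of algebras underlying `FreeStarAlgebra.lift`. -/
def liftAlgHom (v : X → B) : FreeStarAlgebra X →ₐ[ℂ] B :=
  MonoidAlgebra.lift ℂ B (FreeMonoid (X × Bool))
    (FreeMonoid.lift fun x => if x.2 then star (v x.1) else v x.1)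

theorem liftAlgHom_gen (v : X → B) (x : X × Bool) :
    liftAlgHom v (gen x) = if x.2 then star (v x.1) else v x.1 := by
  simp [liftAlgHom, gen]

/-- The universal property of the free ⋆-algebra. -/
def lift [StarModule ℂ B] (v : X → B) : FreeStarAlgebra X →⋆ₐ[ℂ] B where
  toAlgHom := liftAlgHom v
  map_star' a := by
    -- Compatibility with the involutions is an equality of two ring morphisms into the opposite
    -- algebra, so scalars and generators suffice.
    have h : (RingHom.op (liftAlgHom v : FreeStarAlgebra X →+* B)).comp starHom =
        (starRingEquiv : B ≃+* Bᵐᵒᵖ).toRingHom.comp (liftAlgHom v : FreeStarAlgebra X →+* B) := by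
      refine ringHom_ext (fun c => ?_) (fun x => ?_)
      · change MulOpposite.op (liftAlgHom v (starHom (algebraMap ℂ (FreeStarAlgebra X) c)).unop) =
          MulOpposite.op (star (liftAlgHom v (algebraMap ℂ (FreeStarAlgebra X) c)))
        rw [starHom_algebraMap, MulOpposite.unop_op, AlgHom.commutes, AlgHom.commutes,
          algebraMap_star_comm]
      · change MulOpposite.op (liftAlgHom v (starHom (gen x)).unop) =
          MulOpposite.op (star (liftAlgHom v (gen x)))
        rw [starHom_gen, MulOpposite.unop_op, liftAlgHom_gen, liftAlgHom_gen]
        rcases x with ⟨x, _ | _⟩ <;> simp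
    exact congrArg MulOpposite.unop (RingHom.congr_fun h a)

theorem lift_gen [StarModule ℂ B] (v : X → B) (x : X) : lift v (gen (x, false)) = v x := by
  change liftAlgHom v _ = _
  rw [liftAlgHom_gen]
  simp

theorem starAlgHom_ext [StarModule ℂ B] {f g : FreeStarAlgebra X →⋆ₐ[ℂ] B}
    (h : ∀ x, f (gen (x, false)) = g (gen (x, false))) : f = g := by
  have key : (f : FreeStarAlgebra X →+* B) = (g : FreeStarAlgebra X →+* B) := by
    refine ringHom_ext (fun c => ?_) (fun x => ?_)
    · change f _ = g _
      rw [AlgHomClass.commutes, AlgHomClass.commutes]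
    · change f _ = g _
      rcases x with ⟨x, _ | _⟩
      · exact h x
      · rw [← star_gen, map_star, map_star, h x]
  exact DFunLike.ext _ _ fun a => RingHom.congr_fun key a

end FreeStarAlgebra

/-! ### Extension of morphisms to completions. -/

namespace CStarSeminorm

variable {𝒜 : Type*} [Ring 𝒜] [StarRing 𝒜] [Algebra ℂ 𝒜]

/-- The C⋆-seminorm induced by a morphism to a C⋆-algebra. -/
def ofHom {B : Type*} [CStarAlgebra B] (f : 𝒜 →⋆ₐ[ℂ] B) : CStarSeminorm 𝒜 where
  toFun a := ‖f a‖
  map_zero' := by simp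
  add_le' a b := by rw [map_add]; exact norm_add_le _ _
  neg' a := by simp
  smul' c a := by rw [map_smul, norm_smul]
  mul_le_mul' a b := by rw [map_mul]; exact norm_mul_le _ _
  star_mul_self' a := by rw [map_mul, map_star, CStarRing.norm_star_mul_self, sq]

theorem ofHom_apply {B : Type*} [CStarAlgebra B] (f : 𝒜 →⋆ₐ[ℂ] B) (a : 𝒜) :
    ofHom f a = ‖f a‖ := rfl

/-- Two continuous maps on the completion which agree on the image of `𝒜` are equal. -/
theorem completion_ext {p : CStarSeminorm 𝒜} {B : Type*} [TopologicalSpace B] [T2Space B]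
    {f g : p.Completion → B} (hf : Continuous f) (hg : Continuous g)
    (h : ∀ a, f (p.mkHom a) = g (p.mkHom a)) : f = g :=
  funext fun x => p.induction_on (P := fun x => f x = g x) x (isClosed_eq hf hg) h

theorem dense_range_mkHom (p : CStarSeminorm 𝒜) : DenseRange p.mkHom :=
  UniformSpace.Completion.denseRange_coe (α := p.Space)

section lift

variable [StarModule ℂ 𝒜] {B : Type*} [CStarAlgebra B] (p : CStarSeminorm 𝒜) (f : 𝒜 →⋆ₐ[ℂ] B)
  (h : ∀ a, ‖f a‖ ≤ p a)

/-- The ring morphism underlying `CStarSeminorm.lift`. -/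
def liftRingHom : p.Completion →+* B :=
  UniformSpace.Completion.extensionHom (α := p.Space) (f : 𝒜 →+* B)
    (AddMonoidHomClass.continuous_of_bound (show p.Space →+* B from (f : 𝒜 →+* B)) 1
      (fun a => by rw [one_mul]; exact h a))

theorem liftRingHom_mkHom (a : 𝒜) : liftRingHom p f h (p.mkHom a) = f a :=
  UniformSpace.Completion.extensionHom_coe (α := p.Space) _ _ a

theorem continuous_liftRingHom : Continuous (liftRingHom p f h) :=
  UniformSpace.Completion.continuous_extension (α := p.Space)

/-- A morphism to a C⋆-algebra which is bounded by `p` extends to the completion. -/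
def lift : p.Completion →⋆ₐ[ℂ] B where
  toRingHom := liftRingHom p f h
  commutes' c := by
    change liftRingHom p f h (p.mkHom (algebraMap ℂ 𝒜 c)) = _
    rw [liftRingHom_mkHom]
    exact AlgHomClass.commutes f c
  map_star' := by
    refine congrFun (completion_ext (p := p) ?_ ?_ fun a => ?_)
    · exact (continuous_liftRingHom p f h).comp continuous_star
    · exact continuous_star.comp (continuous_liftRingHom p f h)
    · change liftRingHom p f h (star (p.mkHom a)) = star (liftRingHom p f h (p.mkHom a))
      rw [← map_star, liftRingHom_mkHom, liftRingHom_mkHom, map_star]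

theorem lift_mkHom (a : 𝒜) : lift p f h (p.mkHom a) = f a := liftRingHom_mkHom p f h a

end lift

end CStarSeminorm

section

variable {𝒜 : Type*} [Ring 𝒜] [StarRing 𝒜] [Algebra ℂ 𝒜] [StarModule ℂ 𝒜]
  {B : Type*} [CStarAlgebra B]

/-- The universal property of the universal C⋆-algebra with given relations. -/
theorem exists_hom_of_relations {R : Set 𝒜} (hR : HasMaxSeminorm R) (f : 𝒜 →⋆ₐ[ℂ] B)
    (hf : ∀ r ∈ R, f r = 0) :
    ∃ g : (maxSeminorm R hR).Completion →⋆ₐ[ℂ] B, ∀ a, g (CStarSeminorm.mkHom _ a) = f a := by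
  have h : ∀ a, ‖f a‖ ≤ maxSeminorm R hR a := fun a =>
    le_maxSeminorm hR (CStarSeminorm.ofHom f) (fun r hr => by
      rw [CStarSeminorm.ofHom_apply, hf r hr, norm_zero]) a
  exact ⟨CStarSeminorm.lift _ f h, CStarSeminorm.lift_mkHom _ f h⟩

theorem mkHom_maxSeminorm_rel {R : Set 𝒜} (hR : HasMaxSeminorm R) {r : 𝒜} (hr : r ∈ R) :
    (maxSeminorm R hR).mkHom r = 0 := by
  rw [← norm_eq_zero, CStarSeminorm.norm_mkHom, maxSeminorm_rel hR hr]

end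

/-! ### Biunitary matrices and evaluation of noncommutative polynomials. -/

section Evaluation

variable {N : ℕ} {B : Type*} [Ring B] [StarRing B] [Algebra ℂ B]

/-- The matrix `v` and its transpose are unitary. -/
structure Biunitary (v : Matrix (Fin N) (Fin N) B) : Prop where
  mul_conjTranspose : v * v.conjTranspose = 1
  conjTranspose_mul : v.conjTranspose * v = 1
  map_star_mul_transpose : v.map star * v.transpose = 1
  transpose_mul_map_star : v.transpose * v.map star = 1

theorem Biunitary.relations {v : Matrix (Fin N) (Fin N) B} (hv : Biunitary v) :
    ∀ r ∈ biunitaryRelations v, r = 0 := by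
  rintro r ⟨i, j, h | h | h | h⟩
  · rw [h, hv.mul_conjTranspose, sub_self, Matrix.zero_apply]
  · rw [h, hv.conjTranspose_mul, sub_self, Matrix.zero_apply]
  · rw [h, hv.map_star_mul_transpose, sub_self, Matrix.zero_apply]
  · rw [h, hv.transpose_mul_map_star, sub_self, Matrix.zero_apply]

theorem Biunitary.of_relations {v : Matrix (Fin N) (Fin N) B}
    (h : ∀ r ∈ biunitaryRelations v, r = 0) : Biunitary v where
  mul_conjTranspose := sub_eq_zero.1 (Matrix.ext fun i j => h _ ⟨i, j, Or.inl rfl⟩)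
  conjTranspose_mul := sub_eq_zero.1 (Matrix.ext fun i j => h _ ⟨i, j, Or.inr (Or.inl rfl)⟩)
  map_star_mul_transpose :=
    sub_eq_zero.1 (Matrix.ext fun i j => h _ ⟨i, j, Or.inr (Or.inr (Or.inl rfl))⟩)
  transpose_mul_map_star :=
    sub_eq_zero.1 (Matrix.ext fun i j => h _ ⟨i, j, Or.inr (Or.inr (Or.inr rfl))⟩)

section map

variable {B' : Type*} [Ring B'] [StarRing B'] [Algebra ℂ B'] (f : B →⋆ₐ[ℂ] B')

theorem map_conjTranspose_hom {m n : Type*} (v : Matrix m n B) :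
    (v.map f).conjTranspose = v.conjTranspose.map f := by
  ext i j
  exact (map_star f _).symm

theorem map_star_hom {m n : Type*} (v : Matrix m n B) :
    (v.map f).map star = (v.map star).map f := by
  ext i j
  exact (map_star f _).symm

theorem map_mul_hom {l m n : Type*} [Fintype m] (v : Matrix l m B) (w : Matrix m n B) :
    (v * w).map f = v.map f * w.map f := by
  ext i j
  simp [Matrix.mul_apply]

theorem map_one_hom {n : Type*} [DecidableEq n] : (1 : Matrix n n B).map f = 1 :=
  Matrix.map_one f (map_zero f) (map_one f)

theorem map_sub_hom {m n : Type*} (v w : Matrix m n B) : (v - w).map f = v.map f - w.map f := by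
  ext i j
  simp

theorem Biunitary.map {v : Matrix (Fin N) (Fin N) B} (hv : Biunitary v) : Biunitary (v.map f) where
  mul_conjTranspose := by
    rw [map_conjTranspose_hom, ← map_mul_hom, hv.mul_conjTranspose, map_one_hom]
  conjTranspose_mul := by
    rw [map_conjTranspose_hom, ← map_mul_hom, hv.conjTranspose_mul, map_one_hom]
  map_star_mul_transpose := by
    rw [map_star_hom, ← Matrix.transpose_map, ← map_mul_hom, hv.map_star_mul_transpose, map_one_hom]
  transpose_mul_map_star := by
    rw [map_star_hom, ← Matrix.transpose_map, ← map_mul_hom, hv.transpose_mul_map_star, map_one_hom]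

theorem map_biunitaryRelations {v : Matrix (Fin N) (Fin N) B} {r : B}
    (hr : r ∈ biunitaryRelations v) : f r ∈ biunitaryRelations (v.map f) := by
  obtain ⟨i, j, h⟩ := hr
  refine ⟨i, j, ?_⟩
  rw [map_conjTranspose_hom, map_star_hom, ← Matrix.transpose_map, ← map_mul_hom, ← map_mul_hom,
    ← map_mul_hom, ← map_mul_hom, ← map_one_hom f, ← map_sub_hom, ← map_sub_hom, ← map_sub_hom,
    ← map_sub_hom]
  rcases h with rfl | rfl | rfl | rfl
  · exact Or.inl rfl
  · exact Or.inr (Or.inl rfl)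
  · exact Or.inr (Or.inr (Or.inl rfl))
  · exact Or.inr (Or.inr (Or.inr rfl))

theorem map_tensorPower (v : Matrix (Fin N) (Fin N) B) (k : Word) :
    (tensorPower v k).map f = tensorPower (v.map f) k := by
  ext i j
  simp only [tensorPower, Matrix.map_apply, Matrix.of_apply, map_list_prod, List.map_ofFn]
  congr 1
  congr 1
  funext t
  simp only [Function.comp_apply]
  cases k.get t
  · rfl
  · exact map_star f _

theorem map_algebraMap_hom {m n : Type*} (T : Matrix m n ℂ) :
    (T.map (algebraMap ℂ B)).map f = T.map (algebraMap ℂ B') := by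
  ext i j
  simp [AlgHomClass.commutes]

theorem map_defect (v : Matrix (Fin N) (Fin N) B) {k l : Word} (T : Op N k l) :
    (defect v T).map f = defect (v.map f) T := by
  rw [defect, defect, map_sub_hom, map_mul_hom, map_mul_hom, map_algebraMap_hom, map_tensorPower,
    map_tensorPower]

end map

theorem mem_homSpaces {v : Matrix (Fin N) (Fin N) B} {k l : Word} {T : Op N k l} :
    T ∈ homSpaces v k l ↔ T.map (algebraMap ℂ B) * tensorPower v k =
      tensorPower v l * T.map (algebraMap ℂ B) := Iff.rfl

theorem mem_homSpaces_iff_defect {v : Matrix (Fin N) (Fin N) B} {k l : Word} {T : Op N k l} :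
    T ∈ homSpaces v k l ↔ defect v T = 0 := by
  rw [mem_homSpaces, defect, sub_eq_zero]

theorem homSpaces_le_map {B' : Type*} [Ring B'] [StarRing B'] [Algebra ℂ B'] (f : B →⋆ₐ[ℂ] B')
    {v : Matrix (Fin N) (Fin N) B} {k l : Word} {T : Op N k l} (hT : T ∈ homSpaces v k l) :
    T ∈ homSpaces (v.map f) k l := by
  rw [mem_homSpaces_iff_defect] at hT ⊢
  rw [← map_defect, hT]
  ext i j
  simp

variable [StarModule ℂ B]

/-- The morphism from the free ⋆-algebra which maps the free generators to the entries of `v`. -/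
def ev (v : Matrix (Fin N) (Fin N) B) : FreeStarAlgebra (Fin N × Fin N) →⋆ₐ[ℂ] B :=
  FreeStarAlgebra.lift fun x => v x.1 x.2

theorem freeMatrix_map_ev (v : Matrix (Fin N) (Fin N) B) : (freeMatrix N).map (ev v) = v := by
  ext i j
  exact FreeStarAlgebra.lift_gen (fun x : Fin N × Fin N => v x.1 x.2) (i, j)

theorem ev_freeMatrix_apply (v : Matrix (Fin N) (Fin N) B) (i j : Fin N) :
    ev v (freeMatrix N i j) = v i j :=
  FreeStarAlgebra.lift_gen (fun x : Fin N × Fin N => v x.1 x.2) (i, j)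

theorem hom_comp_ev {B' : Type*} [Ring B'] [StarRing B'] [Algebra ℂ B'] [StarModule ℂ B']
    (f : B →⋆ₐ[ℂ] B') (v : Matrix (Fin N) (Fin N) B) : f.comp (ev v) = ev (v.map f) := by
  refine FreeStarAlgebra.starAlgHom_ext fun x => ?_
  have h := ev_freeMatrix_apply (v.map f) x.1 x.2
  rw [Matrix.map_apply, ← ev_freeMatrix_apply v] at h
  exact h.symm

end Evaluation

/-! ### `C(U_N^+)` and `A_C` as universal objects. -/

section Universal

variable {N : ℕ} {B : Type*} [CStarAlgebra B]

theorem FreeUnitary.biunitary (N : ℕ) : Biunitary (FreeUnitary.u N) := by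
  refine Biunitary.of_relations fun r hr => ?_
  obtain ⟨s, hs, rfl⟩ : ∃ s ∈ biunitaryRelations (freeMatrix N),
      (maxSeminorm _ (hasMaxSeminorm_biunitary N)).mkHom s = r := by
    obtain ⟨i, j, h⟩ := hr
    rw [FreeUnitary.u, map_conjTranspose_hom, map_star_hom, ← Matrix.transpose_map, ← map_mul_hom,
      ← map_mul_hom, ← map_mul_hom, ← map_mul_hom, ← map_one_hom
        (maxSeminorm _ (hasMaxSeminorm_biunitary N)).mkHom, ← map_sub_hom, ← map_sub_hom,
      ← map_sub_hom, ← map_sub_hom] at h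
    rcases h with h | h | h | h
    · exact ⟨_, ⟨i, j, Or.inl rfl⟩, h.symm⟩
    · exact ⟨_, ⟨i, j, Or.inr (Or.inl rfl)⟩, h.symm⟩
    · exact ⟨_, ⟨i, j, Or.inr (Or.inr (Or.inl rfl))⟩, h.symm⟩
    · exact ⟨_, ⟨i, j, Or.inr (Or.inr (Or.inr rfl))⟩, h.symm⟩
  exact mkHom_maxSeminorm_rel _ hs

/-- The universal property of `C(U_N^+)`. -/
theorem FreeUnitary.exists_hom {v : Matrix (Fin N) (Fin N) B} (hv : Biunitary v) :
    ∃ f : FreeUnitary N →⋆ₐ[ℂ] B, (FreeUnitary.u N).map f = v := by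
  obtain ⟨g, hg⟩ := exists_hom_of_relations (hasMaxSeminorm_biunitary N) (ev v) fun r hr => by
    have := map_biunitaryRelations (ev v) hr
    rw [freeMatrix_map_ev] at this
    exact hv.relations _ this
  refine ⟨g, ?_⟩
  ext i j
  rw [Matrix.map_apply, FreeUnitary.u, Matrix.map_apply, hg, ev_freeMatrix_apply]

theorem TannakaAlgebra.biunitary (C : HomSpaces N) : Biunitary (TannakaAlgebra.u C) :=
  (FreeUnitary.biunitary N).map _

theorem TannakaAlgebra.le_homSpaces (C : HomSpaces N) {k l : Word} {T : Op N k l}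
    (hT : T ∈ C k l) : T ∈ homSpaces (TannakaAlgebra.u C) k l := by
  rw [mem_homSpaces_iff_defect, TannakaAlgebra.u, ← map_defect]
  ext i j
  rw [Matrix.map_apply]
  exact mkHom_maxSeminorm_rel _ ⟨k, l, T, hT, i, j, rfl⟩

/-- The universal property of `A_C`. -/
theorem TannakaAlgebra.exists_hom {C : HomSpaces N} {v : Matrix (Fin N) (Fin N) B}
    (hv : Biunitary v) (hC : ∀ k l, C k l ≤ homSpaces v k l) :
    ∃ f : TannakaAlgebra C →⋆ₐ[ℂ] B, (TannakaAlgebra.u C).map f = v := by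
  obtain ⟨f, hf⟩ := FreeUnitary.exists_hom hv
  obtain ⟨g, hg⟩ := exists_hom_of_relations (hasMaxSeminorm_quotient (intertwiningRelations C)) f
    (by
      rintro r ⟨k, l, T, hT, i, j, rfl⟩
      have h := mem_homSpaces_iff_defect.1 (hC k l hT)
      rw [← hf, ← map_defect] at h
      exact congrFun (congrFun h i) j)
  refine ⟨g, ?_⟩
  rw [← hf]
  ext i j
  rw [Matrix.map_apply, TannakaAlgebra.u, Matrix.map_apply, hg, Matrix.map_apply]

/-- The ⋆-algebra of smooth elements is the image of the free ⋆-algebra. -/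
theorem range_ev (u : Matrix (Fin N) (Fin N) B) : (ev u).range = smooth u := by
  apply le_antisymm
  · rintro _ ⟨a, rfl⟩
    -- Evaluating inside the subalgebra and then including it shows that the values stay in it.
    let g : FreeStarAlgebra (Fin N × Fin N) →⋆ₐ[ℂ] smooth u :=
      ev (Matrix.of fun i j => ⟨u i j, entry_mem_smooth u i j⟩)
    have h : (smooth u).subtype.comp g = ev u := by
      rw [hom_comp_ev]
      rfl
    rw [← h]
    exact (g a).2
  · refine StarAlgebra.adjoin_le ?_
    rintro _ ⟨ij, rfl⟩
    exact ⟨freeMatrix N ij.1 ij.2, ev_freeMatrix_apply u _ _⟩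

/-- `A_C` is a completion of a completion of the free ⋆-algebra, so the noncommutative polynomials
in `u` are dense. -/
theorem TannakaAlgebra.smooth_topologicalClosure (C : HomSpaces N) :
    (smooth (TannakaAlgebra.u C)).topologicalClosure = ⊤ := by
  set q := maxSeminorm _ (hasMaxSeminorm_quotient (intertwiningRelations C))
  set p := maxSeminorm _ (hasMaxSeminorm_biunitary N)
  have hq : Continuous q.mkHom :=
    AddMonoidHomClass.continuous_of_bound q.mkHom 1 fun a => by
      rw [one_mul]; exact NonUnitalStarAlgHom.norm_apply_le q.mkHom a
  have h : DenseRange (q.mkHom ∘ p.mkHom) :=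
    q.dense_range_mkHom.comp p.dense_range_mkHom hq
  have h2 : ∀ a, q.mkHom (p.mkHom a) = ev (TannakaAlgebra.u C) a := by
    intro a
    have : (q.mkHom.comp p.mkHom) = ev (TannakaAlgebra.u C) := by
      refine FreeStarAlgebra.starAlgHom_ext fun x => ?_
      exact (ev_freeMatrix_apply (TannakaAlgebra.u C) x.1 x.2).symm
    exact DFunLike.congr_fun this a
  refine top_unique fun x _ => ?_
  refine closure_mono ?_ (h x)
  rintro _ ⟨a, rfl⟩
  rw [SetLike.mem_coe, ← range_ev]
  exact ⟨a, (h2 a).symm⟩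

end Universal

/-! ### Tensor powers and intertwiners -/

section TensorPower

variable {N : ℕ}

/-- Summation over multi-indices, letter by letter. -/
theorem Idx.sum_cons {M : Type*} [AddCommMonoid M] (c : Color) (k : Word)
    (f : Idx N (c :: k) → M) :
    ∑ z, f z = ∑ a : Fin N, ∑ z : Idx N k, f (Fin.cons a z : Fin (k.length + 1) → Fin N) := by
  rw [← Fintype.sum_prod_type']
  exact (Fintype.sum_equiv (Fin.consEquiv fun _ : Fin (k.length + 1) => Fin N) _ _
    fun _ => rfl).symm

theorem Idx.sum_nil {M : Type*} [AddCommMonoid M] (f : Idx N [] → M) (i : Idx N []) :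
    ∑ z, f z = f i := by
  have : Unique (Idx N []) := inferInstanceAs (Unique (Fin 0 → Fin N))
  rw [Fintype.sum_unique]
  exact congrArg f (Subsingleton.elim _ _)

/-- Concatenation of multi-indices. -/
def Idx.append {k l : Word} : Idx N k × Idx N l ≃ Idx N (k ++ l) where
  toFun z t := Fin.append z.1 z.2 (Fin.cast List.length_append t)
  invFun i := (i.fst, i.snd)
  left_inv z := by
    refine Prod.ext ?_ ?_
    · funext t
      exact Fin.append_left z.1 z.2 t
    · funext t
      exact Fin.append_right z.1 z.2 t
  right_inv i := by
    funext t
    obtain ⟨t, ht⟩ := t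
    have h : ∀ s : Fin (k.length + l.length),
        Fin.append (Idx.fst i) (Idx.snd i) s = i (Fin.cast List.length_append.symm s) := by
      intro s
      refine Fin.addCases (fun s => ?_) (fun s => ?_) s
      · rw [Fin.append_left]; rfl
      · rw [Fin.append_right]; rfl
    exact h _

theorem Idx.append_fst {k l : Word} (z : Idx N k × Idx N l) : (Idx.append z).fst = z.1 :=
  congrArg Prod.fst (Idx.append.left_inv z)

theorem Idx.append_snd {k l : Word} (z : Idx N k × Idx N l) : (Idx.append z).snd = z.2 :=
  congrArg Prod.snd (Idx.append.left_inv z)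

theorem Idx.sum_append {M : Type*} [AddCommMonoid M] {k l : Word} (f : Idx N (k ++ l) → M) :
    ∑ z, f z = ∑ x : Idx N k, ∑ y : Idx N l, f (Idx.append (x, y)) := by
  rw [← Fintype.sum_prod_type']
  exact (Fintype.sum_equiv Idx.append _ _ fun _ => rfl).symm

/-! ### Tensor powers of a biunitary matrix are unitary. -/

section Ring

variable {A : Type*} [Ring A] [StarRing A]

theorem tensorPower_nil (u : Matrix (Fin N) (Fin N) A) (i j : Idx N []) :
    tensorPower u [] i j = 1 := by
  simp [tensorPower]

theorem tensorPower_cons (u : Matrix (Fin N) (Fin N) A) (c : Color) (k : Word) (a b : Fin N)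
    (i j : Idx N k) :
    tensorPower u (c :: k) (Fin.cons a i : Fin (k.length + 1) → Fin N)
      (Fin.cons b j : Fin (k.length + 1) → Fin N) = colored u c a b * tensorPower u k i j := by
  simp only [tensorPower, Matrix.of_apply]
  change (List.ofFn (n := k.length + 1) _).prod = _
  rw [List.ofFn_succ, List.prod_cons]
  rfl

/-- `Idx N (c :: k)` unfolds to functions on `Fin (k.length + 1)`; the ascriptions on `Fin.cons`
rely on this, and inductions on words split indices this way. -/
theorem Idx.cons_induction {c : Color} {k : Word} {P : Idx N (c :: k) → Prop}
    (h : ∀ a z, P (Fin.cons a z : Fin (k.length + 1) → Fin N)) (i : Idx N (c :: k)) : P i := by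
  have := h (i 0) (fun t => i t.succ)
  rwa [show (Fin.cons (i 0) (fun t => i t.succ) : Fin (k.length + 1) → Fin N) = i from
    Fin.cons_self_tail (α := fun _ => Fin N) i] at this

theorem Idx.cons_inj {k : Word} {a b : Fin N} {x y : Idx N k} :
    (Fin.cons a x : Fin (k.length + 1) → Fin N) = Fin.cons b y ↔ a = b ∧ x = y :=
  Fin.cons_inj

theorem tensorPower_append (u : Matrix (Fin N) (Fin N) A) {k l : Word} (i j : Idx N (k ++ l)) :
    tensorPower u (k ++ l) i j =
      tensorPower u k i.fst j.fst * tensorPower u l i.snd j.snd := by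
  simp only [tensorPower, Matrix.of_apply]
  rw [← List.prod_append]
  congr 1
  refine List.ext_getElem (by simp) fun n h1 h2 => ?_
  simp only [List.getElem_ofFn, List.getElem_append, List.length_ofFn]
  simp only [List.length_ofFn, List.length_append] at h1
  split_ifs with h
  · simp [Idx.fst, List.getElem_append, h]
  · have : k.length + (n - k.length) = n := by omega
    simp [Idx.snd, List.getElem_append, h, this]

theorem colored_mul_star {u : Matrix (Fin N) (Fin N) A} (hu : Biunitary u) (c : Color)
    (a b : Fin N) : ∑ d, colored u c a d * star (colored u c b d) = if a = b then 1 else 0 := by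
  rw [← Matrix.one_apply]
  cases c
  · rw [← hu.mul_conjTranspose]
    rfl
  · rw [← hu.map_star_mul_transpose]
    simp [colored, Matrix.mul_apply]

theorem star_colored_mul {u : Matrix (Fin N) (Fin N) A} (hu : Biunitary u) (c : Color)
    (a b : Fin N) : ∑ d, star (colored u c d a) * colored u c d b = if a = b then 1 else 0 := by
  rw [← Matrix.one_apply]
  cases c
  · rw [← hu.conjTranspose_mul]
    rfl
  · rw [← hu.transpose_mul_map_star]
    simp [colored, Matrix.mul_apply]

/-- In `(x y)(x' y')^* = x (y y'^*) x'^*` the tail of the word is innermost: it is contracted first,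
by induction, leaving a scalar between the first letters. -/
theorem tensorPower_mul_conjTranspose {u : Matrix (Fin N) (Fin N) A} (hu : Biunitary u)
    (k : Word) : tensorPower u k * (tensorPower u k).conjTranspose = 1 := by
  induction k with
  | nil =>
    ext i j
    rw [Matrix.mul_apply, Idx.sum_nil _ i, Matrix.conjTranspose_apply, tensorPower_nil,
      tensorPower_nil, Subsingleton.elim (α := Fin 0 → Fin N) i j, Matrix.one_apply_eq, star_one,
      one_mul]
  | cons c k ih =>
    ext i j
    induction i using Idx.cons_induction with | h a i
    induction j using Idx.cons_induction with | h b j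
    have h : ∀ d, ∑ z : Idx N k, tensorPower u (c :: k) (Fin.cons a i : Fin (k.length + 1) → Fin N)
        (Fin.cons d z : Fin (k.length + 1) → Fin N) *
        star (tensorPower u (c :: k) (Fin.cons b j : Fin (k.length + 1) → Fin N)
          (Fin.cons d z : Fin (k.length + 1) → Fin N)) =
        colored u c a d * (1 : Matrix (Idx N k) (Idx N k) A) i j * star (colored u c b d) := by
      intro d
      rw [← ih, Matrix.mul_apply, Finset.mul_sum, Finset.sum_mul]
      refine Finset.sum_congr rfl fun z _ => ?_
      rw [tensorPower_cons, tensorPower_cons, star_mul, Matrix.conjTranspose_apply]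
      noncomm_ring
    rw [Matrix.mul_apply, Idx.sum_cons]
    simp only [Matrix.conjTranspose_apply]
    rw [Finset.sum_congr rfl fun d _ => h d]
    simp only [Matrix.one_apply, Idx.cons_inj]
    by_cases hij : i = j
    · simp only [hij, if_true, mul_one, and_true]
      exact colored_mul_star hu c a b
    · simp [hij]

/-- Here `(x y)^* (x' y') = y^* (x^* x') y'`, so the first letter is innermost; the sums are
exchanged to contract it before the tail. -/
theorem conjTranspose_tensorPower_mul {u : Matrix (Fin N) (Fin N) A} (hu : Biunitary u)
    (k : Word) : (tensorPower u k).conjTranspose * tensorPower u k = 1 := by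
  induction k with
  | nil =>
    ext i j
    rw [Matrix.mul_apply, Idx.sum_nil _ i, Matrix.conjTranspose_apply, tensorPower_nil,
      tensorPower_nil, Subsingleton.elim (α := Fin 0 → Fin N) i j, Matrix.one_apply_eq, star_one,
      one_mul]
  | cons c k ih =>
    ext i j
    induction i using Idx.cons_induction with | h a i
    induction j using Idx.cons_induction with | h b j
    rw [Matrix.mul_apply, Idx.sum_cons, Finset.sum_comm]
    have h : ∀ z, ∑ d, (tensorPower u (c :: k)).conjTranspose
        (Fin.cons a i : Fin (k.length + 1) → Fin N) (Fin.cons d z : Fin (k.length + 1) → Fin N) *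
        tensorPower u (c :: k) (Fin.cons d z : Fin (k.length + 1) → Fin N)
          (Fin.cons b j : Fin (k.length + 1) → Fin N) =
        star (tensorPower u k z i) * (if a = b then 1 else 0) * tensorPower u k z j := by
      intro z
      rw [← star_colored_mul hu c, Finset.mul_sum, Finset.sum_mul]
      refine Finset.sum_congr rfl fun d _ => ?_
      rw [Matrix.conjTranspose_apply, tensorPower_cons, tensorPower_cons, star_mul]
      noncomm_ring
    rw [Finset.sum_congr rfl fun d _ => h d]
    by_cases hab : a = b
    · simp only [hab, if_true, mul_one, Matrix.one_apply, Idx.cons_inj, true_and]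
      rw [← Matrix.one_apply, ← ih]
      rfl
    · simp [hab, Matrix.one_apply, Idx.cons_inj]

end Ring

/-! ### The intertwiners of a biunitary matrix form a tensor category. -/

section Intertwiners

variable {A : Type*} [Ring A] [StarRing A] [Algebra ℂ A]

theorem one_mem_homSpaces (u : Matrix (Fin N) (Fin N) A) (k : Word) :
    (1 : Op N k k) ∈ homSpaces u k k := by
  rw [mem_homSpaces, Matrix.map_one _ (map_zero _) (map_one _), one_mul, mul_one]

theorem map_mul_algebraMap {l m n : Type*} [Fintype m] (S : Matrix l m ℂ) (T : Matrix m n ℂ) :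
    (S * T).map (algebraMap ℂ A) = S.map (algebraMap ℂ A) * T.map (algebraMap ℂ A) :=
  Matrix.map_mul

theorem mul_mem_homSpaces {u : Matrix (Fin N) (Fin N) A} {k l m : Word} {S : Op N l m}
    {T : Op N k l} (hS : S ∈ homSpaces u l m) (hT : T ∈ homSpaces u k l) :
    S * T ∈ homSpaces u k m := by
  rw [mem_homSpaces] at *
  rw [map_mul_algebraMap, Matrix.mul_assoc, hT, ← Matrix.mul_assoc, hS, Matrix.mul_assoc]

theorem conjTranspose_map_algebraMap [StarModule ℂ A] {m n : Type*} (T : Matrix m n ℂ) :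
    T.conjTranspose.map (algebraMap ℂ A) = (T.map (algebraMap ℂ A)).conjTranspose := by
  ext i j
  exact algebraMap_star_comm (T j i)

/-- The adjoint of an intertwiner intertwines the adjoints. -/
theorem conjTranspose_mul_of_mem_homSpaces {u : Matrix (Fin N) (Fin N) A} (hu : Biunitary u)
    {k l : Word} {T : Op N k l} (hT : T ∈ homSpaces u k l) :
    (tensorPower u l).conjTranspose * T.map (algebraMap ℂ A) =
      T.map (algebraMap ℂ A) * (tensorPower u k).conjTranspose := by
  rw [mem_homSpaces] at hT
  calc (tensorPower u l).conjTranspose * T.map (algebraMap ℂ A)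
      = (tensorPower u l).conjTranspose * (T.map (algebraMap ℂ A) * tensorPower u k) *
          (tensorPower u k).conjTranspose := by
        rw [Matrix.mul_assoc, Matrix.mul_assoc, tensorPower_mul_conjTranspose hu, Matrix.mul_one]
    _ = _ := by
        rw [hT, ← Matrix.mul_assoc, conjTranspose_tensorPower_mul hu, Matrix.one_mul]

theorem conjTranspose_mem_homSpaces [StarModule ℂ A] {u : Matrix (Fin N) (Fin N) A}
    (hu : Biunitary u) {k l : Word} {T : Op N k l} (hT : T ∈ homSpaces u k l) :
    T.conjTranspose ∈ homSpaces u l k := by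
  have h := congrArg Matrix.conjTranspose (conjTranspose_mul_of_mem_homSpaces hu hT)
  rw [Matrix.conjTranspose_mul, Matrix.conjTranspose_mul, Matrix.conjTranspose_conjTranspose,
    Matrix.conjTranspose_conjTranspose, ← conjTranspose_map_algebraMap] at h
  exact h

/-- Multiply the two entrywise identities; only central scalars have to be moved. -/
theorem tensor_mem_homSpaces {u : Matrix (Fin N) (Fin N) A} {k l p q : Word} {S : Op N k l}
    {T : Op N p q} (hS : S ∈ homSpaces u k l) (hT : T ∈ homSpaces u p q) :
    S.tensor T ∈ homSpaces u (k ++ p) (l ++ q) := by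
  rw [mem_homSpaces] at *
  ext i j
  have h1 := congrFun (congrFun hS i.fst) j.fst
  have h2 := congrFun (congrFun hT i.snd) j.snd
  rw [Matrix.mul_apply, Matrix.mul_apply] at h1 h2
  rw [Matrix.mul_apply, Matrix.mul_apply, Idx.sum_append, Idx.sum_append]
  have h3 := congrArg₂ (· * ·) h1 h2
  simp only [Finset.sum_mul_sum] at h3
  refine Eq.trans ?_ (h3.trans ?_)
  all_goals
    refine Finset.sum_congr rfl fun x _ => Finset.sum_congr rfl fun y _ => ?_
    rw [tensorPower_append, Idx.append_fst, Idx.append_snd]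
    simp only [Matrix.map_apply, Op.tensor, Matrix.of_apply, Idx.append_fst, Idx.append_snd,
      map_mul]
  · rw [mul_assoc, ← mul_assoc _ (tensorPower u k _ _), Algebra.commutes (T i.snd y)]
    simp only [mul_assoc]
  · rw [mul_assoc, ← mul_assoc (algebraMap ℂ A (S x j.fst)), Algebra.commutes (S x j.fst)]
    simp only [mul_assoc]

/-- The conjugate color. -/
def Color.flip : Color → Color
  | .white => .black
  | .black => .white

theorem colored_flip (u : Matrix (Fin N) (Fin N) A) (c : Color) (a b : Fin N) :
    colored u c.flip a b = star (colored u c a b) := by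
  cases c
  · rfl
  · exact (star_star _).symm

theorem opR_cons_cons (c d : Color) (a b : Fin N) (z i : Idx N []) :
    opR N c d (Fin.cons a (Fin.cons b z : Fin (0 + 1) → Fin N) : Fin (0 + 1 + 1) → Fin N) i =
      if a = b then 1 else 0 := rfl

theorem tensorPower_pair (u : Matrix (Fin N) (Fin N) A) (c d : Color) (a b a' b' : Fin N)
    (z z' : Idx N []) : tensorPower u [c, d]
      (Fin.cons a (Fin.cons b z : Fin (0 + 1) → Fin N) : Fin (0 + 1 + 1) → Fin N)
      (Fin.cons a' (Fin.cons b' z' : Fin (0 + 1) → Fin N) : Fin (0 + 1 + 1) → Fin N) =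
      colored u c a a' * colored u d b b' := by
  have h1 := tensorPower_cons u c [d] a a' (Fin.cons b z : Fin (0 + 1) → Fin N)
    (Fin.cons b' z' : Fin (0 + 1) → Fin N)
  have h2 := tensorPower_cons u d [] b b' z z'
  rw [tensorPower_nil, mul_one] at h2
  exact h1.trans (congrArg _ h2)

/-- That `R` intertwines is exactly the relation `u^c (u^c)^* = 1`; the adjoint of `R`, treated
next, encodes `(u^c)^* u^c = 1`. With both colors this is biunitarity, and the formulas serve in
both directions. -/
theorem defect_opR (u : Matrix (Fin N) (Fin N) A) (c : Color) (a b : Fin N) (z i : Idx N []) :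
    defect u (opR N c c.flip)
      (Fin.cons a (Fin.cons b z : Fin (0 + 1) → Fin N) : Fin (0 + 1 + 1) → Fin N) i =
      (if a = b then 1 else 0) - ∑ d, colored u c a d * star (colored u c b d) := by
  rw [defect, Matrix.sub_apply, Matrix.mul_apply, Matrix.mul_apply, Idx.sum_nil _ i,
    tensorPower_nil, mul_one, Matrix.map_apply]
  congr 1
  · rw [opR_cons_cons, apply_ite (algebraMap ℂ A), map_one, map_zero]
  · rw [Idx.sum_cons]
    simp only [Idx.sum_cons]
    refine Finset.sum_congr rfl fun d _ => ?_
    refine (Finset.sum_eq_single d (fun e _ hde => ?_) (by simp)).trans ?_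
    · rw [Idx.sum_nil _ i, Matrix.map_apply, opR_cons_cons, if_neg (Ne.symm hde), map_zero,
        mul_zero]
    · rw [Idx.sum_nil _ i, Matrix.map_apply, opR_cons_cons, if_pos rfl, map_one, mul_one,
        ← colored_flip]
      exact tensorPower_pair u c c.flip a b d d z i

theorem defect_conjTranspose_opR (u : Matrix (Fin N) (Fin N) A) (c : Color) (a b : Fin N)
    (z i : Idx N []) :
    defect u (opR N c.flip c).conjTranspose i
      (Fin.cons a (Fin.cons b z : Fin (0 + 1) → Fin N) : Fin (0 + 1 + 1) → Fin N) =
      ∑ d, star (colored u c d a) * colored u c d b - if a = b then 1 else 0 := by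
  rw [defect, Matrix.sub_apply, Matrix.mul_apply, Matrix.mul_apply, Idx.sum_nil _ i,
    tensorPower_nil, one_mul, Matrix.map_apply]
  congr 1
  · rw [Idx.sum_cons]
    simp only [Idx.sum_cons]
    refine Finset.sum_congr rfl fun d _ => ?_
    refine (Finset.sum_eq_single d (fun e _ hde => ?_) (by simp)).trans ?_
    · rw [Idx.sum_nil _ i, Matrix.map_apply, Matrix.conjTranspose_apply, opR_cons_cons,
        if_neg (Ne.symm hde), star_zero, map_zero, zero_mul]
    · rw [Idx.sum_nil _ i, Matrix.map_apply, Matrix.conjTranspose_apply, opR_cons_cons,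
        if_pos rfl, star_one, map_one, one_mul, ← colored_flip]
      exact tensorPower_pair u c.flip c d d a b i z
  · rw [Matrix.conjTranspose_apply, opR_cons_cons, apply_ite star, star_one, star_zero,
      apply_ite (algebraMap ℂ A), map_one, map_zero]

theorem opR_mem_homSpaces {u : Matrix (Fin N) (Fin N) A} (hu : Biunitary u) (c : Color) :
    opR N c c.flip ∈ homSpaces u [] [c, c.flip] := by
  rw [mem_homSpaces_iff_defect]
  ext i j
  induction i using Idx.cons_induction with | h a i
  induction i using Idx.cons_induction with | h b i
  rw [Matrix.zero_apply]
  exact (defect_opR u c a b i j).trans (by rw [colored_mul_star hu, sub_self])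

theorem Biunitary.isTensorCategory [StarModule ℂ A] {u : Matrix (Fin N) (Fin N) A}
    (hu : Biunitary u) : IsTensorCategory (homSpaces u) where
  tensor_mem := tensor_mem_homSpaces
  comp_mem := mul_mem_homSpaces
  adjoint_mem := conjTranspose_mem_homSpaces hu
  id_mem := one_mem_homSpaces u
  opR_white_black_mem := opR_mem_homSpaces hu .white
  opR_black_white_mem := opR_mem_homSpaces hu .black

end Intertwiners

/-! ### Products of commuting matrices -/

section Product

variable {A A' B : Type*} [Ring A] [StarRing A] [Algebra ℂ A] [Ring A'] [StarRing A']
  [Algebra ℂ A'] [Ring B] [StarRing B] [Algebra ℂ B] {f : A →⋆ₐ[ℂ] B} {g : A' →⋆ₐ[ℂ] B}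

theorem conjTranspose_mul_of_commute (hfg : ∀ a b, Commute (f a) (g b)) {l m n : Type*}
    [Fintype m] (u : Matrix l m A) (v : Matrix m n A') :
    (u.map f * v.map g).map star = (u.map star).map f * (v.map star).map g := by
  ext i j
  rw [Matrix.map_apply, Matrix.mul_apply, Matrix.mul_apply, star_sum]
  refine Finset.sum_congr rfl fun k _ => ?_
  simp only [Matrix.map_apply, map_star, star_mul]
  rw [← map_star, ← map_star, (hfg _ _).eq]

theorem colored_mul_of_commute (hfg : ∀ a b, Commute (f a) (g b)) (u : Matrix (Fin N) (Fin N) A)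
    (v : Matrix (Fin N) (Fin N) A') (c : Color) :
    colored (u.map f * v.map g) c = (colored u c).map f * (colored v c).map g := by
  cases c
  · rfl
  · exact conjTranspose_mul_of_commute hfg u v

/-- For `f`, `g` the two inclusions in the maximal tensor product, this computes the
comultiplication on tensor powers. -/
theorem tensorPower_mul_of_commute (hfg : ∀ a b, Commute (f a) (g b))
    (u : Matrix (Fin N) (Fin N) A) (v : Matrix (Fin N) (Fin N) A') (k : Word) :
    tensorPower (u.map f * v.map g) k = (tensorPower u k).map f * (tensorPower v k).map g := by
  induction k with
  | nil =>
    ext i j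
    rw [tensorPower_nil, Matrix.mul_apply, Idx.sum_nil _ i, Matrix.map_apply, Matrix.map_apply,
      tensorPower_nil, tensorPower_nil, map_one, map_one, one_mul]
  | cons c k ih =>
    ext i j
    induction i using Idx.cons_induction with | h a i
    induction j using Idx.cons_induction with | h b j
    rw [tensorPower_cons, ih, colored_mul_of_commute hfg, Matrix.mul_apply, Matrix.mul_apply,
      Finset.sum_mul_sum, Matrix.mul_apply, Idx.sum_cons]
    refine Finset.sum_congr rfl fun d _ => Finset.sum_congr rfl fun z _ => ?_
    simp only [Matrix.map_apply]
    -- The `g`-part of the first letter is moved past the `f`-part of the tail.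
    rw [tensorPower_cons, tensorPower_cons, map_mul, map_mul, mul_assoc, mul_assoc,
      ← mul_assoc (g _), ← mul_assoc (f (tensorPower u k i z)), (hfg _ _).eq]

theorem Biunitary.mul_of_commute (hfg : ∀ a b, Commute (f a) (g b))
    {u : Matrix (Fin N) (Fin N) A} {v : Matrix (Fin N) (Fin N) A'} (hu : Biunitary u)
    (hv : Biunitary v) : Biunitary (u.map f * v.map g) := by
  have hu' := hu.map f
  have hv' := hv.map g
  have hT : (u.map f * v.map g).transpose = (v.map g).transpose * (u.map f).transpose := by
    ext i j
    simp only [Matrix.transpose_apply, Matrix.mul_apply]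
    exact Finset.sum_congr rfl fun k _ => (hfg _ _).eq
  have hS : (u.map f * v.map g).map star = (u.map f).map star * (v.map g).map star := by
    rw [conjTranspose_mul_of_commute hfg, map_star_hom, map_star_hom]
  constructor
  · rw [Matrix.conjTranspose_mul, Matrix.mul_assoc, ← Matrix.mul_assoc (v.map g),
      hv'.mul_conjTranspose, Matrix.one_mul, hu'.mul_conjTranspose]
  · rw [Matrix.conjTranspose_mul, Matrix.mul_assoc, ← Matrix.mul_assoc _ (u.map f),
      hu'.conjTranspose_mul, Matrix.one_mul, hv'.conjTranspose_mul]
  · rw [hT, hS, Matrix.mul_assoc, ← Matrix.mul_assoc _ _ (u.map f).transpose,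
      hv'.map_star_mul_transpose, Matrix.one_mul, hu'.map_star_mul_transpose]
  · rw [hT, hS, Matrix.mul_assoc, ← Matrix.mul_assoc _ _ ((v.map g).map star),
      hu'.transpose_mul_map_star, Matrix.one_mul, hv'.transpose_mul_map_star]

theorem mem_homSpaces_mul_of_commute (hfg : ∀ a b, Commute (f a) (g b))
    {u : Matrix (Fin N) (Fin N) A} {v : Matrix (Fin N) (Fin N) A'} {k l : Word} {T : Op N k l}
    (hu : T ∈ homSpaces u k l) (hv : T ∈ homSpaces v k l) :
    T ∈ homSpaces (u.map f * v.map g) k l := by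
  have hu' := homSpaces_le_map f hu
  have hv' := homSpaces_le_map g hv
  rw [mem_homSpaces] at *
  rw [tensorPower_mul_of_commute hfg, tensorPower_mul_of_commute hfg]
  rw [← map_tensorPower, ← map_tensorPower] at hu' hv'
  rw [← Matrix.mul_assoc, hu', Matrix.mul_assoc, hv', Matrix.mul_assoc]

end Product

/-! ### The opposite algebra -/

section Opposite

variable {A : Type*} [Ring A] [StarRing A] [Algebra ℂ A]

/-- The matrix with entries `u_ji^*`, over the opposite algebra. -/
def opMatrix (u : Matrix (Fin N) (Fin N) A) : Matrix (Fin N) (Fin N) Aᵐᵒᵖ :=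
  Matrix.of fun i j => MulOpposite.op (star (u j i))

/-- The star reverses the order of the letters and the opposite product reverses it back. -/
theorem tensorPower_opMatrix (u : Matrix (Fin N) (Fin N) A) (k : Word) :
    tensorPower (opMatrix u) k = (tensorPower u k).conjTranspose.map MulOpposite.op := by
  induction k with
  | nil =>
    ext i j
    rw [Matrix.map_apply, Matrix.conjTranspose_apply, tensorPower_nil, tensorPower_nil, star_one,
      MulOpposite.op_one]
  | cons c k ih =>
    ext i j
    induction i using Idx.cons_induction with | h a i
    induction j using Idx.cons_induction with | h b j
    rw [tensorPower_cons, ih, Matrix.map_apply, Matrix.map_apply, Matrix.conjTranspose_apply,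
      Matrix.conjTranspose_apply, tensorPower_cons, star_mul, MulOpposite.op_mul]
    cases c <;> rfl

/-- Passing to the opposite algebra exchanges the unitarity of `u` with that of `u^t`, so both are
needed. -/
theorem Biunitary.opMatrix {u : Matrix (Fin N) (Fin N) A} (hu : Biunitary u) :
    Biunitary (opMatrix u) := by
  have h1 : ∀ i j : Fin N, MulOpposite.op ((1 : Matrix (Fin N) (Fin N) A) i j) =
      (1 : Matrix (Fin N) (Fin N) Aᵐᵒᵖ) j i := by
    intro i j
    rw [Matrix.one_apply, Matrix.one_apply, apply_ite MulOpposite.op]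
    simp only [eq_comm, MulOpposite.op_one, MulOpposite.op_zero]
  constructor
  all_goals
    ext i j
    rw [← h1]
  · rw [← hu.transpose_mul_map_star]
    simp [Tannaka.opMatrix, Matrix.mul_apply, Finset.op_sum]
  · rw [← hu.map_star_mul_transpose]
    simp [Tannaka.opMatrix, Matrix.mul_apply, Finset.op_sum]
  · rw [← hu.conjTranspose_mul]
    simp [Tannaka.opMatrix, Matrix.mul_apply, Finset.op_sum]
  · rw [← hu.mul_conjTranspose]
    simp [Tannaka.opMatrix, Matrix.mul_apply, Finset.op_sum]

/-- This is the intertwining relation between the adjoints of the tensor powers, read in the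
opposite algebra. -/
theorem mem_homSpaces_opMatrix {u : Matrix (Fin N) (Fin N) A} (hu : Biunitary u) {k l : Word}
    {T : Op N k l} (hT : T ∈ homSpaces u k l) : T ∈ homSpaces (opMatrix u) k l := by
  have h := conjTranspose_mul_of_mem_homSpaces hu hT
  rw [mem_homSpaces, tensorPower_opMatrix, tensorPower_opMatrix]
  ext i j
  have h' := congrArg MulOpposite.op (congrFun (congrFun h i) j)
  rw [Matrix.mul_apply, Matrix.mul_apply, Finset.op_sum, Finset.op_sum] at h'
  rw [Matrix.mul_apply, Matrix.mul_apply]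
  refine Eq.trans ?_ (h'.symm.trans ?_)
  · refine Finset.sum_congr rfl fun z _ => ?_
    rw [Matrix.map_apply, Matrix.map_apply, MulOpposite.op_mul]
    exact Algebra.commutes _ _
  · refine Finset.sum_congr rfl fun z _ => ?_
    rw [Matrix.map_apply, Matrix.map_apply, MulOpposite.op_mul]
    exact Algebra.commutes (T z j) (MulOpposite.op ((tensorPower u l).conjTranspose i z))

end Opposite

end TensorPower

/-! ### The Woronowicz algebra associated to a tensor category -/

section

variable {N : ℕ} {A B : Type*} [CStarAlgebra A] [CStarAlgebra B]

/-- The left inclusion into the maximal tensor product. -/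
def MaxTensor.inl : A →⋆ₐ[ℂ] MaxTensor A B :=
  (maxSeminorm ∅ (hasMaxSeminorm_tensor A B)).mkHom.comp
    { (Algebra.TensorProduct.includeLeft : A →ₐ[ℂ] A ⊗[ℂ] B) with
      map_star' := fun a => by simp }

/-- The right inclusion into the maximal tensor product. -/
def MaxTensor.inr : B →⋆ₐ[ℂ] MaxTensor A B :=
  (maxSeminorm ∅ (hasMaxSeminorm_tensor A B)).mkHom.comp
    { (Algebra.TensorProduct.includeRight : B →ₐ[ℂ] A ⊗[ℂ] B) with
      map_star' := fun a => by simp }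

theorem MaxTensor.inl_mul_inr (a : A) (b : B) :
    MaxTensor.inl a * MaxTensor.inr b = MaxTensor.tmul a b := by
  change (maxSeminorm ∅ (hasMaxSeminorm_tensor A B)).mkHom (a ⊗ₜ 1) *
    (maxSeminorm ∅ (hasMaxSeminorm_tensor A B)).mkHom (1 ⊗ₜ b) = _
  rw [← map_mul, Algebra.TensorProduct.tmul_mul_tmul, mul_one, one_mul]
  rfl

theorem MaxTensor.commute_inl_inr (a : A) (b : B) :
    Commute (MaxTensor.inl a : MaxTensor A B) (MaxTensor.inr b) := by
  rw [Commute, SemiconjBy, MaxTensor.inl_mul_inr]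
  change _ = (maxSeminorm ∅ (hasMaxSeminorm_tensor A B)).mkHom (1 ⊗ₜ b) *
    (maxSeminorm ∅ (hasMaxSeminorm_tensor A B)).mkHom (a ⊗ₜ 1)
  rw [← map_mul, Algebra.TensorProduct.tmul_mul_tmul, mul_one, one_mul]
  rfl

theorem tensorPower_one (k : Word) : tensorPower (1 : Matrix (Fin N) (Fin N) ℂ) k = 1 := by
  induction k with
  | nil =>
    ext i j
    rw [tensorPower_nil, Subsingleton.elim (α := Fin 0 → Fin N) i j, Matrix.one_apply_eq]
  | cons c k ih =>
    ext i j
    induction i using Idx.cons_induction with | h a i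
    induction j using Idx.cons_induction with | h b j
    have hc : colored (1 : Matrix (Fin N) (Fin N) ℂ) c = 1 := by
      cases c
      · rfl
      · exact Matrix.map_one _ (star_zero _) (star_one _)
    rw [tensorPower_cons, ih, hc]
    simp only [Matrix.one_apply, Idx.cons_inj, ite_and, ite_mul, one_mul, zero_mul]

theorem homSpaces_one (k l : Word) (T : Op N k l) :
    T ∈ homSpaces (1 : Matrix (Fin N) (Fin N) ℂ) k l := by
  rw [mem_homSpaces, tensorPower_one, tensorPower_one, Matrix.mul_one, Matrix.one_mul]

theorem Biunitary.one : Biunitary (1 : Matrix (Fin N) (Fin N) ℂ) := by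
  have h : (1 : Matrix (Fin N) (Fin N) ℂ).map star = 1 :=
    Matrix.map_one _ (star_zero _) (star_one _)
  constructor <;> simp [h]

/-- The universal property yields the three morphisms once `(∑ u_ik ⊗ u_kj)`, the scalar unit matrix
and `(u_ji^*)` over the opposite algebra are biunitary and intertwined by every `T ∈ C`. -/
theorem TannakaAlgebra.isWoronowicz (C : HomSpaces N) : IsWoronowicz (TannakaAlgebra.u C) where
  unitary := by
    have h := TannakaAlgebra.biunitary C
    exact ⟨h.conjTranspose_mul, h.mul_conjTranspose⟩
  generates := TannakaAlgebra.smooth_topologicalClosure C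
  comul := by
    have h := TannakaAlgebra.biunitary C
    have hc := MaxTensor.commute_inl_inr (A := TannakaAlgebra C) (B := TannakaAlgebra C)
    obtain ⟨f, hf⟩ := TannakaAlgebra.exists_hom (C := C) (h.mul_of_commute hc h)
      fun k l T hT => mem_homSpaces_mul_of_commute hc (TannakaAlgebra.le_homSpaces C hT)
        (TannakaAlgebra.le_homSpaces C hT)
    refine ⟨f, fun i j => ?_⟩
    have := congrFun (congrFun hf i) j
    rw [Matrix.map_apply, Matrix.mul_apply] at this
    rw [this]
    exact Finset.sum_congr rfl fun k _ => MaxTensor.inl_mul_inr _ _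
  counit := by
    obtain ⟨f, hf⟩ := TannakaAlgebra.exists_hom (C := C) Biunitary.one
      fun k l T _ => homSpaces_one k l T
    refine ⟨f, fun i j => ?_⟩
    rw [← Matrix.one_apply, ← hf, Matrix.map_apply]
  antipode := by
    have h := TannakaAlgebra.biunitary C
    obtain ⟨f, hf⟩ := TannakaAlgebra.exists_hom (C := C) h.opMatrix
      fun k l T hT => mem_homSpaces_opMatrix h (TannakaAlgebra.le_homSpaces C hT)
    refine ⟨f, fun i j => ?_⟩
    exact congrFun (congrFun hf i) j

/-- The antipode reverses products and sends `u_ij` to `u_ji^*`, so it turns `u^* u = 1` and `u u^*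
= 1` into the relations for `ū` and `u^t`. -/
theorem IsWoronowicz.biunitary {u : Matrix (Fin N) (Fin N) A} (hu : IsWoronowicz u) :
    Biunitary u := by
  obtain ⟨S, hS⟩ := hu.antipode
  have hS' : ∀ i j, S (star (u i j)) = MulOpposite.op (u j i) := by
    intro i j
    rw [map_star, hS]
    exact congrArg MulOpposite.op (star_star _)
  have h1 : u * u.conjTranspose = 1 := hu.unitary.2
  have h2 : u.conjTranspose * u = 1 := hu.unitary.1
  refine ⟨h1, h2, ?_, ?_⟩
  all_goals
    ext i j
    refine MulOpposite.op_injective ?_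
    have h0 : MulOpposite.op ((1 : Matrix (Fin N) (Fin N) A) i j) =
        S ((1 : Matrix (Fin N) (Fin N) A) j i) := by
      rw [Matrix.one_apply, Matrix.one_apply]
      by_cases hij : i = j
      · simp [hij]
      · simp [hij, Ne.symm hij]
    rw [h0, Matrix.mul_apply, Finset.op_sum]
  · rw [← h2, Matrix.mul_apply, map_sum]
    refine Finset.sum_congr rfl fun k _ => ?_
    rw [map_mul, hS, Matrix.conjTranspose_apply, hS', ← MulOpposite.op_mul]
    rfl
  · rw [← h1, Matrix.mul_apply, map_sum]
    refine Finset.sum_congr rfl fun k _ => ?_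
    rw [map_mul, hS, Matrix.conjTranspose_apply, hS', ← MulOpposite.op_mul]
    rfl

end

/-! ### Parseval frames and the bicommutant theorem for matrices -/

section Frame

open Matrix
open scoped ComplexOrder

variable {l m n ι κ : Type*} [Fintype m] [Fintype n] [Fintype ι] [Fintype κ]

/-- A Parseval frame of a linear space of matrices, for the inner product `Tr(x^* y)`. -/
structure IsParsevalFrame (S : Submodule ℂ (Matrix m n ℂ)) (X : ι → Matrix m n ℂ) : Prop where
  mem : ∀ α, X α ∈ S
  sum_smul : ∀ x ∈ S, ∑ α, trace ((X α)ᴴ * x) • X α = x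

/-- An orthonormal basis for the Hilbert–Schmidt product is a frame. Frames are preferred to bases
because the blocks of a frame are again a frame, although they may be linearly dependent. -/
theorem exists_isParsevalFrame (S : Submodule ℂ (Matrix m n ℂ)) :
    ∃ (r : ℕ) (X : Fin r → Matrix m n ℂ), IsParsevalFrame S X := by
  let e : Matrix m n ℂ ≃ₗ[ℂ] EuclideanSpace ℂ (m × n) :=
    (LinearEquiv.curry ℂ ℂ m n).symm ≪≫ₗ (WithLp.linearEquiv 2 ℂ (m × n → ℂ)).symm
  have he : ∀ x y : Matrix m n ℂ, inner ℂ (e x) (e y) = trace (xᴴ * y) := by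
    intro x y
    simp only [PiLp.inner_apply, RCLike.inner_apply, trace, diag_apply, mul_apply,
      conjTranspose_apply]
    rw [Fintype.sum_prod_type, Finset.sum_comm]
    exact Finset.sum_congr rfl fun _ _ => Finset.sum_congr rfl fun _ _ => mul_comm _ _
  let b := stdOrthonormalBasis ℂ (S.map (e : Matrix m n ℂ →ₗ[ℂ] EuclideanSpace ℂ (m × n)))
  have hb : ∀ α, ∃ x ∈ S, e x = b α := fun α => (b α).2
  choose X hXS hX using hb
  refine ⟨_, X, hXS, fun x hx => ?_⟩
  have h := b.sum_repr' (⟨e x, x, hx, rfl⟩ :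
    S.map (e : Matrix m n ℂ →ₗ[ℂ] EuclideanSpace ℂ (m × n)))
  have h' := congrArg Subtype.val h
  apply e.injective
  simp only [Submodule.coe_sum, Submodule.coe_smul, Submodule.coe_inner, ← hX, he] at h'
  rw [map_sum]
  simpa using h'

theorem star_trace_conjTranspose_mul (x y : Matrix m n ℂ) :
    star (trace (xᴴ * y)) = trace (yᴴ * x) := by
  rw [← trace_conjTranspose, conjTranspose_mul, conjTranspose_conjTranspose]

/-- The kernels of the orthogonal projections on two spaces of matrices are intertwined by any map
which maps the first space to the second one, and whose adjoint maps the second one to the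
first one. -/
theorem IsParsevalFrame.intertwine [Fintype l] {S : Submodule ℂ (Matrix m n ℂ)}
    {S' : Submodule ℂ (Matrix l n ℂ)} {X : ι → Matrix m n ℂ} {Y : κ → Matrix l n ℂ}
    (hX : IsParsevalFrame S X) (hY : IsParsevalFrame S' Y) (T : Matrix l m ℂ)
    (hT : ∀ x ∈ S, T * x ∈ S') (hT' : ∀ y ∈ S', Tᴴ * y ∈ S) (i : l) (j : n) (p : m) (q : n) :
    ∑ α, (T * X α) i j * star (X α p q) = ∑ β, Y β i j * star ((Tᴴ * Y β) p q) := by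
  -- Expand `T X_α` in the frame `Y` and `T^* Y_β` in the frame `X`; the two coefficient matrices
  -- are adjoint to each other.
  have h1 : ∀ α, (T * X α) i j = ∑ β, trace ((Y β)ᴴ * (T * X α)) * Y β i j := by
    intro α
    conv_lhs => rw [← hY.sum_smul _ (hT _ (hX.mem α))]
    simp [Matrix.sum_apply]
  have h2 : ∀ β, (Tᴴ * Y β) p q = ∑ α, trace ((X α)ᴴ * (Tᴴ * Y β)) * X α p q := by
    intro β
    conv_lhs => rw [← hX.sum_smul _ (hT' _ (hY.mem β))]
    simp [Matrix.sum_apply]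
  have h3 : ∀ α β, star (trace ((X α)ᴴ * (Tᴴ * Y β))) = trace ((Y β)ᴴ * (T * X α)) := by
    intro α β
    rw [star_trace_conjTranspose_mul, conjTranspose_mul, conjTranspose_conjTranspose,
      Matrix.mul_assoc]
  simp only [h1, h2, star_sum, star_mul', h3, Finset.sum_mul, Finset.mul_sum]
  rw [Finset.sum_comm]
  exact Finset.sum_congr rfl fun _ _ => Finset.sum_congr rfl fun _ _ => by ring

/-- The kernel of the orthogonal projection does not depend on the choice of the frame. -/
theorem IsParsevalFrame.kernel_eq {S : Submodule ℂ (Matrix m n ℂ)} {X : ι → Matrix m n ℂ}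
    {Y : κ → Matrix m n ℂ} (hX : IsParsevalFrame S X) (hY : IsParsevalFrame S Y) (i : m) (j : n)
    (p : m) (q : n) :
    ∑ α, X α i j * star (X α p q) = ∑ β, Y β i j * star (Y β p q) := by
  classical
  simpa using hX.intertwine hY 1 (by simp) (by simp) i j p q

section Algebra

variable [DecidableEq n] {S : StarSubalgebra ℂ (Matrix n n ℂ)} {X : ι → Matrix n n ℂ}

/-- Taking adjoints is antiunitary for `Tr(x^* y)` and preserves `S`. -/
theorem IsParsevalFrame.conjTranspose (hX : IsParsevalFrame S.toSubalgebra.toSubmodule X) :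
    IsParsevalFrame S.toSubalgebra.toSubmodule fun α => (X α)ᴴ where
  mem α := star_mem (S := StarSubalgebra ℂ (Matrix n n ℂ)) (s := S) (hX.mem α)
  sum_smul x hx := by
    have h := congrArg Matrix.conjTranspose
      (hX.sum_smul xᴴ (star_mem (S := StarSubalgebra ℂ (Matrix n n ℂ)) (s := S) hx))
    rw [conjTranspose_conjTranspose, conjTranspose_sum] at h
    conv_rhs => rw [← h]
    refine Finset.sum_congr rfl fun α _ => ?_
    rw [conjTranspose_smul, star_trace_conjTranspose_mul, conjTranspose_conjTranspose,
      conjTranspose_conjTranspose, trace_mul_comm]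

/-- The averaging map of a matrix algebra takes its values in the commutant. -/
theorem IsParsevalFrame.mul_average (hX : IsParsevalFrame S.toSubalgebra.toSubmodule X)
    (a : Matrix n n ℂ) {b : Matrix n n ℂ} (hb : b ∈ S) :
    b * ∑ α, X α * a * (X α)ᴴ = (∑ α, X α * a * (X α)ᴴ) * b := by
  -- In tensor form, `∑ b X_α ⊗ conj(X_α) = ∑ X_α ⊗ conj(b^* X_α)`; contracting with `a` gives the
  -- claim.
  have key := hX.intertwine hX b (fun x hx => mul_mem (S := StarSubalgebra ℂ (Matrix n n ℂ)) (s := S) hb hx)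
    (fun x hx => mul_mem (S := StarSubalgebra ℂ (Matrix n n ℂ)) (s := S) (star_mem hb) hx)
  ext i j
  rw [Finset.mul_sum, Finset.sum_mul, Matrix.sum_apply, Matrix.sum_apply]
  have h1 : ∀ α, (b * (X α * a * (X α)ᴴ)) i j =
      ∑ q, ∑ p, a p q * ((b * X α) i p * star (X α j q)) := by
    intro α
    rw [← Matrix.mul_assoc, ← Matrix.mul_assoc, Matrix.mul_apply]
    refine Finset.sum_congr rfl fun q _ => ?_
    rw [Matrix.mul_apply, Finset.sum_mul]
    refine Finset.sum_congr rfl fun p _ => ?_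
    rw [conjTranspose_apply]
    ring
  have h2 : ∀ α, (X α * a * (X α)ᴴ * b) i j =
      ∑ q, ∑ p, a p q * (X α i p * star ((bᴴ * X α) j q)) := by
    intro α
    rw [Matrix.mul_assoc, Matrix.mul_apply]
    refine Finset.sum_congr rfl fun q _ => ?_
    rw [Matrix.mul_apply, Finset.sum_mul]
    refine Finset.sum_congr rfl fun p _ => ?_
    rw [← conjTranspose_apply (bᴴ * X α), conjTranspose_mul, conjTranspose_conjTranspose]
    ring
  simp only [h1, h2]
  rw [Finset.sum_comm, Finset.sum_comm (s := Finset.univ (α := ι))]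
  refine Finset.sum_congr rfl fun q _ => ?_
  rw [Finset.sum_comm, Finset.sum_comm (s := Finset.univ (α := ι))]
  refine Finset.sum_congr rfl fun p _ => ?_
  rw [← Finset.mul_sum, ← Finset.mul_sum, key]

/-- The expansion of the unit in the adjoint frame; it shows in particular that the `X_α^*` have no
common kernel. -/
theorem IsParsevalFrame.sum_trace_smul_conjTranspose
    (hX : IsParsevalFrame S.toSubalgebra.toSubmodule X) :
    ∑ α, trace (X α) • (X α)ᴴ = 1 := by
  have := hX.conjTranspose.sum_smul 1 (one_mem S)
  simpa using this

/-- The bicommutant theorem for ⋆-algebras of matrices. -/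
theorem mem_of_commute_commutant {S : StarSubalgebra ℂ (Matrix n n ℂ)} {y : Matrix n n ℂ}
    (hy : ∀ a : Matrix n n ℂ, (∀ b ∈ S, b * a = a * b) → y * a = a * y) : y ∈ S := by
  obtain ⟨r, X, hX⟩ := exists_isParsevalFrame S.toSubalgebra.toSubmodule
  -- Since `y` commutes with the averages of all matrix units, `∑ y X_α ⊗ X_α^* = ∑ X_α ⊗ X_α^* y`.
  have h1 : ∀ i j p q, ∑ α, (y * X α) i p * (X α)ᴴ q j = ∑ α, X α i p * ((X α)ᴴ * y) q j := by
    intro i j p q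
    have h2 := hy (∑ α, X α * single p q 1 * (X α)ᴴ) fun b hb => hX.mul_average _ hb
    have h3 := congrFun (congrFun h2 i) j
    rw [Finset.mul_sum, Finset.sum_mul, Matrix.sum_apply, Matrix.sum_apply] at h3
    have h4 : ∀ A B : Matrix n n ℂ, (A * (single p q 1 : Matrix n n ℂ) * B) i j = A i p * B q j := by
      intro A B
      rw [Matrix.mul_apply, Finset.sum_eq_single q]
      · simp
      · intro k _ hk
        rw [Matrix.mul_single_apply_of_ne _ _ _ _ _ hk]
        simp
      · simp
    have h5 : ∀ α, (y * (X α * (single p q 1 : Matrix n n ℂ) * (X α)ᴴ)) i j = (y * X α) i p * (X α)ᴴ q j := by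
      intro α
      rw [← Matrix.mul_assoc, ← Matrix.mul_assoc, h4]
    have h6 : ∀ α, (X α * (single p q 1 : Matrix n n ℂ) * (X α)ᴴ * y) i j = X α i p * ((X α)ᴴ * y) q j := by
      intro α
      rw [Matrix.mul_assoc, h4]
    simpa only [h5, h6] using h3
  -- The trace of the first leg turns the right-hand side into `(∑ Tr(X_α) X_α^*) y = y`, so `y` is
  -- a combination of the `X_α^*`.
  have h5 : ∑ α, trace (y * X α) • (X α)ᴴ = y := by
    ext q j
    have h6 : ∑ α, trace (y * X α) * (X α)ᴴ q j = ∑ α, trace (X α) * ((X α)ᴴ * y) q j := by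
      simp only [trace, diag_apply, Finset.sum_mul]
      rw [Finset.sum_comm, Finset.sum_comm (s := Finset.univ (α := Fin r))]
      exact Finset.sum_congr rfl fun i _ => h1 i j i q
    have h7 : ∑ α, trace (X α) • ((X α)ᴴ * y) = y := by
      simp only [← Matrix.smul_mul]
      rw [← Finset.sum_mul, hX.sum_trace_smul_conjTranspose, Matrix.one_mul]
    conv_rhs => rw [← h7]
    simpa [Matrix.sum_apply] using h6
  rw [← h5]
  exact sum_mem fun α _ => S.toSubalgebra.smul_mem (S.star_mem' (hX.mem α)) _

/-- The quadratic form `a ↦ ∑ Tr(a^* X a X^*)` is positive, and its kernel is orthogonal to the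
commutant. -/
theorem IsParsevalFrame.average_nonneg (hX : IsParsevalFrame S.toSubalgebra.toSubmodule X)
    (a : Matrix n n ℂ) :
    0 ≤ trace (aᴴ * ∑ α, X α * a * (X α)ᴴ) ∧
      (trace (aᴴ * ∑ α, X α * a * (X α)ᴴ) = 0 →
        ∀ b : Matrix n n ℂ, (∀ x ∈ S, x * b = b * x) → trace (bᴴ * a) = 0) := by
  -- The averaging map `Ψ` is self-adjoint with values in the commutant, where it is multiplication
  -- by the invertible element `z`. Hence `c = Ψ(a) z⁻¹` is the orthogonal projection of `a` onto
  -- the commutant, and the form equals `Tr(c^* z c)`, which is positive and vanishes only for `c =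
  -- 0`.
  set Ψ : Matrix n n ℂ → Matrix n n ℂ := fun a => ∑ α, X α * a * (X α)ᴴ with hΨ
  set z : Matrix n n ℂ := ∑ α, X α * (X α)ᴴ with hz
  have hΨ_mem : ∀ a, ∀ x ∈ S, x * Ψ a = Ψ a * x := fun a x hx => hX.mul_average a hx
  have hzS : ∀ x ∈ S, x * z = z * x := by
    intro x hx
    have := hX.mul_average 1 hx
    simpa only [Matrix.mul_one] using this
  have hΨ_comm : ∀ b, (∀ x ∈ S, x * b = b * x) → Ψ b = b * z := by
    intro b hb
    simp only [hΨ, hz, Finset.mul_sum]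
    refine Finset.sum_congr rfl fun α _ => ?_
    rw [hb _ (hX.mem α), Matrix.mul_assoc]
  have hinj : ∀ c : Matrix n n ℂ, (∀ α, (X α)ᴴ * c = 0) → c = 0 := by
    intro c hc
    rw [← Matrix.one_mul c, ← hX.sum_trace_smul_conjTranspose, Finset.sum_mul]
    exact Finset.sum_eq_zero fun α _ => by rw [Matrix.smul_mul, hc, smul_zero]
  have hquad : ∀ c : Matrix n n ℂ, trace (cᴴ * z * c) = ∑ α, trace (((X α)ᴴ * c)ᴴ * ((X α)ᴴ * c)) := by
    intro c
    rw [hz, Finset.mul_sum, Finset.sum_mul, trace_sum]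
    refine Finset.sum_congr rfl fun α _ => ?_
    rw [conjTranspose_mul, conjTranspose_conjTranspose]
    simp only [Matrix.mul_assoc]
  have hpos : ∀ c : Matrix n n ℂ, 0 ≤ trace (cᴴ * c) := fun c =>
    (posSemidef_conjTranspose_mul_self c).trace_nonneg
  have hquad_zero : ∀ c : Matrix n n ℂ, trace (cᴴ * z * c) = 0 → c = 0 := by
    intro c hc
    rw [hquad] at hc
    refine hinj c fun α => ?_
    have := (Finset.sum_eq_zero_iff_of_nonneg fun α _ => hpos _).1 hc α (Finset.mem_univ α)
    exact trace_conjTranspose_mul_self_eq_zero_iff.1 this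
  have hunit : IsUnit z := by
    rw [← Matrix.mulVec_injective_iff_isUnit]
    refine (injective_iff_map_eq_zero (Matrix.mulVecLin z)).2 fun v hv => ?_
    -- A vector becomes a matrix with all columns equal to it, so that `hquad_zero` applies.
    have h1 : z * Matrix.of (fun i (_ : n) => v i) = 0 := by
      ext i j
      exact congrFun hv i
    have h2 := hquad_zero (Matrix.of fun i (_ : n) => v i) (by
      rw [Matrix.mul_assoc, h1, Matrix.mul_zero, trace_zero])
    funext i
    exact congrFun (congrFun h2 i) i
  have hdet : IsUnit z.det := (Matrix.isUnit_iff_isUnit_det z).1 hunit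
  have hzinv : ∀ x, x * z = z * x → x * z⁻¹ = z⁻¹ * x := by
    intro x hx
    calc x * z⁻¹ = z⁻¹ * (z * x) * z⁻¹ := by
          rw [← Matrix.mul_assoc, Matrix.nonsing_inv_mul _ hdet, Matrix.one_mul]
      _ = z⁻¹ * x := by
          rw [← hx, Matrix.mul_assoc, Matrix.mul_assoc, Matrix.mul_nonsing_inv _ hdet,
            Matrix.mul_one]
  have hadj : ∀ b a, trace (bᴴ * Ψ a) = trace ((Ψ b)ᴴ * a) := by
    intro b a
    -- The adjoints of a frame are a frame of the same algebra, with the same kernel.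
    have h1 : Ψ b = ∑ α, (X α)ᴴ * b * X α := by
      ext i j
      have hk := hX.kernel_eq hX.conjTranspose
      simp only [hΨ, Matrix.sum_apply, Matrix.mul_apply, Finset.sum_mul, conjTranspose_apply]
      rw [Finset.sum_comm, Finset.sum_comm (s := Finset.univ (α := ι))]
      refine Finset.sum_congr rfl fun q _ => ?_
      rw [Finset.sum_comm, Finset.sum_comm (s := Finset.univ (α := ι))]
      refine Finset.sum_congr rfl fun p _ => ?_
      have := congrArg (fun t => b p q * t) (hk i p j q)
      simp only [Finset.mul_sum, conjTranspose_apply, star_star] at this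
      refine Eq.trans (Finset.sum_congr rfl fun α _ => ?_)
        (this.trans (Finset.sum_congr rfl fun α _ => ?_)) <;> ring
    rw [h1]
    simp only [hΨ, conjTranspose_sum, Finset.mul_sum, Finset.sum_mul, trace_sum]
    refine Finset.sum_congr rfl fun α _ => ?_
    rw [conjTranspose_mul, conjTranspose_mul, conjTranspose_conjTranspose, ← Matrix.mul_assoc,
      trace_mul_comm]
    simp only [Matrix.mul_assoc]
  have hcomm_inv : ∀ b, (∀ x ∈ S, x * b = b * x) → ∀ x ∈ S, x * (b * z⁻¹) = (b * z⁻¹) * x := by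
    intro b hb x hx
    rw [← Matrix.mul_assoc, hb x hx, Matrix.mul_assoc, hzinv x (hzS x hx), Matrix.mul_assoc]
  have hΨ_inv : ∀ b, (∀ x ∈ S, x * b = b * x) → Ψ (b * z⁻¹) = b := by
    intro b hb
    rw [hΨ_comm _ (hcomm_inv b hb), Matrix.mul_assoc, Matrix.nonsing_inv_mul _ hdet,
      Matrix.mul_one]
  set c := Ψ a * z⁻¹ with hc
  have hΨc : Ψ c = Ψ a := hΨ_inv _ (hΨ_mem a)
  have hcS : ∀ x ∈ S, x * c = c * x := hcomm_inv _ (hΨ_mem a)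
  have hzS_mem : z ∈ S := sum_mem fun α _ => mul_mem (hX.mem α) (star_mem (hX.mem α))
  have hz_herm : zᴴ = z := by
    simp [hz, conjTranspose_sum]
  -- As `Ψ(c) = Ψ(a)`, self-adjointness allows `a` to be replaced by `c` on each side in turn.
  have hQ : trace (aᴴ * Ψ a) = trace (cᴴ * z * c) := by
    calc trace (aᴴ * Ψ a) = trace (aᴴ * Ψ c) := by rw [hΨc]
      _ = trace (cᴴ * Ψ c) := by rw [hadj, ← hΨc, ← hadj]
      _ = trace (cᴴ * z * c) := by rw [hΨ_comm c hcS, ← hcS z hzS_mem, Matrix.mul_assoc]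
  change 0 ≤ trace (aᴴ * Ψ a) ∧ (trace (aᴴ * Ψ a) = 0 → _)
  rw [hQ]
  refine ⟨?_, fun h0 b hb => ?_⟩
  · rw [hquad]
    exact Finset.sum_nonneg fun α _ => hpos _
  · have hc0 := hquad_zero c h0
    rw [← hΨ_inv b hb, ← hadj, ← hΨc, hΨ_comm c hcS, hc0, Matrix.zero_mul, Matrix.mul_zero,
      trace_zero]

end Algebra

end Frame

/-! ### Positive functionals -/

section PositiveFunctional

open scoped ComplexOrder

/-- A positive linear functional on a ⋆-algebra. -/
def IsPositiveFunctional {𝒜 : Type*} [Ring 𝒜] [StarRing 𝒜] [Algebra ℂ 𝒜] (φ : 𝒜 →ₗ[ℂ] ℂ) :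
    Prop :=
  ∀ a, 0 ≤ φ (star a * a)

/-- The positive functionals separate the points of a C⋆-algebra. -/
theorem eq_zero_of_forall_positive {A : Type*} [CStarAlgebra A] {a : A}
    (ha : ∀ φ : A →ₗ[ℂ] ℂ, IsPositiveFunctional φ → φ a = 0) : a = 0 := by
  let := CStarAlgebra.spectralOrder A
  have := CStarAlgebra.spectralOrderedRing A
  -- If `b + b^*` is not positive, Hahn–Banach separates it from the positive cone by a real
  -- functional `f`. The complexification of `x ↦ f(x + x^*)` is positive, and its real part at `b`
  -- is negative. Applying this to `±a` and `±i a` makes both parts of `a` vanish.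
  have key : ∀ b : A, (∀ φ : A →ₗ[ℂ] ℂ, IsPositiveFunctional φ → φ b = 0) → 0 ≤ b + star b := by
    intro b hb
    by_contra hneg
    obtain ⟨f, hf, hfb⟩ := (ProperCone.positive ℝ A).hyperplane_separation_point
      (x₀ := b + star b) hneg
    let g : Module.Dual ℝ A :=
      { toFun x := f (x + star x)
        map_add' x y := by rw [star_add, ← map_add]; congr 1; abel
        map_smul' c x := by
          rw [star_smul, star_trivial, ← smul_add, map_smul, RingHom.id_apply] }
    have hg : ∀ x, g x = f (x + star x) := fun _ => rfl
    have hφ : IsPositiveFunctional (g.extendRCLike : A →ₗ[ℂ] ℂ) := by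
      intro x
      rw [Module.Dual.extendRCLike_apply, hg, hg]
      have h1 : RCLike.I (K := ℂ) • (star x * x) + star (RCLike.I (K := ℂ) • (star x * x)) = 0 := by
        rw [star_smul, star_mul, star_star, ← add_smul]
        simp
      have h2 : 0 ≤ f (star x * x + star (star x * x)) := by
        refine hf _ ?_
        change 0 ≤ star x * x + star (star x * x)
        rw [star_mul, star_star]
        exact add_nonneg (star_mul_self_nonneg x) (star_mul_self_nonneg x)
      rw [h1, map_zero, RCLike.ofReal_zero, mul_zero, sub_zero]
      exact RCLike.ofReal_nonneg.2 h2
    have h3 := hb _ hφ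
    have h4 := congrArg RCLike.re h3
    rw [Module.Dual.re_extendRCLike_apply, hg, map_zero] at h4
    exact hfb.ne h4
  have hsmul : ∀ c : ℂ, ∀ φ : A →ₗ[ℂ] ℂ, IsPositiveFunctional φ → φ (c • a) = 0 := by
    intro c φ hφ
    rw [map_smul, ha φ hφ, smul_zero]
  have h1 : a + star a = 0 := by
    refine le_antisymm ?_ (key a ha)
    have := key _ (hsmul (-1))
    rw [star_smul, neg_smul, one_smul] at this
    simp only [star_neg, star_one, neg_smul, one_smul] at this
    rw [← neg_add] at this
    exact neg_nonneg.1 this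
  have h2 : Complex.I • a + star (Complex.I • a) = 0 := by
    refine le_antisymm ?_ (key _ (hsmul Complex.I))
    have := key _ (hsmul (-Complex.I))
    rw [neg_smul, star_neg, ← neg_add] at this
    exact neg_nonneg.1 this
  rw [star_smul, Complex.star_def, Complex.conj_I, neg_smul, ← sub_eq_add_neg, ← smul_sub,
    smul_eq_zero_iff_right Complex.I_ne_zero] at h2
  have h3 : (2 : ℂ) • a = 0 := by
    rw [two_smul]
    have h4 : a = star a := sub_eq_zero.1 h2
    nth_rw 2 [h4]
    exact h1
  exact (smul_eq_zero_iff_right two_ne_zero).1 h3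

variable {𝒜 : Type*} [Ring 𝒜] [StarRing 𝒜] [Algebra ℂ 𝒜] [StarModule ℂ 𝒜] {φ : 𝒜 →ₗ[ℂ] ℂ}

namespace IsPositiveFunctional

/-- Polarization: `φ(z^* z)` is real for `z = x + y` and for `z = x + i y`. -/
theorem apply_star_mul (hφ : IsPositiveFunctional φ) (x y : 𝒜) :
    star (φ (star y * x)) = φ (star x * y) := by
  have im0 : ∀ a : 𝒜, (φ (star a * a)).im = 0 := fun a => ((Complex.nonneg_iff.1 (hφ a)).2).symm
  have h1 := im0 (x + y)
  have h2 := im0 (x + Complex.I • y)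
  simp only [star_add, add_mul, mul_add, map_add, Complex.add_im, im0, star_smul,
    Algebra.smul_mul_assoc, Algebra.mul_smul_comm, map_smul] at h1 h2
  simp [im0] at h1 h2
  refine Complex.ext ?_ ?_
  · simp
    linarith
  · simp
    linarith

/-- The semi-inner product associated to a positive functional. -/
@[reducible]
def core (hφ : IsPositiveFunctional φ) : PreInnerProductSpace.Core ℂ 𝒜 where
  inner x y := φ (star x * y)
  conj_inner_symm x y := hφ.apply_star_mul x y
  re_inner_nonneg x := (Complex.nonneg_iff.1 (hφ x)).1
  add_left x y z := by rw [star_add, add_mul, map_add]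
  smul_left x y r := by
    rw [star_smul, Algebra.smul_mul_assoc, map_smul]
    rfl

/-- The seminorm associated to a positive functional. -/
def norm (_hφ : IsPositiveFunctional φ) (x : 𝒜) : ℝ := √(φ (star x * x)).re

theorem norm_nonneg (hφ : IsPositiveFunctional φ) (x : 𝒜) : 0 ≤ hφ.norm x := Real.sqrt_nonneg _

theorem norm_sq (hφ : IsPositiveFunctional φ) (x : 𝒜) : hφ.norm x ^ 2 = (φ (star x * x)).re :=
  Real.sq_sqrt (Complex.nonneg_iff.1 (hφ x)).1

theorem norm_apply_le (hφ : IsPositiveFunctional φ) (x y : 𝒜) :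
    ‖φ (star x * y)‖ ≤ hφ.norm x * hφ.norm y :=
  @InnerProductSpace.Core.norm_inner_le_norm ℂ 𝒜 _ _ _ hφ.core x y

theorem norm_add_le (hφ : IsPositiveFunctional φ) (x y : 𝒜) :
    hφ.norm (x + y) ≤ hφ.norm x + hφ.norm y :=
  @_root_.norm_add_le 𝒜
    (@InnerProductSpace.Core.toSeminormedAddCommGroup ℂ 𝒜 _ _ _ hφ.core).toSeminormedAddGroup x y

theorem norm_smul (hφ : IsPositiveFunctional φ) (c : ℂ) (x : 𝒜) :
    hφ.norm (c • x) = ‖c‖ * hφ.norm x := by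
  have h : φ (star (c • x) * (c • x)) = (‖c‖ ^ 2 : ℝ) * φ (star x * x) := by
    rw [star_smul, Algebra.smul_mul_assoc, Algebra.mul_smul_comm, map_smul, map_smul, smul_eq_mul,
      smul_eq_mul, ← mul_assoc, Complex.star_def, ← Complex.normSq_eq_conj_mul_self,
      Complex.normSq_eq_norm_sq]
  rw [IsPositiveFunctional.norm, IsPositiveFunctional.norm, h, Complex.re_ofReal_mul,
    Real.sqrt_mul (sq_nonneg _), Real.sqrt_sq (_root_.norm_nonneg c)]

theorem norm_zero (hφ : IsPositiveFunctional φ) : hφ.norm 0 = 0 := by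
  simp [IsPositiveFunctional.norm]

/-- Left multiplications are bounded for the seminorm associated to `φ`. -/
def Admissible (hφ : IsPositiveFunctional φ) : Prop :=
  ∀ a, ∃ M, 0 ≤ M ∧ ∀ y, hφ.norm (a * y) ≤ M * hφ.norm y

/-- The norm of the operator of left multiplication by `a`. -/
def opNorm (hφ : IsPositiveFunctional φ) (a : 𝒜) : ℝ :=
  sInf {M | 0 ≤ M ∧ ∀ y, hφ.norm (a * y) ≤ M * hφ.norm y}

theorem opNorm_nonneg (hφ : IsPositiveFunctional φ) (a : 𝒜) : 0 ≤ hφ.opNorm a :=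
  Real.sInf_nonneg fun _ h => h.1

theorem opNorm_le (hφ : IsPositiveFunctional φ) {a : 𝒜} {M : ℝ} (h0 : 0 ≤ M)
    (h : ∀ y, hφ.norm (a * y) ≤ M * hφ.norm y) : hφ.opNorm a ≤ M :=
  csInf_le ⟨0, fun _ h => h.1⟩ ⟨h0, h⟩

theorem Admissible.norm_mul_le {hφ : IsPositiveFunctional φ} (hb : hφ.Admissible) (a y : 𝒜) :
    hφ.norm (a * y) ≤ hφ.opNorm a * hφ.norm y := by
  rcases (hφ.norm_nonneg y).eq_or_lt with h | h
  · obtain ⟨M, _, hM⟩ := hb a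
    have := hM y
    rw [← h, mul_zero] at this ⊢
    exact this
  · rw [← div_le_iff₀ h]
    exact le_csInf (hb a) fun M hM => (div_le_iff₀ h).2 (hM.2 y)

/-- The C⋆-seminorm of the GNS representation. -/
def Admissible.cstarSeminorm {hφ : IsPositiveFunctional φ} (hb : hφ.Admissible) :
    CStarSeminorm 𝒜 :=
  have smul_le : ∀ (c : ℂ) (x : 𝒜), hφ.opNorm (c • x) ≤ ‖c‖ * hφ.opNorm x := by
    intro c x
    refine hφ.opNorm_le (mul_nonneg (_root_.norm_nonneg c) (hφ.opNorm_nonneg x)) fun y => ?_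
    rw [Algebra.smul_mul_assoc, hφ.norm_smul, mul_assoc]
    exact mul_le_mul_of_nonneg_left (hb.norm_mul_le x y) (_root_.norm_nonneg c)
  have mul_le : ∀ a b, hφ.opNorm (a * b) ≤ hφ.opNorm a * hφ.opNorm b := by
    intro a b
    refine hφ.opNorm_le (mul_nonneg (hφ.opNorm_nonneg a) (hφ.opNorm_nonneg b)) fun y => ?_
    rw [mul_assoc, mul_assoc]
    exact (hb.norm_mul_le _ _).trans
      (mul_le_mul_of_nonneg_left (hb.norm_mul_le b y) (hφ.opNorm_nonneg a))
  -- The C⋆-inequality is Cauchy–Schwarz: `‖a y‖² = φ(y^* (a^* a y)) ≤ ‖y‖ ‖a^* a y‖`.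
  have sq_le : ∀ a, hφ.opNorm a ^ 2 ≤ hφ.opNorm (star a * a) := by
    intro a
    have h1 : hφ.opNorm a ≤ √(hφ.opNorm (star a * a)) := by
      refine hφ.opNorm_le (Real.sqrt_nonneg _) fun y => ?_
      refine abs_le_of_sq_le_sq' ?_ (mul_nonneg (Real.sqrt_nonneg _) (hφ.norm_nonneg y)) |>.2
      rw [mul_pow, Real.sq_sqrt (hφ.opNorm_nonneg _), hφ.norm_sq]
      calc (φ (star (a * y) * (a * y))).re
          ≤ ‖φ (star y * (star a * a * y))‖ := by
            rw [star_mul, mul_assoc, ← mul_assoc (star a)]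
            exact Complex.re_le_norm _
        _ ≤ hφ.norm y * (hφ.opNorm (star a * a) * hφ.norm y) :=
            (hφ.norm_apply_le _ _).trans
              (mul_le_mul_of_nonneg_left (hb.norm_mul_le _ _) (hφ.norm_nonneg y))
        _ = _ := by ring
    calc _ ≤ _ := pow_le_pow_left₀ (hφ.opNorm_nonneg a) h1 2
      _ = _ := Real.sq_sqrt (hφ.opNorm_nonneg _)
  have le_star : ∀ a, hφ.opNorm a ≤ hφ.opNorm (star a) := by
    intro a
    rcases (hφ.opNorm_nonneg a).eq_or_lt with h | h
    · rw [← h]; exact hφ.opNorm_nonneg _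
    · have h1 := (sq_le a).trans (mul_le (star a) a)
      rw [sq] at h1
      exact le_of_mul_le_mul_right h1 h
  { Seminorm.ofSMulLE hφ.opNorm
      (le_antisymm (hφ.opNorm_le le_rfl fun y => by rw [zero_mul, zero_mul, hφ.norm_zero])
        (hφ.opNorm_nonneg 0))
      (fun a b => hφ.opNorm_le (add_nonneg (hφ.opNorm_nonneg a) (hφ.opNorm_nonneg b)) fun y => by
        rw [add_mul, add_mul]
        exact (hφ.norm_add_le _ _).trans (add_le_add (hb.norm_mul_le a y) (hb.norm_mul_le b y)))
      smul_le with
    mul_le_mul' := mul_le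
    star_mul_self' := fun a => by
      refine le_antisymm ?_ (sq_le a)
      refine (mul_le (star a) a).trans ?_
      rw [sq]
      refine mul_le_mul_of_nonneg_right ?_ (hφ.opNorm_nonneg a)
      exact (le_star (star a)).trans_eq (congrArg hφ.opNorm (star_star a)) }

theorem Admissible.cstarSeminorm_apply {hφ : IsPositiveFunctional φ} (hb : hφ.Admissible)
    (a : 𝒜) : hb.cstarSeminorm a = hφ.opNorm a := rfl

theorem Admissible.cstarSeminorm_eq_zero {hφ : IsPositiveFunctional φ} (hb : hφ.Admissible)
    {a : 𝒜} (h : ∀ y, φ (star (a * y) * (a * y)) = 0) : hb.cstarSeminorm a = 0 := by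
  refine le_antisymm (hφ.opNorm_le le_rfl fun y => ?_) (hφ.opNorm_nonneg a)
  rw [IsPositiveFunctional.norm, h, Complex.zero_re, Real.sqrt_zero, zero_mul]

/-- The bound for left multiplication by `a` is evaluated at the cyclic vector `1`. -/
theorem Admissible.apply_star_mul_self_eq_zero {hφ : IsPositiveFunctional φ}
    (hb : hφ.Admissible) {a : 𝒜} (h : hb.cstarSeminorm a = 0) : φ (star a * a) = 0 := by
  have h1 := hb.norm_mul_le a 1
  rw [mul_one, ← hb.cstarSeminorm_apply, h, zero_mul] at h1
  have h2 := hφ.norm_sq a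
  rw [le_antisymm h1 (hφ.norm_nonneg a)] at h2
  refine Complex.ext ?_ ?_
  · rw [← h2]; simp
  · exact (Complex.nonneg_iff.1 (hφ a)).2.symm

theorem Admissible.apply_eq_zero {hφ : IsPositiveFunctional φ}
    (hb : hφ.Admissible) {a : 𝒜} (h : hb.cstarSeminorm a = 0) : φ a = 0 := by
  have h1 := hφ.norm_apply_le 1 a
  have h2 : hφ.norm a = 0 := by
    rw [IsPositiveFunctional.norm, hb.apply_star_mul_self_eq_zero h]
    simp
  rw [star_one, one_mul, h2, mul_zero] at h1
  exact norm_le_zero_iff.1 h1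

/-- With the next two lemmas: the elements with bounded left multiplication are closed under the
algebra operations, so admissibility is a condition on generators. -/
theorem bounded_add (hφ : IsPositiveFunctional φ) {a b : 𝒜}
    (ha : ∃ M, 0 ≤ M ∧ ∀ y, hφ.norm (a * y) ≤ M * hφ.norm y)
    (hb : ∃ M, 0 ≤ M ∧ ∀ y, hφ.norm (b * y) ≤ M * hφ.norm y) :
    ∃ M, 0 ≤ M ∧ ∀ y, hφ.norm ((a + b) * y) ≤ M * hφ.norm y := by
  obtain ⟨M, hM, hM'⟩ := ha
  obtain ⟨K, hK, hK'⟩ := hb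
  refine ⟨M + K, add_nonneg hM hK, fun y => ?_⟩
  rw [add_mul, add_mul]
  exact (hφ.norm_add_le _ _).trans (add_le_add (hM' y) (hK' y))

theorem bounded_mul (hφ : IsPositiveFunctional φ) {a b : 𝒜}
    (ha : ∃ M, 0 ≤ M ∧ ∀ y, hφ.norm (a * y) ≤ M * hφ.norm y)
    (hb : ∃ M, 0 ≤ M ∧ ∀ y, hφ.norm (b * y) ≤ M * hφ.norm y) :
    ∃ M, 0 ≤ M ∧ ∀ y, hφ.norm ((a * b) * y) ≤ M * hφ.norm y := by
  obtain ⟨M, hM, hM'⟩ := ha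
  obtain ⟨K, hK, hK'⟩ := hb
  refine ⟨M * K, mul_nonneg hM hK, fun y => ?_⟩
  rw [mul_assoc, mul_assoc]
  exact (hM' _).trans (mul_le_mul_of_nonneg_left (hK' y) hM)

theorem bounded_smul (hφ : IsPositiveFunctional φ) {a : 𝒜} (c : ℂ)
    (ha : ∃ M, 0 ≤ M ∧ ∀ y, hφ.norm (a * y) ≤ M * hφ.norm y) :
    ∃ M, 0 ≤ M ∧ ∀ y, hφ.norm ((c • a) * y) ≤ M * hφ.norm y := by
  obtain ⟨M, hM, hM'⟩ := ha
  refine ⟨‖c‖ * M, mul_nonneg (_root_.norm_nonneg c) hM, fun y => ?_⟩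
  rw [Algebra.smul_mul_assoc, hφ.norm_smul, mul_assoc]
  exact mul_le_mul_of_nonneg_left (hM' y) (_root_.norm_nonneg c)

/-- Left multiplication by `a` is bounded if `φ ((a y)^* a y) ≤ M φ (y^* y)` for every `y`. -/
theorem bounded_of_re_le (hφ : IsPositiveFunctional φ) {a : 𝒜} {M : ℝ} (hM : 0 ≤ M)
    (h : ∀ y, (φ (star (a * y) * (a * y))).re ≤ M * (φ (star y * y)).re) :
    ∃ M, 0 ≤ M ∧ ∀ y, hφ.norm (a * y) ≤ M * hφ.norm y := by
  refine ⟨√M, Real.sqrt_nonneg M, fun y => ?_⟩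
  rw [IsPositiveFunctional.norm, IsPositiveFunctional.norm, ← Real.sqrt_mul hM]
  exact Real.sqrt_le_sqrt (h y)

end IsPositiveFunctional

end PositiveFunctional

/-! ### Product functionals -/

section ProductFunctional

open scoped ComplexOrder

variable {A B : Type*} [CStarAlgebra A] [CStarAlgebra B] {φ : A →ₗ[ℂ] ℂ} {ψ : B →ₗ[ℂ] ℂ}

/-- The tensor product of two functionals. -/
def tensorFunctional (φ : A →ₗ[ℂ] ℂ) (ψ : B →ₗ[ℂ] ℂ) : A ⊗[ℂ] B →ₗ[ℂ] ℂ :=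
  LinearMap.mul' ℂ ℂ ∘ₗ TensorProduct.map φ ψ

theorem tensorFunctional_tmul (φ : A →ₗ[ℂ] ℂ) (ψ : B →ₗ[ℂ] ℂ) (a : A) (b : B) :
    tensorFunctional φ ψ (a ⊗ₜ b) = φ a * ψ b := by
  simp [tensorFunctional]

theorem IsPositiveFunctional.posSemidef {𝒜 ι : Type*} [Ring 𝒜] [StarRing 𝒜] [Algebra ℂ 𝒜]
    [StarModule ℂ 𝒜] [Fintype ι] {φ : 𝒜 →ₗ[ℂ] ℂ} (hφ : IsPositiveFunctional φ) (a : ι → 𝒜) :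
    (Matrix.of fun i j => φ (star (a i) * a j)).PosSemidef := by
  refine Matrix.PosSemidef.of_dotProduct_mulVec_nonneg ?_ fun c => ?_
  · ext i j
    exact hφ.apply_star_mul _ _
  · have h := hφ (∑ i, c i • a i)
    rw [star_sum, Finset.sum_mul_sum, map_sum] at h
    simp only [map_sum, star_smul, Algebra.smul_mul_assoc, Algebra.mul_smul_comm, map_smul] at h
    convert h using 1
    simp only [dotProduct, Matrix.mulVec, Pi.star_apply, Matrix.of_apply, Finset.mul_sum,
      smul_eq_mul]
    exact Finset.sum_congr rfl fun i _ => Finset.sum_congr rfl fun j _ => by ring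

theorem exists_sum_tmul (z : A ⊗[ℂ] B) :
    ∃ (n : ℕ) (a : Fin n → A) (b : Fin n → B), z = ∑ i, a i ⊗ₜ[ℂ] b i := by
  induction z with
  | zero => exact ⟨0, Fin.elim0, Fin.elim0, by simp⟩
  | tmul a b => exact ⟨1, fun _ => a, fun _ => b, by simp⟩
  | add x y hx hy =>
    obtain ⟨n, a, b, rfl⟩ := hx
    obtain ⟨m, a', b', rfl⟩ := hy
    exact ⟨n + m, Fin.append a a', Fin.append b b', by simp [Fin.sum_univ_add]⟩

/-- The value at `z^* z` is the sum of all entries of a Hadamard product of two Gram matrices, which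
is positive semidefinite by the Schur product theorem. -/
theorem IsPositiveFunctional.tensor (hφ : IsPositiveFunctional φ) (hψ : IsPositiveFunctional ψ) :
    IsPositiveFunctional (tensorFunctional φ ψ) := by
  intro z
  obtain ⟨n, a, b, rfl⟩ := exists_sum_tmul z
  have h := ((hφ.posSemidef a).hadamard (hψ.posSemidef b)).dotProduct_mulVec_nonneg fun _ => 1
  convert h using 1
  simp [star_sum, Finset.sum_mul_sum, tensorFunctional_tmul, dotProduct, Matrix.mulVec]

/-- The inequality `a^* a ≤ ‖a‖²` written as an algebraic identity, which can be carried into the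
algebraic tensor product without an order there. -/
theorem star_mul_self_add_exists {A : Type*} [CStarAlgebra A] (a : A) :
    ∃ c : A, star a * a + star c * c = algebraMap ℂ A (‖a‖ ^ 2 : ℝ) := by
  let := CStarAlgebra.spectralOrder A
  have := CStarAlgebra.spectralOrderedRing A
  have h1 : star a * a ≤ algebraMap ℝ A (‖a‖ ^ 2) := by
    have := CStarAlgebra.star_mul_le_algebraMap_norm_sq (a := a)
    exact this
  obtain ⟨c, hc⟩ := CStarAlgebra.nonneg_iff_eq_star_mul_self.1 (sub_nonneg.2 h1)
  refine ⟨c, ?_⟩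
  rw [← hc, add_sub_cancel]
  rfl

theorem IsPositiveFunctional.tensor_admissible (hφ : IsPositiveFunctional φ)
    (hψ : IsPositiveFunctional ψ) : (hφ.tensor hψ).Admissible := by
  have h := hφ.tensor hψ
  -- If `x^* x + c^* c = r`, positivity at `c y` bounds the value at `x y` by `r` times the value at
  -- `y`.
  have key : ∀ (r : ℝ) (x c : A ⊗[ℂ] B), 0 ≤ r →
      star x * x + star c * c = algebraMap ℂ (A ⊗[ℂ] B) r →
      ∃ M, 0 ≤ M ∧ ∀ y, h.norm (x * y) ≤ M * h.norm y := by
    intro r x c hr hx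
    refine h.bounded_of_re_le hr fun y => ?_
    have h1 : star (x * y) * (x * y) + star (c * y) * (c * y) = (r : ℂ) • (star y * y) := by
      rw [star_mul, star_mul, mul_assoc, mul_assoc, ← mul_assoc (star x), ← mul_assoc (star c),
        ← mul_add, ← add_mul, hx, ← Algebra.smul_def, Algebra.mul_smul_comm]
    have h2 := congrArg (fun t => (tensorFunctional φ ψ t).re) h1
    simp only [map_add, map_smul, Complex.add_re, smul_eq_mul, Complex.re_ofReal_mul] at h2
    have h3 := (Complex.nonneg_iff.1 (h (c * y))).1
    linarith
  intro z
  induction z with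
  | zero => exact ⟨0, le_rfl, fun y => by rw [zero_mul, zero_mul, h.norm_zero]⟩
  | tmul a b =>
    have : a ⊗ₜ[ℂ] b = (a ⊗ₜ 1) * (1 ⊗ₜ b) := by simp
    rw [this]
    obtain ⟨c, hc⟩ := star_mul_self_add_exists a
    obtain ⟨d, hd⟩ := star_mul_self_add_exists b
    refine h.bounded_mul (key _ _ (c ⊗ₜ 1) (sq_nonneg ‖a‖) ?_)
      (key _ _ (1 ⊗ₜ d) (sq_nonneg ‖b‖) ?_)
    · simp only [TensorProduct.star_tmul, Algebra.TensorProduct.tmul_mul_tmul, star_one, mul_one]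
      rw [← TensorProduct.add_tmul, hc]
      rfl
    · simp only [TensorProduct.star_tmul, Algebra.TensorProduct.tmul_mul_tmul, star_one, mul_one]
      rw [← TensorProduct.tmul_add, hd, Algebra.TensorProduct.algebraMap_apply,
        Algebra.algebraMap_eq_smul_one, Algebra.algebraMap_eq_smul_one, TensorProduct.smul_tmul]
  | add x y hx hy => exact h.bounded_add hx hy

/-- Product functionals are well defined on the image of the algebraic tensor product. -/
theorem tensorFunctional_eq_zero (hφ : IsPositiveFunctional φ) (hψ : IsPositiveFunctional ψ)
    {z : A ⊗[ℂ] B} (hz : (maxSeminorm ∅ (hasMaxSeminorm_tensor A B)).mkHom z = 0) :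
    tensorFunctional φ ψ z = 0 := by
  -- The GNS seminorm of the product functional is dominated by the maximal C⋆-seminorm, so it
  -- vanishes at `z`.
  refine (hφ.tensor_admissible hψ).apply_eq_zero (le_antisymm ?_ (CStarSeminorm.nonneg _ z))
  refine (le_maxSeminorm (hasMaxSeminorm_tensor A B) _ (fun r hr => hr.elim) z).trans ?_
  rw [← CStarSeminorm.norm_mkHom, hz, _root_.norm_zero]

end ProductFunctional

/-! ### Linear relations between the coefficients of a corepresentation -/

section Corepresentation

open Matrix

variable {V : Type*} [Fintype V]

/-- The pairing between scalar matrices and matrices with entries in a complex vector space. -/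
def pairing {M : Type*} [AddCommMonoid M] [Module ℂ M] (a : Matrix V V ℂ) (w : Matrix V V M) : M :=
  ∑ p, ∑ q, a p q • w p q

theorem map_pairing {M M' F : Type*} [AddCommMonoid M] [Module ℂ M] [AddCommMonoid M']
    [Module ℂ M'] [FunLike F M M'] [LinearMapClass F ℂ M M'] (f : F) (a : Matrix V V ℂ)
    (w : Matrix V V M) : f (pairing a w) = pairing a (w.map f) := by
  simp [pairing, map_sum, map_smul]

/-- The entries of a commutator as linear combinations of the entries of `w`. -/
theorem commutator_apply [DecidableEq V] {A : Type*} [Ring A] [Algebra ℂ A] (T : Matrix V V ℂ)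
    (w : Matrix V V A) (p q : V) :
    (T.map (algebraMap ℂ A) * w - w * T.map (algebraMap ℂ A)) p q =
      pairing (Matrix.of fun r s => (if s = q then T p r else 0) - if r = p then T s q else 0) w := by
  rw [pairing, Matrix.sub_apply, mul_apply, mul_apply]
  simp only [of_apply, sub_smul, Finset.sum_sub_distrib, ite_smul, zero_smul]
  congr 1
  · refine Finset.sum_congr rfl fun r _ => ?_
    simp [Algebra.smul_def]
  · rw [Finset.sum_comm]
    refine Finset.sum_congr rfl fun s _ => ?_
    simp [Algebra.smul_def, Algebra.commutes]

variable {A : Type*} [CStarAlgebra A]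

/-- A matrix `w` of coefficients, on which a comultiplication, a counit and an antipode act in
the usual way. -/
structure IsCorepresentation [DecidableEq V] (w : Matrix V V A) : Prop where
  comul : ∃ Δ : A →⋆ₐ[ℂ] MaxTensor A A, w.map Δ = w.map MaxTensor.inl * w.map MaxTensor.inr
  counit : ∃ ε : A →⋆ₐ[ℂ] ℂ, w.map ε = 1
  antipode : ∃ S : A →⋆ₐ[ℂ] Aᵐᵒᵖ, w.map S = wᴴ.map MulOpposite.op

namespace IsCorepresentation

variable [DecidableEq V] {w : Matrix V V A}

/-- A matrix satisfying all relations is a functional `w_pq ↦ x_pq` on the span of the entries, and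
the product of matrices is convolution through the comultiplication. The relation `∑ a_pq w_pr ⊗
w_rq = 0` is known only in the maximal tensor product, so it is first tested on products of positive
functionals. -/
theorem pairing_mul (hw : IsCorepresentation w) {x y : Matrix V V ℂ}
    (hx : ∀ a, pairing a w = 0 → pairing a x = 0) (hy : ∀ a, pairing a w = 0 → pairing a y = 0)
    {a : Matrix V V ℂ} (ha : pairing a w = 0) : pairing a (x * y) = 0 := by
  obtain ⟨Δ, hΔ⟩ := hw.comul
  set z : A ⊗[ℂ] A := ∑ p, ∑ q, a p q • ∑ r, w p r ⊗ₜ[ℂ] w r q with hz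
  have h1 : (maxSeminorm ∅ (hasMaxSeminorm_tensor A A)).mkHom z = 0 := by
    have h2 := congrArg Δ ha
    rw [map_pairing, hΔ, map_zero] at h2
    rw [← h2, hz]
    simp only [pairing, map_sum, map_smul]
    refine Finset.sum_congr rfl fun p _ => Finset.sum_congr rfl fun q _ => ?_
    rw [mul_apply]
    congr 1
    exact Finset.sum_congr rfl fun r _ => (MaxTensor.inl_mul_inr _ _).symm
  have h3 : ∀ φ ψ : A →ₗ[ℂ] ℂ, IsPositiveFunctional φ → IsPositiveFunctional ψ →
      ∑ p, ∑ q, a p q * ∑ r, φ (w p r) * ψ (w r q) = 0 := by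
    intro φ ψ hφ hψ
    have := tensorFunctional_eq_zero hφ hψ h1
    simpa only [hz, map_sum, map_smul, tensorFunctional_tmul, smul_eq_mul] using this
  -- Slicing the second leg by `ψ` leaves a relation between the entries of `w`, because positive
  -- functionals separate points.
  have h4 : ∀ ψ : A →ₗ[ℂ] ℂ, IsPositiveFunctional ψ →
      pairing (Matrix.of fun p r => ∑ q, a p q * ψ (w r q)) w = 0 := by
    intro ψ hψ
    refine eq_zero_of_forall_positive fun φ hφ => ?_
    rw [← h3 φ ψ hφ hψ, pairing]
    simp only [map_sum, map_smul, of_apply, smul_eq_mul, Finset.sum_mul, Finset.mul_sum]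
    refine Finset.sum_congr rfl fun p _ => ?_
    rw [Finset.sum_comm]
    exact Finset.sum_congr rfl fun q _ => Finset.sum_congr rfl fun r _ => by ring
  -- These relations hold for `x`; removing `ψ` then leaves a relation for the second leg, to be
  -- applied to `y`.
  have h5 : pairing (Matrix.of fun r q => ∑ p, a p q * x p r) w = 0 := by
    refine eq_zero_of_forall_positive fun ψ hψ => ?_
    rw [← hx _ (h4 ψ hψ), pairing, pairing]
    simp only [map_sum, map_smul, of_apply, smul_eq_mul, Finset.sum_mul]
    rw [Finset.sum_comm (s := Finset.univ (α := V))]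
    rw [Finset.sum_comm]
    conv_rhs => rw [Finset.sum_comm]
    refine Finset.sum_congr rfl fun r _ => ?_
    rw [Finset.sum_comm]
    exact Finset.sum_congr rfl fun p _ => Finset.sum_congr rfl fun q _ => by ring
  rw [← hy _ h5, pairing, pairing]
  simp only [of_apply, smul_eq_mul, mul_apply, Finset.sum_mul, Finset.mul_sum]
  rw [Finset.sum_comm]
  conv_rhs => rw [Finset.sum_comm]
  refine Finset.sum_congr rfl fun q _ => ?_
  rw [Finset.sum_comm]
  exact Finset.sum_congr rfl fun r _ => Finset.sum_congr rfl fun p _ => by ring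

/-- The conjugate-linear map `t ↦ S(t)^*` sends `w_pq` to `w_qp`, so the relations are stable under
`a ↦ a^*`. -/
theorem pairing_conjTranspose (hw : IsCorepresentation w) {x : Matrix V V ℂ}
    (hx : ∀ a, pairing a w = 0 → pairing a x = 0)
    {a : Matrix V V ℂ} (ha : pairing a w = 0) : pairing a xᴴ = 0 := by
  obtain ⟨S, hS⟩ := hw.antipode
  have h1 : pairing aᴴ w = 0 := by
    have h2 := congrArg (fun t => star (MulOpposite.unop t)) (congrArg S ha)
    rw [map_pairing, hS, map_zero] at h2
    simp only [pairing, Finset.unop_sum, star_sum, MulOpposite.unop_zero, star_zero,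
      MulOpposite.unop_smul, star_smul, map_apply, MulOpposite.unop_op, conjTranspose_apply,
      star_star] at h2
    rw [pairing, Finset.sum_comm]
    exact h2
  have h3 := congrArg star (hx _ h1)
  simp only [pairing, star_sum, star_zero, star_smul, conjTranspose_apply, star_star] at h3
  rw [pairing, Finset.sum_comm]
  exact h3

/-- The ⋆-algebra of the matrices satisfying all linear relations which hold between the entries
of `w`. -/
def relationAlgebra (hw : IsCorepresentation w) : StarSubalgebra ℂ (Matrix V V ℂ) where
  carrier := {x | ∀ a, pairing a w = 0 → pairing a x = 0}
  mul_mem' hx hy := fun _ ha => hw.pairing_mul hx hy ha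
  add_mem' {x y} hx hy := fun a ha => by
    have h : pairing a (x + y) = pairing a x + pairing a y := by
      simp [pairing, mul_add, Finset.sum_add_distrib]
    rw [h, hx a ha, hy a ha, add_zero]
  algebraMap_mem' c a ha := by
    obtain ⟨ε, hε⟩ := hw.counit
    have h := congrArg ε ha
    rw [map_pairing, hε, map_zero] at h
    have h' : pairing a (algebraMap ℂ (Matrix V V ℂ) c) = c * pairing a (1 : Matrix V V ℂ) := by
      rw [Algebra.algebraMap_eq_smul_one]
      simp only [pairing, Finset.mul_sum, Matrix.smul_apply, smul_eq_mul]
      exact Finset.sum_congr rfl fun _ _ => Finset.sum_congr rfl fun _ _ => by ring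
    rw [h', h, mul_zero]
  star_mem' hx := fun _ ha => hw.pairing_conjTranspose hx ha

/-- The relations form a subspace of matrices. A matrix outside it is detected by a linear
functional killing the subspace, and such a functional is the pairing with an element of
`relationAlgebra`. -/
theorem pairing_eq_zero_of_forall (hw : IsCorepresentation w) {a : Matrix V V ℂ}
    (ha : ∀ x ∈ hw.relationAlgebra, pairing a x = 0) : pairing a w = 0 := by
  let K : Submodule ℂ (Matrix V V ℂ) :=
    { carrier := {a | pairing a w = 0}
      add_mem' := fun {a b} (ha : pairing a w = 0) (hb : pairing b w = 0) => by
        have h : pairing (a + b) w = pairing a w + pairing b w := by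
          simp [pairing, add_smul, Finset.sum_add_distrib]
        change pairing (a + b) w = 0
        rw [h, ha, hb, add_zero]
      zero_mem' := by
        change pairing 0 w = 0
        simp [pairing]
      smul_mem' := fun c a (ha : pairing a w = 0) => by
        have h : pairing (c • a) w = c • pairing a w := by
          simp [pairing, mul_smul, Finset.smul_sum]
        change pairing (c • a) w = 0
        rw [h, ha, smul_zero] }
  by_contra hne
  obtain ⟨f, hf, hfK⟩ := Submodule.exists_le_ker_of_notMem (p := K) (v := a) hne
  have h1 : ∀ b : Matrix V V ℂ, f b = pairing b (Matrix.of fun p q => f (single p q 1)) := by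
    intro b
    conv_lhs => rw [matrix_eq_sum_single b]
    simp only [map_sum, pairing, of_apply, smul_eq_mul]
    refine Finset.sum_congr rfl fun p _ => Finset.sum_congr rfl fun q _ => ?_
    rw [← smul_eq_mul, ← map_smul, smul_single, smul_eq_mul, mul_one]
  refine hf ?_
  rw [h1]
  refine ha _ fun b hb => ?_
  rw [← h1]
  exact hfK hb

/-- The entries of `T w - w T` are combinations of the entries of `w` with coefficients depending
only on `T`. Their vanishing is a family of relations, equivalently the same commutation for every
`x` in the algebra. -/
theorem commute_iff (hw : IsCorepresentation w) {T : Matrix V V ℂ} :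
    T.map (algebraMap ℂ A) * w = w * T.map (algebraMap ℂ A) ↔
      ∀ x ∈ hw.relationAlgebra, T * x = x * T := by
  have h0 : ∀ x : Matrix V V ℂ, T * x - x * T = T.map (algebraMap ℂ ℂ) * x -
      x * T.map (algebraMap ℂ ℂ) := by
    intro x
    have : T.map (algebraMap ℂ ℂ) = T := by ext; rfl
    rw [this]
  constructor
  · intro h x hx
    rw [← sub_eq_zero, h0]
    ext p q
    rw [commutator_apply]
    refine hx _ ?_
    rw [← commutator_apply, h, sub_self, Matrix.zero_apply]
  · intro h
    rw [← sub_eq_zero]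
    ext p q
    rw [commutator_apply]
    refine hw.pairing_eq_zero_of_forall fun x hx => ?_
    rw [← commutator_apply, ← h0, h x hx, sub_self, Matrix.zero_apply]

/-- The linear relations between the entries of a corepresentation are determined by its
endomorphisms. -/
theorem pairing_eq_zero_iff (hw : IsCorepresentation w) (a : Matrix V V ℂ) :
    pairing a w = 0 ↔ ∀ x : Matrix V V ℂ, (∀ T : Matrix V V ℂ,
      T.map (algebraMap ℂ A) * w = w * T.map (algebraMap ℂ A) → T * x = x * T) →
        pairing a x = 0 := by
  constructor
  · intro ha x hx
    -- The endomorphisms of `w` are the commutant of the relation algebra, so `x` lies in its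
    -- bicommutant.
    have : x ∈ hw.relationAlgebra := mem_of_commute_commutant fun T hT =>
      (hx T (hw.commute_iff.2 fun b hb => (hT b hb).symm)).symm
    exact this a ha
  · intro h
    exact hw.pairing_eq_zero_of_forall fun x hx => h x fun T hT => hw.commute_iff.1 hT x hx

end IsCorepresentation

end Corepresentation

/-! ### Direct sums of tensor powers -/

section DirectSum

open Matrix

variable {N : ℕ} {ι : Type} [Fintype ι] [DecidableEq ι]

/-- The index set of the basis of a direct sum of tensor powers of `H`. -/
abbrev SumIdx (N : ℕ) (κ : ι → Word) : Type := Σ s, Idx N (κ s)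

/-- The direct sum of the corepresentations `u^⊗k`. -/
def sumPower {A : Type*} [Ring A] [StarRing A] (u : Matrix (Fin N) (Fin N) A) (κ : ι → Word) :
    Matrix (SumIdx N κ) (SumIdx N κ) A :=
  blockDiagonal' fun s => tensorPower u (κ s)

theorem sumPower_map {A B : Type*} [Ring A] [StarRing A] [Algebra ℂ A] [Ring B] [StarRing B]
    [Algebra ℂ B] (f : A →⋆ₐ[ℂ] B) (u : Matrix (Fin N) (Fin N) A) (κ : ι → Word) :
    (sumPower u κ).map f = sumPower (u.map f) κ := by
  rw [sumPower, blockDiagonal'_map _ _ (map_zero f)]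
  simp only [map_tensorPower]
  rfl

/-- The block of a matrix over a direct sum. -/
def block {κ : ι → Word} (T : Matrix (SumIdx N κ) (SumIdx N κ) ℂ) (s t : ι) :
    Op N (κ t) (κ s) :=
  Matrix.of fun i j => T ⟨s, i⟩ ⟨t, j⟩

theorem mul_sumPower_apply {A : Type*} [Ring A] [StarRing A] (u : Matrix (Fin N) (Fin N) A)
    (κ : ι → Word) (T : Matrix (SumIdx N κ) (SumIdx N κ) A) (s t : ι) (i : Idx N (κ s))
    (j : Idx N (κ t)) : (T * sumPower u κ) ⟨s, i⟩ ⟨t, j⟩ =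
      ∑ z, T ⟨s, i⟩ ⟨t, z⟩ * tensorPower u (κ t) z j := by
  rw [mul_apply, Fintype.sum_sigma, Finset.sum_eq_single t]
  · exact Finset.sum_congr rfl fun z _ => by rw [sumPower, blockDiagonal'_apply_eq]
  · intro r _ hr
    exact Finset.sum_eq_zero fun z _ => by rw [sumPower, blockDiagonal'_apply_ne _ _ _ hr, mul_zero]
  · simp

theorem sumPower_mul_apply {A : Type*} [Ring A] [StarRing A] (u : Matrix (Fin N) (Fin N) A)
    (κ : ι → Word) (T : Matrix (SumIdx N κ) (SumIdx N κ) A) (s t : ι) (i : Idx N (κ s))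
    (j : Idx N (κ t)) : (sumPower u κ * T) ⟨s, i⟩ ⟨t, j⟩ =
      ∑ z, tensorPower u (κ s) i z * T ⟨s, z⟩ ⟨t, j⟩ := by
  rw [mul_apply, Fintype.sum_sigma, Finset.sum_eq_single s]
  · exact Finset.sum_congr rfl fun z _ => by rw [sumPower, blockDiagonal'_apply_eq]
  · intro r _ hr
    exact Finset.sum_eq_zero fun z _ => by
      rw [sumPower, blockDiagonal'_apply_ne _ _ _ (Ne.symm hr), zero_mul]
  · simp

theorem commute_sumPower_iff {A : Type*} [Ring A] [StarRing A] [Algebra ℂ A]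
    (u : Matrix (Fin N) (Fin N) A) (κ : ι → Word) (T : Matrix (SumIdx N κ) (SumIdx N κ) ℂ) :
    T.map (algebraMap ℂ A) * sumPower u κ = sumPower u κ * T.map (algebraMap ℂ A) ↔
      ∀ s t, block T s t ∈ homSpaces u (κ t) (κ s) := by
  constructor
  · intro h s t
    rw [mem_homSpaces]
    ext i j
    have := congrFun (congrFun h ⟨s, i⟩) ⟨t, j⟩
    rw [mul_sumPower_apply, sumPower_mul_apply] at this
    exact this
  · intro h
    ext ⟨s, i⟩ ⟨t, j⟩
    rw [mul_sumPower_apply, sumPower_mul_apply]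
    exact congrFun (congrFun (mem_homSpaces.1 (h s t)) i) j

/-- The structure maps are ⋆-morphisms, so their action on each block is determined by their values
on `u`. -/
theorem IsWoronowicz.isCorepresentation {A : Type*} [CStarAlgebra A]
    {u : Matrix (Fin N) (Fin N) A} (hu : IsWoronowicz u) (κ : ι → Word) :
    IsCorepresentation (sumPower u κ) where
  comul := by
    obtain ⟨Δ, hΔ⟩ := hu.comul
    refine ⟨Δ, ?_⟩
    have h : u.map Δ = u.map MaxTensor.inl * u.map MaxTensor.inr := by
      ext i j
      rw [map_apply, hΔ, mul_apply]
      exact Finset.sum_congr rfl fun k _ => (MaxTensor.inl_mul_inr _ _).symm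
    rw [sumPower_map, h, sumPower_map, sumPower_map, sumPower, sumPower, sumPower,
      ← blockDiagonal'_mul]
    congr 1
    funext s
    rw [tensorPower_mul_of_commute MaxTensor.commute_inl_inr, map_tensorPower, map_tensorPower]
  counit := by
    obtain ⟨ε, hε⟩ := hu.counit
    refine ⟨ε, ?_⟩
    have h : u.map ε = 1 := by
      ext i j
      rw [map_apply, hε, one_apply]
    rw [sumPower_map, h, sumPower]
    simp only [tensorPower_one]
    exact blockDiagonal'_one
  antipode := by
    obtain ⟨S, hS⟩ := hu.antipode
    refine ⟨S, ?_⟩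
    have h : u.map S = opMatrix u := by
      ext i j
      rw [map_apply, hS]
      rfl
    rw [sumPower_map, h, sumPower, sumPower]
    simp only [tensorPower_opMatrix]
    rw [blockDiagonal'_conjTranspose, blockDiagonal'_map _ _ MulOpposite.op_zero]

end DirectSum

/-! ### Monomials -/

section Monomial

variable {N : ℕ}

/-- The color of a free generator. -/
def letterColor (x : (Fin N × Fin N) × Bool) : Color := if x.2 then .black else .white

/-- The word formed by the colors of a monomial. -/
def colors (m : FreeMonoid ((Fin N × Fin N) × Bool)) : Word := m.toList.map letterColor

/-- The row indices of a monomial. -/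
def rowIdx (m : FreeMonoid ((Fin N × Fin N) × Bool)) : Idx N (colors m) :=
  fun t => (m.toList[t.1]'(t.2.trans_eq (List.length_map _))).1.1

/-- The column indices of a monomial. -/
def colIdx (m : FreeMonoid ((Fin N × Fin N) × Bool)) : Idx N (colors m) :=
  fun t => (m.toList[t.1]'(t.2.trans_eq (List.length_map _))).1.2

/-- The monomial with given colors and indices. -/
def monomial {k : Word} (i j : Idx N k) : FreeMonoid ((Fin N × Fin N) × Bool) :=
  FreeMonoid.ofList (List.ofFn fun t => ((i t, j t), match k.get t with
    | .white => false
    | .black => true))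

theorem FreeStarAlgebra.prod_gen {X : Type*} (l : List (X × Bool)) :
    (l.map FreeStarAlgebra.gen).prod =
      (MonoidAlgebra.single (FreeMonoid.ofList l) 1 : FreeStarAlgebra X) := by
  induction l with
  | nil => rfl
  | cons x l ih =>
    rw [List.map_cons, List.prod_cons, ih, FreeStarAlgebra.gen, MonoidAlgebra.single_mul_single,
      one_mul]
    rfl

theorem tensorPower_freeMatrix (k : Word) (i j : Idx N k) :
    tensorPower (freeMatrix N) k i j = MonoidAlgebra.single (monomial i j) 1 := by
  rw [monomial, ← FreeStarAlgebra.prod_gen, List.map_ofFn, tensorPower, Matrix.of_apply]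
  congr 2
  funext t
  simp only [Function.comp_apply]
  cases k.get t
  · rfl
  · exact FreeStarAlgebra.star_gen (i t, j t)

theorem monomial_colors (m : FreeMonoid ((Fin N × Fin N) × Bool)) :
    monomial (rowIdx m) (colIdx m) = m := by
  refine FreeMonoid.toList.injective ?_
  refine List.ext_getElem ?_ fun n h1 h2 => ?_
  · simp [monomial, colors]
  · simp only [monomial, FreeMonoid.toList_ofList, List.getElem_ofFn, rowIdx, colIdx]
    refine Prod.ext rfl ?_
    simp only [colors, List.get_eq_getElem, List.getElem_map, letterColor]
    cases (m.toList[n]).2 <;> rfl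

theorem tensorPower_colors (m : FreeMonoid ((Fin N × Fin N) × Bool)) :
    tensorPower (freeMatrix N) (colors m) (rowIdx m) (colIdx m) = MonoidAlgebra.single m 1 := by
  rw [tensorPower_freeMatrix, monomial_colors]

theorem colors_monomial {k : Word} (i j : Idx N k) : colors (monomial i j) = k := by
  refine List.ext_getElem ?_ fun n h1 h2 => ?_
  · simp [monomial, colors]
  · simp only [colors, monomial, FreeMonoid.toList_ofList, List.getElem_map, List.getElem_ofFn,
      letterColor, List.get_eq_getElem]
    cases k[n] <;> rfl

/-- The colors of `monomial i j` equal `k` only propositionally; quantifying over `P` replaces a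
transport of indices. -/
theorem apply_monomial {α : Type*} (P : ∀ k : Word, Idx N k → Idx N k → α) {k : Word}
    (i j : Idx N k) :
    P (colors (monomial i j)) (rowIdx (monomial i j)) (colIdx (monomial i j)) = P k i j := by
  have key : ∀ (k' : Word) (h : k' = k) (i' j' : Idx N k'),
      (∀ t, i' t = i (Fin.cast (congrArg List.length h) t)) →
      (∀ t, j' t = j (Fin.cast (congrArg List.length h) t)) → P k' i' j' = P k i j := by
    rintro k' rfl i' j' hi hj
    rw [show i' = i from funext hi, show j' = j from funext hj]
  refine key _ (colors_monomial i j) _ _ (fun t => ?_) (fun t => ?_)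
  · simp [rowIdx, monomial]
    rfl
  · simp [colIdx, monomial]
    rfl

open Matrix in
/-- Every element of the free ⋆-algebra is a linear combination of coefficients of a direct sum of
tensor powers. -/
theorem exists_eq_pairing (x : FreeStarAlgebra (Fin N × Fin N)) :
    ∃ (ι : Type) (_ : Fintype ι) (_ : DecidableEq ι) (κ : ι → Word)
      (a : ∀ s, Matrix (Idx N (κ s)) (Idx N (κ s)) ℂ),
      x = pairing (blockDiagonal' a) (sumPower (freeMatrix N) κ) := by
  classical
  -- One summand for each monomial of the support, with a multiple of a matrix unit as coefficient.
  refine ⟨x.coeff.support, inferInstance, inferInstance, fun m => colors m.1,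
    fun m => single (rowIdx m.1) (colIdx m.1) (x.coeff m.1), ?_⟩
  have h : ∀ (m : x.coeff.support) (i : Idx N (colors m.1)),
      ∑ q, blockDiagonal' (fun m : x.coeff.support => single (rowIdx m.1) (colIdx m.1) (x.coeff m.1)) ⟨m, i⟩ q •
        sumPower (freeMatrix N) (fun m : x.coeff.support => colors m.1) ⟨m, i⟩ q =
      if rowIdx m.1 = i then MonoidAlgebra.single m.1 (x.coeff m.1) else 0 := by
    intro m i
    rw [Fintype.sum_sigma, Finset.sum_eq_single m]
    · simp only [blockDiagonal'_apply_eq, sumPower]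
      split_ifs with hi
      · subst hi
        rw [Finset.sum_eq_single (colIdx m.1)]
        · rw [single_apply_same, tensorPower_colors, MonoidAlgebra.smul_single, smul_eq_mul, mul_one]
        · intro j _ hj
          rw [single_apply_of_col_ne _ _ (Ne.symm hj), zero_smul]
        · simp
      · exact Finset.sum_eq_zero fun j _ => by
          rw [single_apply_of_row_ne hi, zero_smul]
    · intro m' _ hm
      exact Finset.sum_eq_zero fun j _ => by
        rw [blockDiagonal'_apply_ne _ _ _ (Ne.symm hm), zero_smul]
    · simp
  rw [pairing, Fintype.sum_sigma]
  simp only [h, Finset.sum_ite_eq, Finset.mem_univ, if_true]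
  rw [Finset.sum_coe_sort x.coeff.support fun m => MonoidAlgebra.single m (x.coeff m)]
  exact (MonoidAlgebra.sum_coeff_single x).symm

/-- Equality of the spaces of intertwiners implies equality of all relations. -/
theorem IsWoronowicz.ev_eq_zero_iff {A B : Type*} [CStarAlgebra A] [CStarAlgebra B]
    {u : Matrix (Fin N) (Fin N) A} {v : Matrix (Fin N) (Fin N) B} (hu : IsWoronowicz u)
    (hv : IsWoronowicz v) (h : homSpaces u = homSpaces v)
    (x : FreeStarAlgebra (Fin N × Fin N)) : ev u x = 0 ↔ ev v x = 0 := by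
  obtain ⟨ι, _, _, κ, a, rfl⟩ := exists_eq_pairing x
  -- Both sides become the same condition on `a`, involving the matrices `u`, `v` only through their
  -- Hom spaces.
  rw [map_pairing, map_pairing, sumPower_map, sumPower_map, freeMatrix_map_ev, freeMatrix_map_ev,
    (hu.isCorepresentation κ).pairing_eq_zero_iff, (hv.isCorepresentation κ).pairing_eq_zero_iff]
  simp only [commute_sumPower_iff, h]

end Monomial

/-! ### Equivalence of Woronowicz algebras and equality of their Hom spaces. -/

section Equivalence

variable {N : ℕ} {A B : Type*} [CStarAlgebra A] [CStarAlgebra B]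
  {u : Matrix (Fin N) (Fin N) A} {v : Matrix (Fin N) (Fin N) B}

/-- The two smooth algebras are quotients of the free ⋆-algebra by the same kernel. -/
theorem equivalent_of_ev_eq_zero_iff (h : ∀ x, ev u x = 0 ↔ ev v x = 0) : Equivalent u v := by
  have hu : ∀ y : smooth u, ∃ x, ev u x = y := fun y => by
    have := y.2
    exact (range_ev _).ge this
  have hv : ∀ y : smooth v, ∃ x, ev v x = y := fun y => by
    have := y.2
    exact (range_ev _).ge this
  have mem_v : ∀ x, ev v x ∈ smooth v := fun x => by
    rw [← range_ev]; exact ⟨x, rfl⟩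
  have h' : ∀ x y, ev u x = ev u y ↔ ev v x = ev v y := fun x y => by
    rw [← sub_eq_zero, ← map_sub, h, map_sub, sub_eq_zero]
  -- Arbitrary lifts to polynomials suffice: `hF` says that the image does not depend on the lift.
  choose f hf using hu
  let F : smooth u → smooth v := fun y => ⟨ev v (f y), mem_v _⟩
  have hF : ∀ (y : smooth u) (x), ev u x = y → (F y : B) = ev v x := fun y x hx =>
    (h' _ _).1 ((hf y).trans hx.symm)
  let e : smooth u →⋆ₐ[ℂ] smooth v :=
    { toFun := F
      map_one' := Subtype.ext ((hF 1 1 (map_one _)).trans (map_one _))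
      map_zero' := Subtype.ext ((hF 0 0 (map_zero _)).trans (map_zero _))
      map_mul' := fun x y => Subtype.ext ((hF _ (f x * f y) (by
        rw [map_mul, hf, hf]; rfl)).trans (map_mul _ _ _))
      map_add' := fun x y => Subtype.ext ((hF _ (f x + f y) (by
        rw [map_add, hf, hf]; rfl)).trans (map_add _ _ _))
      commutes' := fun c => Subtype.ext ((hF _ (algebraMap ℂ _ c)
        (AlgHomClass.commutes (ev u) c)).trans (AlgHomClass.commutes (ev v) c))
      map_star' := fun x => Subtype.ext ((hF _ (star (f x)) (by
        rw [map_star, hf]; rfl)).trans (map_star _ _)) }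
  have he : Function.Bijective e := by
    constructor
    · intro x y hxy
      have : ev v (f x) = ev v (f y) := congrArg Subtype.val hxy
      rw [← h', hf, hf] at this
      exact Subtype.ext this
    · intro y
      obtain ⟨x, hx⟩ := hv y
      refine ⟨⟨ev u x, by rw [← range_ev]; exact ⟨x, rfl⟩⟩, Subtype.ext ?_⟩
      rw [← hx]
      exact hF _ x rfl
  refine ⟨StarAlgEquiv.ofBijective e he, fun i j => Subtype.ext ?_⟩
  have := hF ⟨u i j, entry_mem_smooth u i j⟩ (freeMatrix N i j) (ev_freeMatrix_apply u i j)
  rw [ev_freeMatrix_apply] at this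
  exact this

/-- Being an intertwiner is the vanishing of certain polynomials in the coordinates, and equivalent
coordinates satisfy the same polynomial relations. -/
theorem Equivalent.homSpaces_eq (h : Equivalent u v) : homSpaces u = homSpaces v := by
  obtain ⟨e, he⟩ := h
  let u' : Matrix (Fin N) (Fin N) (smooth u) := Matrix.of fun i j => ⟨u i j, entry_mem_smooth u i j⟩
  let v' : Matrix (Fin N) (Fin N) (smooth v) := Matrix.of fun i j => ⟨v i j, entry_mem_smooth v i j⟩
  have hu : u'.map (smooth u).subtype = u := rfl
  have hv : v'.map (smooth v).subtype = v := rfl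
  have huv : u'.map (e : smooth u →⋆ₐ[ℂ] smooth v) = v' := by
    ext i j
    exact congrArg Subtype.val (he i j)
  have h1 : ∀ x, e (ev u' x) = ev v' x := fun x => by
    rw [← huv, ← hom_comp_ev]
    rfl
  have h2 : ∀ x, ((ev u' x : smooth u) : A) = ev u x := fun x => by
    conv_rhs => rw [← hu, ← hom_comp_ev]
    rfl
  have h3 : ∀ x, ((ev v' x : smooth v) : B) = ev v x := fun x => by
    conv_rhs => rw [← hv, ← hom_comp_ev]
    rfl
  have h4 : ∀ x, ev u x = 0 ↔ ev v x = 0 := by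
    intro x
    rw [← h2, ← h3, ← h1]
    simp
  funext k l
  ext T
  rw [mem_homSpaces_iff_defect, mem_homSpaces_iff_defect, ← Matrix.ext_iff, ← Matrix.ext_iff]
  rw [← freeMatrix_map_ev u, ← freeMatrix_map_ev v]
  simp only [← map_defect, Matrix.map_apply, Matrix.zero_apply, h4]

theorem IsWoronowicz.equivalent_iff (hu : IsWoronowicz u) (hv : IsWoronowicz v) :
    Equivalent u v ↔ homSpaces u = homSpaces v :=
  ⟨Equivalent.homSpaces_eq, fun h => equivalent_of_ev_eq_zero_iff (hu.ev_eq_zero_iff hv h)⟩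

end Equivalence

/-! ### Frobenius reciprocity -/

section Frobenius

open Matrix

variable {N : ℕ}

theorem Idx.fst_singleton {d : Color} {l : Word} (a : Fin N) (i : Idx N l) :
    Idx.fst (k := [d]) (l := l) (Fin.cons a i : Fin (l.length + 1) → Fin N) = fun _ => a := by
  funext t
  obtain ⟨t, ht⟩ := t
  obtain rfl : t = 0 := by simpa using ht
  rfl

theorem Idx.snd_singleton {d : Color} {l : Word} (a : Fin N) (i : Idx N l) :
    Idx.snd (k := [d]) (l := l) (Fin.cons a i : Fin (l.length + 1) → Fin N) = i := by
  funext t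
  have h : (⟨[d].length + t.1, by simp; omega⟩ : Fin (l.length + 1)) = t.succ := by
    ext
    simp
    omega
  change (Fin.cons a i : Fin (l.length + 1) → Fin N) ⟨[d].length + t.1, _⟩ = i t
  rw [h, Fin.cons_succ]

theorem Idx.snd_pair {c d : Color} {l : Word} (a b : Fin N) (i : Idx N l) :
    Idx.snd (k := [d, c]) (l := l)
      (Fin.cons a (Fin.cons b i : Fin (l.length + 1) → Fin N) : Fin (l.length + 1 + 1) → Fin N) =
      i := by
  funext t
  have h : (⟨[d, c].length + t.1, by simp; omega⟩ : Fin (l.length + 1 + 1)) = t.succ.succ := by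
    ext
    simp
    omega
  change (Fin.cons a (Fin.cons b i : Fin (l.length + 1) → Fin N) :
    Fin (l.length + 1 + 1) → Fin N) ⟨[d, c].length + t.1, _⟩ = i t
  rw [h, Fin.cons_succ, Fin.cons_succ]

theorem Idx.snd_nil {l : Word} (i : Idx N l) : Idx.snd (k := []) (l := l) i = i := by
  funext t
  change i ⟨0 + t.1, _⟩ = i t
  congr 1
  ext
  simp

theorem Idx.const_inj {d : Color} {a b : Fin N} :
    ((fun _ => a : Idx N [d]) = fun _ => b) ↔ a = b :=
  ⟨fun h => congrFun h (0 : Fin 1), fun h => by rw [h]⟩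

/-- The first letter of the source is moved to the target. -/
def rotate {c : Color} (d : Color) {k l : Word} (T : Op N (c :: k) l) : Op N k (d :: l) :=
  Matrix.of fun x y => T (fun t => x t.succ) (Fin.cons (x 0) y : Fin (k.length + 1) → Fin N)

/-- The first letter of the target is moved to the source. -/
def unrotate (c : Color) {d : Color} {k l : Word} (T : Op N k (d :: l)) : Op N (c :: k) l :=
  Matrix.of fun x y => T (Fin.cons (y 0) x : Fin (l.length + 1) → Fin N) fun t => y t.succ

theorem rotate_cons {c d : Color} {k l : Word} (T : Op N (c :: k) l) (a : Fin N) (x : Idx N l)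
    (y : Idx N k) : rotate d T (Fin.cons a x : Fin (l.length + 1) → Fin N) y =
      T x (Fin.cons a y : Fin (k.length + 1) → Fin N) := rfl

theorem unrotate_cons {c d : Color} {k l : Word} (T : Op N k (d :: l)) (a : Fin N) (x : Idx N l)
    (y : Idx N k) : unrotate c T x (Fin.cons a y : Fin (k.length + 1) → Fin N) =
      T (Fin.cons a x : Fin (l.length + 1) → Fin N) y := rfl

theorem rotate_unrotate {c d : Color} {k l : Word} (T : Op N k (d :: l)) :
    rotate d (unrotate c T) = T := by
  ext x y
  induction x using Idx.cons_induction with | h a x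
  rfl

theorem trace_rotate {c d : Color} {k l : Word} (S T : Op N (c :: k) l) :
    trace ((rotate d S)ᴴ * rotate d T) = trace (Sᴴ * T) := by
  simp only [trace, diag_apply, mul_apply, conjTranspose_apply]
  simp only [Idx.sum_cons]
  rw [Finset.sum_comm]
  refine Finset.sum_congr rfl fun a _ => ?_
  rfl

theorem opR_cons {c d : Color} {l : Word} (a b : Fin N) (i : Idx N l) (j : Idx N []) :
    opR N d c (Idx.fst (k := [d, c]) (l := l)
      (Fin.cons a (Fin.cons b i : Fin (l.length + 1) → Fin N) : Fin (l.length + 1 + 1) → Fin N)) j =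
      if a = b then 1 else 0 := rfl

/-- The map `1 ⊗ T`, where `1` is the identity of a letter. -/
def idTensor (c : Color) {k l : Word} (T : Op N k l) : Op N (c :: k) (c :: l) :=
  Op.tensor (1 : Op N [c] [c]) T

/-- The map `R ⊗ 1`. -/
def capTensor (c d : Color) (k : Word) : Op N k (c :: d :: k) :=
  Op.tensor (opR N c d) (1 : Op N k k)

theorem idTensor_cons {c : Color} {k l : Word} (T : Op N k l) (a b : Fin N) (x : Idx N l)
    (y : Idx N k) :
    idTensor c T (Fin.cons a x : Fin (l.length + 1) → Fin N)
      (Fin.cons b y : Fin (k.length + 1) → Fin N) = if a = b then T x y else 0 := by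
  change (1 : Op N [c] [c]) (Idx.fst (k := [c]) (l := l) (Fin.cons a x : Fin (l.length + 1) → Fin N))
      (Idx.fst (k := [c]) (l := k) (Fin.cons b y : Fin (k.length + 1) → Fin N)) *
    T (Idx.snd (k := [c]) (l := l) (Fin.cons a x : Fin (l.length + 1) → Fin N))
      (Idx.snd (k := [c]) (l := k) (Fin.cons b y : Fin (k.length + 1) → Fin N)) = _
  rw [Idx.fst_singleton, Idx.fst_singleton, Idx.snd_singleton, Idx.snd_singleton, one_apply]
  simp only [Idx.const_inj, ite_mul, one_mul, zero_mul]

theorem capTensor_cons {c d : Color} {k : Word} (a b : Fin N) (x y : Idx N k) :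
    capTensor c d k
      (Fin.cons a (Fin.cons b x : Fin (k.length + 1) → Fin N) : Fin (k.length + 1 + 1) → Fin N) y =
      if a = b then if x = y then 1 else 0 else 0 := by
  change opR N c d (Idx.fst (k := [c, d]) (l := k)
      (Fin.cons a (Fin.cons b x : Fin (k.length + 1) → Fin N) : Fin (k.length + 1 + 1) → Fin N))
      (Idx.fst (k := []) (l := k) y) *
    (1 : Op N k k) (Idx.snd (k := [c, d]) (l := k)
      (Fin.cons a (Fin.cons b x : Fin (k.length + 1) → Fin N) : Fin (k.length + 1 + 1) → Fin N))
      (Idx.snd (k := []) (l := k) y) = _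
  rw [opR_cons, Idx.snd_pair, Idx.snd_nil, one_apply]
  simp only [ite_mul, one_mul, zero_mul]

/-- Bending a leg with `R` expresses the reindexing by categorical operations, so it stays in a
tensor category. The next lemma bends it back with `R^*`. -/
theorem rotate_eq {c d : Color} {k l : Word} (T : Op N (c :: k) l) :
    rotate d T = idTensor d T * capTensor d c k := by
  ext x y
  change _ = ∑ z : Idx N (d :: c :: k), idTensor d T x z * capTensor d c k z y
  rw [Idx.sum_cons]
  induction x using Idx.cons_induction with | h a x
  have h : ∀ e : Fin N, ∑ z : Idx N (c :: k), idTensor d T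
      (Fin.cons a x : Fin (l.length + 1) → Fin N)
      (Fin.cons e z : Fin (k.length + 1 + 1) → Fin N) *
      capTensor d c k (Fin.cons e z : Fin (k.length + 1 + 1) → Fin N) y =
      if a = e then T x (Fin.cons e y : Fin (k.length + 1) → Fin N) else 0 := by
    intro e
    rw [Idx.sum_cons]
    have h' : ∀ (f : Fin N) (z : Idx N k), idTensor d T
        (Fin.cons a x : Fin (l.length + 1) → Fin N)
        (Fin.cons e (Fin.cons f z : Fin (k.length + 1) → Fin N) : Fin (k.length + 1 + 1) → Fin N) *
        capTensor d c k (Fin.cons e (Fin.cons f z : Fin (k.length + 1) → Fin N) :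
          Fin (k.length + 1 + 1) → Fin N) y =
        if z = y then if e = f then
          if a = e then T x (Fin.cons f z : Fin (k.length + 1) → Fin N) else 0 else 0 else 0 := by
      intro f z
      have h1 := idTensor_cons (c := d) T a e x (Fin.cons f z : Fin (k.length + 1) → Fin N)
      refine (congrArg₂ (· * ·) h1 (capTensor_cons e f z y)).trans ?_
      split_ifs <;> simp
    refine (Finset.sum_congr rfl fun f _ => Finset.sum_congr rfl fun z _ => h' f z).trans ?_
    simp
  rw [rotate_cons]
  refine Eq.trans ?_ (Finset.sum_congr rfl fun e _ => h e).symm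
  simp

theorem unrotate_eq {c d : Color} {k l : Word} (T : Op N k (d :: l)) :
    unrotate c T = (capTensor c d l)ᴴ * idTensor c T := by
  ext x y
  change _ = ∑ z : Idx N (c :: d :: l), (capTensor c d l)ᴴ x z * idTensor c T z y
  rw [Idx.sum_cons]
  induction y using Idx.cons_induction with | h a y
  have h : ∀ e : Fin N, ∑ z : Idx N (d :: l),
      (capTensor c d l)ᴴ x (Fin.cons e z : Fin (l.length + 1 + 1) → Fin N) *
      idTensor c T (Fin.cons e z : Fin (l.length + 1 + 1) → Fin N)
        (Fin.cons a y : Fin (k.length + 1) → Fin N) =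
      if e = a then T (Fin.cons e x : Fin (l.length + 1) → Fin N) y else 0 := by
    intro e
    rw [Idx.sum_cons]
    have h' : ∀ (f : Fin N) (z : Idx N l),
        (capTensor c d l)ᴴ x (Fin.cons e (Fin.cons f z : Fin (l.length + 1) → Fin N) :
          Fin (l.length + 1 + 1) → Fin N) *
        idTensor c T
          (Fin.cons e (Fin.cons f z : Fin (l.length + 1) → Fin N) : Fin (l.length + 1 + 1) → Fin N)
          (Fin.cons a y : Fin (k.length + 1) → Fin N) =
        if z = x then if e = f then
          if e = a then T (Fin.cons f z : Fin (l.length + 1) → Fin N) y else 0 else 0 else 0 := by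
      intro f z
      have h1 := idTensor_cons (c := c) T e a (Fin.cons f z : Fin (l.length + 1) → Fin N) y
      rw [conjTranspose_apply]
      refine (congrArg₂ (· * ·) (congrArg star (capTensor_cons e f z x)) h1).trans ?_
      split_ifs <;> simp
    refine (Finset.sum_congr rfl fun f _ => Finset.sum_congr rfl fun z _ => h' f z).trans ?_
    simp
  rw [unrotate_cons]
  refine Eq.trans ?_ (Finset.sum_congr rfl fun e _ => h e).symm
  simp

namespace IsTensorCategory

variable {C : HomSpaces N}

theorem opR_mem (hC : IsTensorCategory C) (c : Color) : opR N c c.flip ∈ C [] [c, c.flip] := by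
  cases c
  · exact hC.opR_white_black_mem
  · exact hC.opR_black_white_mem

theorem opR_flip_mem (hC : IsTensorCategory C) (c : Color) :
    opR N c.flip c ∈ C [] [c.flip, c] := by
  cases c
  · exact hC.opR_black_white_mem
  · exact hC.opR_white_black_mem

theorem idTensor_mem (hC : IsTensorCategory C) (c : Color) {k l : Word} {T : Op N k l}
    (hT : T ∈ C k l) : idTensor c T ∈ C (c :: k) (c :: l) :=
  hC.tensor_mem (hC.id_mem [c]) hT

theorem rotate_mem (hC : IsTensorCategory C) {c : Color} {k l : Word} {T : Op N (c :: k) l}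
    (hT : T ∈ C (c :: k) l) : rotate c.flip T ∈ C k (c.flip :: l) := by
  rw [rotate_eq]
  exact hC.comp_mem (hC.idTensor_mem c.flip hT) (hC.tensor_mem (hC.opR_flip_mem c) (hC.id_mem k))

theorem unrotate_mem (hC : IsTensorCategory C) {c : Color} {k l : Word}
    {T : Op N k (c.flip :: l)} (hT : T ∈ C k (c.flip :: l)) : unrotate c T ∈ C (c :: k) l := by
  rw [unrotate_eq]
  exact hC.comp_mem (hC.adjoint_mem (hC.tensor_mem (hC.opR_mem c) (hC.id_mem l)))
    (hC.idTensor_mem c hT)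

/-- Rotation only permutes matrix entries, so it is isometric, and on the spaces of `C` it is
inverted by `unrotate`. -/
theorem isParsevalFrame_rotate (hC : IsTensorCategory C) {c : Color} {k l : Word} {ι : Type*}
    [Fintype ι] {X : ι → Op N (c :: k) l} (hX : IsParsevalFrame (C (c :: k) l) X) :
    IsParsevalFrame (C k (c.flip :: l)) fun α => rotate c.flip (X α) where
  mem α := hC.rotate_mem (hX.mem α)
  sum_smul y hy := by
    have h := congrArg (rotate c.flip) (hX.sum_smul _ (hC.unrotate_mem hy))
    rw [rotate_unrotate] at h
    conv_rhs => rw [← h]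
    conv_lhs => rw [← rotate_unrotate (c := c) y]
    simp only [trace_rotate]
    ext i j
    simp [rotate, Matrix.sum_apply]

end IsTensorCategory

end Frobenius

/-! ### The Haar functional -/

section Haar

open Matrix
open scoped ComplexOrder

variable {N : ℕ} (C : HomSpaces N)

/-- The matrix of the orthogonal projection onto `C(∅, k)`. -/
def fixedProjection (k : Word) : Matrix (Idx N k) (Idx N k) ℂ :=
  Matrix.of fun i j =>
    ∑ α, (exists_isParsevalFrame (C [] k)).choose_spec.choose α i Fin.elim0 *
      star ((exists_isParsevalFrame (C [] k)).choose_spec.choose α j Fin.elim0)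

variable {C}

/-- The kernel does not depend on the frame chosen in the definition, so any convenient one may be
used. -/
theorem fixedProjection_apply {k : Word} {ι : Type*} [Fintype ι] {X : ι → Op N [] k}
    (hX : IsParsevalFrame (C [] k) X) (z : Idx N []) (i j : Idx N k) :
    fixedProjection C k i j = ∑ α, X α i z * star (X α j z) := by
  obtain rfl : z = Fin.elim0 := Subsingleton.elim (α := Fin 0 → Fin N) _ _
  exact (exists_isParsevalFrame (C [] k)).choose_spec.choose_spec.kernel_eq hX _ _ _ _

/-- `T` maps `C(∅,k)` into `C(∅,l)` and `T^*` maps back, so `T` intertwines the orthogonal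
projections. -/
theorem IsTensorCategory.mul_fixedProjection (hC : IsTensorCategory C) {k l : Word}
    {T : Op N k l} (hT : T ∈ C k l) : T * fixedProjection C k = fixedProjection C l * T := by
  obtain ⟨r, X, hX⟩ := exists_isParsevalFrame (C [] k)
  obtain ⟨s, Y, hY⟩ := exists_isParsevalFrame (C [] l)
  ext i j
  have h := hX.intertwine hY T (fun x hx => hC.comp_mem hT hx)
    (fun y hy => hC.comp_mem (hC.adjoint_mem hT) hy) i Fin.elim0 j Fin.elim0
  simp only [mul_apply, fixedProjection_apply hX Fin.elim0, fixedProjection_apply hY Fin.elim0]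
  simp only [mul_apply, star_sum, Finset.sum_mul, Finset.mul_sum, mul_assoc] at h ⊢
  rw [Finset.sum_comm, h]
  conv_rhs => rw [Finset.sum_comm]
  refine Finset.sum_congr rfl fun β _ => Finset.sum_congr rfl fun z _ => ?_
  rw [conjTranspose_apply, star_mul', star_star]
  ring

variable (C) in
/-- The Haar functional of a tensor category, on the free ⋆-algebra. -/
def haar : FreeStarAlgebra (Fin N × Fin N) →ₗ[ℂ] ℂ where
  toFun x := x.coeff.sum fun m c => c * fixedProjection C (colors m) (rowIdx m) (colIdx m)
  map_add' x y := by
    rw [MonoidAlgebra.coeff_add]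
    exact Finsupp.sum_add_index' (h := fun m (c : ℂ) =>
      c * fixedProjection C (colors m) (rowIdx m) (colIdx m)) (fun _ => zero_mul _)
      fun _ _ _ => add_mul _ _ _
  map_smul' c x := by
    rw [MonoidAlgebra.coeff_smul, Finsupp.sum_smul_index' (h := fun m (c : ℂ) =>
      c * fixedProjection C (colors m) (rowIdx m) (colIdx m)) fun _ => zero_mul _,
      RingHom.id_apply, Finsupp.smul_sum]
    simp only [Finsupp.sum, smul_eq_mul, mul_assoc]

theorem haar_tensorPower (k : Word) (i j : Idx N k) :
    haar C (tensorPower (freeMatrix N) k i j) = fixedProjection C k i j := by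
  rw [tensorPower_freeMatrix]
  change Finsupp.sum (MonoidAlgebra.coeff _) (fun m (c : ℂ) =>
    c * fixedProjection C (colors m) (rowIdx m) (colIdx m)) = _
  rw [MonoidAlgebra.coeff_single, Finsupp.sum_single_index (zero_mul _), one_mul]
  exact apply_monomial (fun k => fixedProjection C k) i j

/-- The value is an entry of `T P_k - P_l T`, where `P` denotes the projections onto the fixed
vectors. -/
theorem IsTensorCategory.haar_defect (hC : IsTensorCategory C) {k l : Word} {T : Op N k l}
    (hT : T ∈ C k l) (i : Idx N l) (j : Idx N k) : haar C (defect (freeMatrix N) T i j) = 0 := by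
  have h := congrFun (congrFun (hC.mul_fixedProjection hT) i) j
  rw [mul_apply, mul_apply] at h
  rw [defect, Matrix.sub_apply, mul_apply, mul_apply, map_sub, map_sum, map_sum, sub_eq_zero]
  refine Eq.trans (Finset.sum_congr rfl fun z _ => ?_)
    (h.trans (Finset.sum_congr rfl fun z _ => ?_))
  · rw [Matrix.map_apply, ← Algebra.smul_def, map_smul, haar_tensorPower, smul_eq_mul]
  · rw [Matrix.map_apply, ← Algebra.commutes, ← Algebra.smul_def, map_smul, haar_tensorPower,
      smul_eq_mul, mul_comm]

section Defect

variable {A : Type*} [Ring A] [StarRing A] [Algebra ℂ A]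

/-- A relation multiplied on the left by a coefficient of a tensor power is the relation for `1 ⊗
T`; the next lemma does the right-hand side. For a tensor category, the span of the relations is
thus a two-sided ideal. -/
theorem defect_one_tensor (u : Matrix (Fin N) (Fin N) A) {k l p : Word} (T : Op N k l)
    (a b : Idx N p) (i : Idx N l) (j : Idx N k) :
    defect u (Op.tensor (1 : Op N p p) T) (Idx.append (a, i)) (Idx.append (b, j)) =
      tensorPower u p a b * defect u T i j := by
  rw [defect, defect, Matrix.sub_apply, Matrix.sub_apply, mul_apply, mul_apply, mul_apply,
    mul_apply, mul_sub, Idx.sum_append, Idx.sum_append]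
  simp only [tensorPower_append, Idx.append_fst, Idx.append_snd, Matrix.map_apply, Op.tensor,
    Matrix.of_apply, one_apply, ite_mul, one_mul, zero_mul, apply_ite (algebraMap ℂ A), map_zero,
    mul_ite, mul_zero]
  congr 1
  · rw [Finset.sum_comm]
    simp only [Finset.sum_ite_eq, Finset.mem_univ, if_true]
    rw [Finset.mul_sum]
    refine Finset.sum_congr rfl fun z _ => ?_
    rw [← mul_assoc, ← mul_assoc, Algebra.commutes]
  · rw [Finset.sum_comm]
    simp only [Finset.sum_ite_eq', Finset.mem_univ, if_true]
    rw [Finset.mul_sum]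
    exact Finset.sum_congr rfl fun z _ => mul_assoc _ _ _

theorem defect_tensor_one (u : Matrix (Fin N) (Fin N) A) {k l p : Word} (T : Op N k l)
    (a b : Idx N p) (i : Idx N l) (j : Idx N k) :
    defect u (Op.tensor T (1 : Op N p p)) (Idx.append (i, a)) (Idx.append (j, b)) =
      defect u T i j * tensorPower u p a b := by
  rw [defect, defect, Matrix.sub_apply, Matrix.sub_apply, mul_apply, mul_apply, mul_apply,
    mul_apply, sub_mul, Idx.sum_append, Idx.sum_append]
  simp only [tensorPower_append, Idx.append_fst, Idx.append_snd, Matrix.map_apply, Op.tensor,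
    Matrix.of_apply, one_apply, mul_one, ite_mul, zero_mul, apply_ite (algebraMap ℂ A), map_zero,
    mul_ite, mul_zero]
  congr 1
  · simp only [Finset.sum_ite_eq, Finset.mem_univ, if_true]
    rw [Finset.sum_mul]
    exact Finset.sum_congr rfl fun z _ => (mul_assoc _ _ _).symm
  · simp only [Finset.sum_ite_eq', Finset.mem_univ, if_true]
    rw [Finset.sum_mul]
    refine Finset.sum_congr rfl fun z _ => ?_
    rw [mul_assoc, mul_assoc, Algebra.commutes]

end Defect

theorem FreeStarAlgebra.induction_tensorPower {P : FreeStarAlgebra (Fin N × Fin N) → Prop}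
    (h0 : P 0) (hadd : ∀ x y, P x → P y → P (x + y)) (hsmul : ∀ (c : ℂ) x, P x → P (c • x))
    (h : ∀ (k : Word) (i j : Idx N k), P (tensorPower (freeMatrix N) k i j))
    (x : FreeStarAlgebra (Fin N × Fin N)) : P x := by
  induction x using MonoidAlgebra.induction_linear with
  | zero => exact h0
  | add x y hx hy => exact hadd x y hx hy
  | single m c =>
    have : (MonoidAlgebra.single m c : FreeStarAlgebra (Fin N × Fin N)) =
        c • MonoidAlgebra.single m 1 := by
      rw [MonoidAlgebra.smul_single, smul_eq_mul, mul_one]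
    rw [this, ← tensorPower_colors]
    exact hsmul _ _ (h _ _ _)

/-- The Haar functional vanishes on the two-sided ideal generated by the relations. -/
theorem IsTensorCategory.haar_mul_defect_mul (hC : IsTensorCategory C) {k l : Word} {T : Op N k l}
    (hT : T ∈ C k l) (i : Idx N l) (j : Idx N k) (x y : FreeStarAlgebra (Fin N × Fin N)) :
    haar C (x * (defect (freeMatrix N) T i j * y)) = 0 := by
  induction x using FreeStarAlgebra.induction_tensorPower with
  | h0 => rw [zero_mul, map_zero]
  | hadd x x' hx hx' => rw [add_mul, map_add, hx, hx', add_zero]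
  | hsmul c x hx => rw [Algebra.smul_mul_assoc, map_smul, hx, smul_zero]
  | h p a b =>
    induction y using FreeStarAlgebra.induction_tensorPower with
    | h0 => rw [mul_zero, mul_zero, map_zero]
    | hadd x x' hx hx' => rw [mul_add, mul_add, map_add, hx, hx', add_zero]
    | hsmul c x hx => rw [Algebra.mul_smul_comm, Algebra.mul_smul_comm, map_smul, hx, smul_zero]
    | h q c d =>
      rw [← defect_tensor_one, ← defect_one_tensor]
      exact hC.haar_defect (hC.tensor_mem (hC.id_mem p) (hC.tensor_mem hT (hC.id_mem q))) _ _

/-- Induction on `k`: the adjoint of the first letter is a letter of the other color, which joins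
the front of `l` while the frame is rotated. For empty `k` this is the definition of the functional.
-/
theorem IsTensorCategory.haar_star_mul (hC : IsTensorCategory C) {k l : Word} {ι : Type*}
    [Fintype ι] {X : ι → Op N k l} (hX : IsParsevalFrame (C k l) X) (i j : Idx N k)
    (i' j' : Idx N l) :
    haar C (star (tensorPower (freeMatrix N) k i j) * tensorPower (freeMatrix N) l i' j') =
      ∑ α, X α i' i * star (X α j' j) := by
  induction k generalizing l with
  | nil =>
    rw [tensorPower_nil, star_one, one_mul, haar_tensorPower, fixedProjection_apply hX i,
      Subsingleton.elim (α := Fin 0 → Fin N) i j]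
  | cons c k ih =>
    induction i using Idx.cons_induction with | h a i
    induction j using Idx.cons_induction with | h b j
    have h := ih (hC.isParsevalFrame_rotate hX) i j
      (Fin.cons a i' : Fin (l.length + 1) → Fin N) (Fin.cons b j' : Fin (l.length + 1) → Fin N)
    rw [tensorPower_cons, colored_flip] at h
    rw [tensorPower_cons, star_mul, mul_assoc]
    exact h

end Haar

/-! ### The algebra of endomorphisms of a direct sum of tensor powers -/

section EndAlgebra

open Matrix
open scoped ComplexOrder

variable {N : ℕ} {C : HomSpaces N}

theorem IsTensorCategory.biunitary_of_le (hC : IsTensorCategory C) {A : Type*} [Ring A] [StarRing A]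
    [Algebra ℂ A] {v : Matrix (Fin N) (Fin N) A} (h : ∀ k l, C k l ≤ homSpaces v k l) :
    Biunitary v := by
  have h1 : ∀ c a b, ∑ d, colored v c a d * star (colored v c b d) = if a = b then 1 else 0 := by
    intro c a b
    have := defect_opR v c a b Fin.elim0 Fin.elim0
    rw [mem_homSpaces_iff_defect.1 (h _ _ (hC.opR_mem c)), Matrix.zero_apply] at this
    exact (sub_eq_zero.1 this.symm).symm
  have h2 : ∀ c a b, ∑ d, star (colored v c d a) * colored v c d b = if a = b then 1 else 0 := by
    intro c a b
    have := defect_conjTranspose_opR v c a b Fin.elim0 Fin.elim0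
    rw [mem_homSpaces_iff_defect.1 (h _ _ (hC.adjoint_mem (hC.opR_flip_mem c))),
      Matrix.zero_apply] at this
    exact sub_eq_zero.1 this.symm
  refine ⟨?_, ?_, ?_, ?_⟩
  · ext a b
    exact h1 .white a b
  · ext a b
    exact h2 .white a b
  · ext a b
    rw [mul_apply, one_apply, ← h1 .black]
    exact Finset.sum_congr rfl fun d _ => congrArg _ (star_star _).symm
  · ext a b
    rw [mul_apply, one_apply, ← h2 .black]
    exact Finset.sum_congr rfl fun d _ => congrArg (· * _) (star_star _).symm

variable {ι : Type} {κ : ι → Word}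

/-- The transpose of a block of a matrix over a direct sum. -/
def blockTranspose (X : Matrix (SumIdx N κ) (SumIdx N κ) ℂ) (s t : ι) : Op N (κ s) (κ t) :=
  Matrix.of fun i j => X ⟨s, j⟩ ⟨t, i⟩

/-- Transposition reverses products. This convention is what makes the formula of `haar_star_mul`
take the form `X a X^*`. -/
theorem blockTranspose_mul [Fintype ι] (X Y : Matrix (SumIdx N κ) (SumIdx N κ) ℂ) (s t : ι) :
    blockTranspose (X * Y) s t = ∑ r, blockTranspose Y r t * blockTranspose X s r := by
  ext i j
  rw [Matrix.sum_apply]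
  change (X * Y) ⟨s, j⟩ ⟨t, i⟩ = _
  rw [mul_apply, Fintype.sum_sigma]
  exact Finset.sum_congr rfl fun r _ => Finset.sum_congr rfl fun z _ => mul_comm _ _

theorem blockTranspose_one [DecidableEq ι] (s : ι) :
    blockTranspose (1 : Matrix (SumIdx N κ) (SumIdx N κ) ℂ) s s = 1 := by
  ext i j
  simp [blockTranspose, one_apply, eq_comm]

theorem blockTranspose_one_ne [DecidableEq ι] {s t : ι} (h : s ≠ t) :
    blockTranspose (1 : Matrix (SumIdx N κ) (SumIdx N κ) ℂ) s t = 0 := by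
  ext i j
  simp [blockTranspose, one_apply, h]

variable [DecidableEq ι]

/-- The matrix with a single nonzero block, the transpose of `y`. -/
def singleBlock (s t : ι) (y : Op N (κ s) (κ t)) : Matrix (SumIdx N κ) (SumIdx N κ) ℂ :=
  Matrix.of fun p q => if h : p.1 = s ∧ q.1 = t then y (h.2 ▸ q.2) (h.1 ▸ p.2) else 0

theorem singleBlock_apply (s t : ι) (y : Op N (κ s) (κ t)) (i : Idx N (κ s)) (j : Idx N (κ t)) :
    singleBlock s t y ⟨s, i⟩ ⟨t, j⟩ = y j i := by
  simp [singleBlock]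

theorem singleBlock_apply_left {s t : ι} (y : Op N (κ s) (κ t)) {p q : SumIdx N κ} (h : p.1 ≠ s) :
    singleBlock s t y p q = 0 := dif_neg fun h' => h h'.1

theorem singleBlock_apply_right {s t : ι} (y : Op N (κ s) (κ t)) {p q : SumIdx N κ} (h : q.1 ≠ t) :
    singleBlock s t y p q = 0 := dif_neg fun h' => h h'.2

theorem blockTranspose_singleBlock (s t : ι) (y : Op N (κ s) (κ t)) :
    blockTranspose (singleBlock s t y) s t = y := by
  ext i j
  exact singleBlock_apply s t y j i

variable [Fintype ι]

/-- The matrices over a direct sum, all whose blocks have their transposes in `C`. -/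
def IsTensorCategory.endAlgebra (hC : IsTensorCategory C) (κ : ι → Word) :
    StarSubalgebra ℂ (Matrix (SumIdx N κ) (SumIdx N κ) ℂ) where
  carrier := {X | ∀ s t, blockTranspose X s t ∈ C (κ s) (κ t)}
  mul_mem' {X Y} hX hY s t := by
    rw [blockTranspose_mul]
    exact Submodule.sum_mem _ fun r _ => hC.comp_mem (hY r t) (hX s r)
  add_mem' hX hY s t := (C (κ s) (κ t)).add_mem (hX s t) (hY s t)
  algebraMap_mem' c s t := by
    rw [Algebra.algebraMap_eq_smul_one]
    refine (C (κ s) (κ t)).smul_mem c ?_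
    change blockTranspose 1 s t ∈ _
    by_cases h : s = t
    · subst h
      rw [blockTranspose_one]
      exact hC.id_mem _
    · rw [blockTranspose_one_ne h]
      exact zero_mem _
  star_mem' hX s t := hC.adjoint_mem (hX t s)

theorem IsTensorCategory.singleBlock_mem_endAlgebra (hC : IsTensorCategory C) {s t : ι}
    {y : Op N (κ s) (κ t)} (hy : y ∈ C (κ s) (κ t)) :
    singleBlock s t y ∈ hC.endAlgebra κ := by
  intro s' t'
  by_cases hs : s' = s
  · by_cases ht : t' = t
    · subst hs ht
      rwa [blockTranspose_singleBlock]
    · convert zero_mem (C (κ s') (κ t'))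
      ext i j
      exact singleBlock_apply_right y ht
  · convert zero_mem (C (κ s') (κ t'))
    ext i j
    exact singleBlock_apply_left y hs

theorem singleBlock_mul_apply (s t : ι) (y : Op N (κ s) (κ t))
    (b : Matrix (SumIdx N κ) (SumIdx N κ) ℂ) (i : Idx N (κ s)) (q : SumIdx N κ) :
    (singleBlock s t y * b) ⟨s, i⟩ q = ∑ z, y z i * b ⟨t, z⟩ q := by
  rw [mul_apply, Fintype.sum_sigma, Finset.sum_eq_single t]
  · simp only [singleBlock_apply]
  · intro r _ hr
    exact Finset.sum_eq_zero fun z _ => by rw [singleBlock_apply_right y hr, zero_mul]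
  · simp

theorem singleBlock_mul_apply_ne {s t : ι} (y : Op N (κ s) (κ t))
    (b : Matrix (SumIdx N κ) (SumIdx N κ) ℂ) {p : SumIdx N κ} (hp : p.1 ≠ s) (q : SumIdx N κ) :
    (singleBlock s t y * b) p q = 0 := by
  rw [mul_apply]
  exact Finset.sum_eq_zero fun z _ => by rw [singleBlock_apply_left y hp, zero_mul]

theorem mul_singleBlock_apply (s t : ι) (y : Op N (κ s) (κ t))
    (b : Matrix (SumIdx N κ) (SumIdx N κ) ℂ) (p : SumIdx N κ) (j : Idx N (κ t)) :
    (b * singleBlock s t y) p ⟨t, j⟩ = ∑ z, b p ⟨s, z⟩ * y j z := by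
  rw [mul_apply, Fintype.sum_sigma, Finset.sum_eq_single s]
  · simp only [singleBlock_apply]
  · intro r _ hr
    exact Finset.sum_eq_zero fun z _ => by rw [singleBlock_apply_left y hr, mul_zero]
  · simp

theorem mul_singleBlock_apply_ne {s t : ι} (y : Op N (κ s) (κ t))
    (b : Matrix (SumIdx N κ) (SumIdx N κ) ℂ) (p : SumIdx N κ) {q : SumIdx N κ} (hq : q.1 ≠ t) :
    (b * singleBlock s t y) p q = 0 := by
  rw [mul_apply]
  exact Finset.sum_eq_zero fun z _ => by rw [singleBlock_apply_right y hq, mul_zero]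

/-- The matrices commuting with the endomorphisms are block diagonal. -/
theorem IsTensorCategory.apply_eq_zero_of_commute (hC : IsTensorCategory C)
    {b : Matrix (SumIdx N κ) (SumIdx N κ) ℂ} (hb : ∀ x ∈ hC.endAlgebra κ, x * b = b * x)
    {p q : SumIdx N κ} (h : p.1 ≠ q.1) : b p q = 0 := by
  have h1 := congrFun (congrFun (hb _ (hC.singleBlock_mem_endAlgebra (s := p.1) (t := p.1)
    (hC.id_mem _))) p) q
  rw [mul_singleBlock_apply_ne _ _ _ h.symm] at h1
  rw [← h1]
  obtain ⟨s, i⟩ := p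
  rw [singleBlock_mul_apply]
  simp [one_apply]

/-- Extracting a block is the adjoint of inserting one, for the Hilbert–Schmidt products. -/
theorem trace_conjTranspose_mul_singleBlock (X : Matrix (SumIdx N κ) (SumIdx N κ) ℂ) (s t : ι)
    (y : Op N (κ s) (κ t)) :
    trace (Xᴴ * singleBlock s t y) = trace ((blockTranspose X s t)ᴴ * y) := by
  rw [trace, trace, Fintype.sum_sigma, Finset.sum_eq_single t]
  · simp only [diag_apply, mul_singleBlock_apply]
    rw [Finset.sum_comm]
    rfl
  · intro r _ hr
    exact Finset.sum_eq_zero fun z _ => by rw [diag_apply, mul_singleBlock_apply_ne _ _ _ hr]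
  · simp

/-- Expand the matrix with the single block `y` in the frame, then extract that block. -/
theorem IsTensorCategory.isParsevalFrame_blockTranspose (hC : IsTensorCategory C) {τ : Type*}
    [Fintype τ] {X : τ → Matrix (SumIdx N κ) (SumIdx N κ) ℂ}
    (hX : IsParsevalFrame (hC.endAlgebra κ).toSubalgebra.toSubmodule X) (s t : ι) :
    IsParsevalFrame (C (κ s) (κ t)) fun γ => blockTranspose (X γ) s t where
  mem γ := hX.mem γ s t
  sum_smul y hy := by
    have h := congrArg (fun x => blockTranspose x s t)
      (hX.sum_smul _ (hC.singleBlock_mem_endAlgebra hy))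
    simp only [trace_conjTranspose_mul_singleBlock, blockTranspose_singleBlock] at h
    conv_rhs => rw [← h]
    ext i j
    simp [blockTranspose, Matrix.sum_apply]

theorem star_pairing_mul_pairing {V M : Type*} [Fintype V] [Ring M] [StarRing M] [Algebra ℂ M]
    [StarModule ℂ M] (φ : M →ₗ[ℂ] ℂ) (a : Matrix V V ℂ) (w : Matrix V V M) :
    φ (star (pairing a w) * pairing a w) =
      ∑ p, ∑ q, ∑ p', ∑ q', star (a p q) * a p' q' * φ (star (w p q) * w p' q') := by
  have h : star (pairing a w) = ∑ p, ∑ q, star (a p q) • star (w p q) := by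
    simp only [pairing, star_sum, star_smul]
  rw [h, Finset.sum_mul, map_sum]
  refine Finset.sum_congr rfl fun p _ => ?_
  rw [Finset.sum_mul, map_sum]
  refine Finset.sum_congr rfl fun q _ => ?_
  rw [pairing, Finset.mul_sum, map_sum]
  refine Finset.sum_congr rfl fun p' _ => ?_
  rw [Finset.mul_sum, map_sum]
  refine Finset.sum_congr rfl fun q' _ => ?_
  rw [Algebra.smul_mul_assoc, Algebra.mul_smul_comm, map_smul, map_smul, smul_eq_mul, smul_eq_mul,
    mul_assoc]

theorem trace_conjTranspose_mul_average {V τ : Type*} [Fintype V] [Fintype τ] (a : Matrix V V ℂ)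
    (X : τ → Matrix V V ℂ) :
    trace (aᴴ * ∑ γ, X γ * a * (X γ)ᴴ) =
      ∑ p, ∑ q, ∑ p', ∑ q', star (a p q) * a p' q' * ∑ γ, X γ p p' * star (X γ q q') := by
  simp only [trace, diag_apply, mul_apply, Matrix.sum_apply, conjTranspose_apply]
  rw [Finset.sum_comm]
  refine Finset.sum_congr rfl fun p _ => Finset.sum_congr rfl fun q _ => ?_
  rw [Finset.sum_comm]
  conv_rhs => rw [Finset.sum_comm]
  rw [Finset.mul_sum]
  refine Finset.sum_congr rfl fun q' _ => ?_
  simp only [Finset.mul_sum, Finset.sum_mul]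
  rw [Finset.sum_comm]
  refine Finset.sum_congr rfl fun p' _ => Finset.sum_congr rfl fun γ _ => ?_
  ring

/-- A single frame of the endomorphism algebra serves all pairs of summands at once, through its
blocks; off-diagonal blocks of the coefficient matrix contribute nothing. -/
theorem IsTensorCategory.haar_star_pairing_mul (hC : IsTensorCategory C) {τ : Type*}
    [Fintype τ] {X : τ → Matrix (SumIdx N κ) (SumIdx N κ) ℂ}
    (hX : IsParsevalFrame (hC.endAlgebra κ).toSubalgebra.toSubmodule X)
    (a : ∀ s, Matrix (Idx N (κ s)) (Idx N (κ s)) ℂ) :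
    haar C (star (pairing (blockDiagonal' a) (sumPower (freeMatrix N) κ)) *
      pairing (blockDiagonal' a) (sumPower (freeMatrix N) κ)) =
      trace ((blockDiagonal' a)ᴴ * ∑ γ, X γ * blockDiagonal' a * (X γ)ᴴ) := by
  rw [star_pairing_mul_pairing, trace_conjTranspose_mul_average]
  refine Finset.sum_congr rfl fun p _ => Finset.sum_congr rfl fun q _ =>
    Finset.sum_congr rfl fun p' _ => Finset.sum_congr rfl fun q' _ => ?_
  obtain ⟨s, i⟩ := p
  obtain ⟨s', j⟩ := q
  obtain ⟨t, i'⟩ := p'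
  obtain ⟨t', j'⟩ := q'
  by_cases hs : s = s'
  · by_cases ht : t = t'
    · subst hs ht
      rw [sumPower, blockDiagonal'_apply_eq (fun s => tensorPower (freeMatrix N) (κ s)),
        blockDiagonal'_apply_eq (fun s => tensorPower (freeMatrix N) (κ s)),
        hC.haar_star_mul (hC.isParsevalFrame_blockTranspose hX s t)]
      rfl
    · rw [blockDiagonal'_apply_ne a _ _ ht, mul_zero, zero_mul, zero_mul]
  · rw [blockDiagonal'_apply_ne a _ _ hs, star_zero, zero_mul, zero_mul, zero_mul]

theorem IsTensorCategory.isPositiveFunctional_haar (hC : IsTensorCategory C) :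
    IsPositiveFunctional (haar C) := by
  intro x
  obtain ⟨ι, _, _, κ, a, rfl⟩ := exists_eq_pairing x
  obtain ⟨r, X, hX⟩ := exists_isParsevalFrame (hC.endAlgebra κ).toSubalgebra.toSubmodule
  rw [hC.haar_star_pairing_mul hX]
  exact (hX.average_nonneg _).1

theorem IsTensorCategory.trace_eq_zero_of_haar (hC : IsTensorCategory C)
    {a : ∀ s, Matrix (Idx N (κ s)) (Idx N (κ s)) ℂ}
    (ha : haar C (star (pairing (blockDiagonal' a) (sumPower (freeMatrix N) κ)) *
      pairing (blockDiagonal' a) (sumPower (freeMatrix N) κ)) = 0)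
    {b : Matrix (SumIdx N κ) (SumIdx N κ) ℂ} (hb : ∀ x ∈ hC.endAlgebra κ, x * b = b * x) :
    trace (b * blockDiagonal' a) = 0 := by
  obtain ⟨r, X, hX⟩ := exists_isParsevalFrame (hC.endAlgebra κ).toSubalgebra.toSubmodule
  rw [hC.haar_star_pairing_mul hX] at ha
  have h := (hX.average_nonneg _).2 ha bᴴ fun x hx => by
    have h1 := congrArg Matrix.conjTranspose (hb (star x) (star_mem hx))
    rw [conjTranspose_mul, conjTranspose_mul, star_eq_conjTranspose,
      conjTranspose_conjTranspose] at h1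
    exact h1.symm
  rwa [conjTranspose_conjTranspose] at h

end EndAlgebra

/-! ### The intertwiners of the algebra of a tensor category -/

section Duality

open Matrix
open scoped ComplexOrder

variable {N : ℕ} {C : HomSpaces N}

/-- The functional vanishes on the ideal of relations, so `∑ u_dj^* u_dj` may be replaced by `1`
between `y^*` and `y`. All terms being nonnegative, each letter acts contractively in the GNS
seminorm. -/
theorem IsTensorCategory.sum_haar_colored (hC : IsTensorCategory C) (c : Color) (j : Fin N)
    (y : FreeStarAlgebra (Fin N × Fin N)) :
    ∑ d, haar C (star (colored (freeMatrix N) c d j * y) * (colored (freeMatrix N) c d j * y)) =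
      haar C (star y * y) := by
  have h := hC.haar_mul_defect_mul (hC.adjoint_mem (hC.opR_flip_mem c)) Fin.elim0
    (Fin.cons j (Fin.cons j Fin.elim0 : Fin (0 + 1) → Fin N) : Fin (0 + 1 + 1) → Fin N) (star y) y
  have h' := defect_conjTranspose_opR (freeMatrix N) c j j Fin.elim0 Fin.elim0
  rw [if_pos rfl] at h'
  rw [h', sub_mul, one_mul, mul_sub, map_sub, sub_eq_zero, Finset.sum_mul, Finset.mul_sum,
    map_sum] at h
  rw [← h]
  refine Finset.sum_congr rfl fun d _ => ?_
  rw [star_mul, mul_assoc, mul_assoc]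

theorem IsTensorCategory.bounded_colored (hC : IsTensorCategory C) (c : Color) (i j : Fin N) :
    ∃ M, 0 ≤ M ∧ ∀ y, hC.isPositiveFunctional_haar.norm (colored (freeMatrix N) c i j * y) ≤
      M * hC.isPositiveFunctional_haar.norm y := by
  refine hC.isPositiveFunctional_haar.bounded_of_re_le zero_le_one fun y => ?_
  rw [one_mul, ← hC.sum_haar_colored c j y, Complex.re_sum]
  exact Finset.single_le_sum (f := fun d => (haar C (star (colored (freeMatrix N) c d j * y) *
    (colored (freeMatrix N) c d j * y))).re)
    (fun d _ => (Complex.nonneg_iff.1 (hC.isPositiveFunctional_haar _)).1) (Finset.mem_univ i)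

theorem IsTensorCategory.admissible_haar (hC : IsTensorCategory C) :
    hC.isPositiveFunctional_haar.Admissible := by
  intro x
  induction x using FreeStarAlgebra.induction_tensorPower with
  | h0 => exact ⟨0, le_rfl, fun y => by rw [zero_mul, zero_mul, IsPositiveFunctional.norm_zero]⟩
  | hadd x y hx hy => exact hC.isPositiveFunctional_haar.bounded_add hx hy
  | hsmul c x hx => exact hC.isPositiveFunctional_haar.bounded_smul c hx
  | h k i j =>
    induction k with
    | nil => exact ⟨1, zero_le_one, fun y => by rw [tensorPower_nil, one_mul, one_mul]⟩
    | cons c k ih =>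
      induction i using Idx.cons_induction with | h a i
      induction j using Idx.cons_induction with | h b j
      rw [tensorPower_cons]
      exact hC.isPositiveFunctional_haar.bounded_mul (hC.bounded_colored c a b) (ih i j)

/-- The relations between the coordinates of `A_C` hold in the representation associated to the
Haar functional. -/
theorem IsTensorCategory.haar_star_defect_mul_defect (hC : IsTensorCategory C) {k l : Word}
    {T : Op N k l} (hT : T ∈ homSpaces (TannakaAlgebra.u C) k l) (i : Idx N l) (j : Idx N k) :
    haar C (star (defect (freeMatrix N) T i j) * defect (freeMatrix N) T i j) = 0 := by
  set p := hC.admissible_haar.cstarSeminorm with hp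
  -- The relations of `C` hold in the GNS completion, since the functional kills the ideal they
  -- generate; the universal property of `A_C` then transports `T` there.
  have hle : ∀ k l, C k l ≤ homSpaces ((freeMatrix N).map p.mkHom) k l := by
    intro k l T hT
    rw [mem_homSpaces_iff_defect, ← map_defect]
    ext i j
    rw [Matrix.map_apply, Matrix.zero_apply, ← norm_eq_zero, p.norm_mkHom]
    refine hC.admissible_haar.cstarSeminorm_eq_zero fun y => ?_
    exact hC.haar_mul_defect_mul hT i j _ y
  obtain ⟨f, hf⟩ := TannakaAlgebra.exists_hom (hC.biunitary_of_le hle) hle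
  have h := homSpaces_le_map f hT
  rw [hf, mem_homSpaces_iff_defect, ← map_defect] at h
  have h' := congrFun (congrFun h i) j
  rw [Matrix.map_apply, Matrix.zero_apply, ← norm_eq_zero, p.norm_mkHom] at h'
  exact hC.admissible_haar.apply_star_mul_self_eq_zero h'

/-- The coefficients expressing the entries of the defect of an intertwiner in terms of the
entries of tensor powers. -/
def defectCoeff {k l : Word} (T : Op N k l) (i : Idx N l) (j : Idx N k) :
    ∀ s : Bool, Matrix (Idx N (cond s l k)) (Idx N (cond s l k)) ℂ
  | false => Matrix.of fun z z' => if z' = j then T i z else 0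
  | true => Matrix.of fun z z' => if z = i then -T z' j else 0

theorem defect_eq_pairing {A : Type*} [Ring A] [StarRing A] [Algebra ℂ A]
    (u : Matrix (Fin N) (Fin N) A) {k l : Word} (T : Op N k l) (i : Idx N l) (j : Idx N k) :
    defect u T i j =
      pairing (blockDiagonal' (defectCoeff T i j)) (sumPower u fun s => cond s l k) := by
  have h0 : ∀ (s : Bool) (z : Idx N (cond s l k)), ∑ q : SumIdx N fun s => cond s l k,
      blockDiagonal' (defectCoeff T i j) ⟨s, z⟩ q •
        sumPower u (fun s => cond s l k) ⟨s, z⟩ q =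
      ∑ z', defectCoeff T i j s z z' • tensorPower u (cond s l k) z z' := by
    intro s z
    rw [Fintype.sum_sigma, Finset.sum_eq_single s]
    · refine Finset.sum_congr rfl fun z' _ => ?_
      rw [blockDiagonal'_apply_eq, sumPower,
        blockDiagonal'_apply_eq (fun s : Bool => tensorPower u (cond s l k))]
    · intro t _ ht
      exact Finset.sum_eq_zero fun z' _ => by rw [blockDiagonal'_apply_ne _ _ _ ht.symm, zero_smul]
    · simp
  rw [pairing, Fintype.sum_sigma]
  simp only [h0]
  rw [Fintype.sum_bool, add_comm, defect, Matrix.sub_apply, mul_apply, mul_apply, sub_eq_add_neg]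
  congr 1
  · refine Finset.sum_congr rfl fun z _ => ?_
    refine Eq.trans ?_ (Finset.sum_eq_single j (fun z' _ h => ?_) (by simp)).symm
    · simp [defectCoeff, Algebra.smul_def]
    · simp [defectCoeff, h]
  · refine Eq.trans ?_ (Finset.sum_eq_single i (fun z' _ h => ?_) (by simp)).symm
    · rw [← Finset.sum_neg_distrib]
      refine Finset.sum_congr rfl fun z _ => ?_
      simp [defectCoeff, Algebra.smul_def, Algebra.commutes]
    · exact Finset.sum_eq_zero fun z _ => by simp [defectCoeff, h]

/-- The right-hand side is the `(j, i)` entry, in the corner from `k` to `l`, of the commutator of a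
block diagonal `b` with the block `T^t`: orthogonality to `b` becomes commutation. -/
theorem trace_mul_blockDiagonal_defectCoeff {k l : Word} (T : Op N k l) (i : Idx N l)
    (j : Idx N k)
    (b : Matrix (SumIdx N fun s => cond s l k) (SumIdx N fun s => cond s l k) ℂ) :
    trace (b * blockDiagonal' (defectCoeff T i j)) =
      ∑ z : Idx N k, b ⟨false, j⟩ ⟨false, z⟩ * T i z -
        ∑ z : Idx N l, T z j * b ⟨true, z⟩ ⟨true, i⟩ := by
  have h0 : ∀ (s : Bool) (x : Idx N (cond s l k)),
      (b * blockDiagonal' (defectCoeff T i j)) ⟨s, x⟩ ⟨s, x⟩ =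
        ∑ z, b ⟨s, x⟩ ⟨s, z⟩ * defectCoeff T i j s z x := by
    intro s x
    rw [mul_apply, Fintype.sum_sigma, Finset.sum_eq_single s]
    · exact Finset.sum_congr rfl fun z _ => by rw [blockDiagonal'_apply_eq]
    · intro t _ ht
      exact Finset.sum_eq_zero fun z _ => by rw [blockDiagonal'_apply_ne _ _ _ ht, mul_zero]
    · simp
  rw [trace, Fintype.sum_sigma]
  simp only [diag_apply, h0]
  rw [Fintype.sum_bool, add_comm, sub_eq_add_neg]
  congr 1
  · refine (Finset.sum_eq_single j (fun x _ h => ?_) (by simp)).trans ?_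
    · exact Finset.sum_eq_zero fun z _ => by simp [defectCoeff, h]
    · simp [defectCoeff]
  · rw [← Finset.sum_neg_distrib]
    refine Finset.sum_congr rfl fun x _ => ?_
    refine (Finset.sum_eq_single i (fun z _ h => ?_) (by simp)).trans ?_
    · simp [defectCoeff, h]
    · simp [defectCoeff, mul_comm]

/-- The intertwiners between the tensor powers of the fundamental corepresentation of `A_C` are
the elements of `C`. -/
theorem IsTensorCategory.homSpaces_le (hC : IsTensorCategory C) (k l : Word) :
    homSpaces (TannakaAlgebra.u C) k l ≤ C k l := by
  intro T hT
  let κ : Bool → Word := fun s => cond s l k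
  -- Here `false` indexes `k` and `true` indexes `l`; the transpose of `T` sits in the corner
  -- `(false, true)`.
  suffices h : singleBlock (κ := κ) false true T ∈ hC.endAlgebra κ by
    have h' := h false true
    rwa [blockTranspose_singleBlock] at h'
  refine mem_of_commute_commutant fun b hb => ?_
  -- As `b` is block diagonal, three corners of the commutator vanish. In the corner `(false, true)`
  -- the orthogonality coming from the Haar functional is used, with `x` and `y` exchanged by the
  -- transposition.
  ext ⟨s, x⟩ ⟨t, y⟩
  cases s with
  | true =>
    rw [singleBlock_mul_apply_ne _ _ (by simp), mul_apply]
    refine (Finset.sum_eq_zero fun z _ => ?_).symm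
    by_cases hz : z.1 = false
    · rw [hC.apply_eq_zero_of_commute hb (by simp [hz]), zero_mul]
    · rw [singleBlock_apply_left _ hz, mul_zero]
  | false =>
    cases t with
    | false =>
      rw [mul_singleBlock_apply_ne _ _ _ (by simp), singleBlock_mul_apply]
      exact Finset.sum_eq_zero fun z _ => by
        rw [hC.apply_eq_zero_of_commute hb (by simp), mul_zero]
    | true =>
      rw [mul_singleBlock_apply, singleBlock_mul_apply]
      have h := hC.haar_star_defect_mul_defect hT y x
      rw [defect_eq_pairing] at h
      have h' := hC.trace_eq_zero_of_haar h hb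
      rw [trace_mul_blockDiagonal_defectCoeff, sub_eq_zero] at h'
      exact h'.symm

theorem IsTensorCategory.homSpaces_eq (hC : IsTensorCategory C) :
    homSpaces (TannakaAlgebra.u C) = C := by
  funext k l
  exact le_antisymm (hC.homSpaces_le k l) fun T hT => TannakaAlgebra.le_homSpaces C hT

end Duality

end

end Tannaka

theorem theorem4p20 (N : ℕ) :
    -- `C ↦ A_C` is well defined, and `C_{A_C} = C`
    (∀ C : Tannaka.HomSpaces N, Tannaka.IsTensorCategory C →
      Tannaka.IsWoronowicz (Tannaka.TannakaAlgebra.u C) ∧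
        Tannaka.homSpaces (Tannaka.TannakaAlgebra.u C) = C) ∧
    -- `A ↦ C_A` is well defined, and `A_{C_A} ≃ A`
    (∀ (A : Type*) [CStarAlgebra A] (u : Matrix (Fin N) (Fin N) A), Tannaka.IsWoronowicz u →
      Tannaka.IsTensorCategory (Tannaka.homSpaces u) ∧
        Tannaka.Equivalent (Tannaka.TannakaAlgebra.u (Tannaka.homSpaces u)) u) ∧
    -- `C_A` depends only on the equivalence class of `A`, and determines this class
    (∀ (A B : Type*) [CStarAlgebra A] [CStarAlgebra B]
      (u : Matrix (Fin N) (Fin N) A) (v : Matrix (Fin N) (Fin N) B),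
      Tannaka.IsWoronowicz u → Tannaka.IsWoronowicz v →
        (Tannaka.Equivalent u v ↔ Tannaka.homSpaces u = Tannaka.homSpaces v)) := by
  refine ⟨fun C hC => ⟨Tannaka.TannakaAlgebra.isWoronowicz C, hC.homSpaces_eq⟩,
    fun A _ u hu => ?_, fun A B _ _ u v hu hv => hu.equivalent_iff hv⟩
  have h := hu.biunitary.isTensorCategory
  -- Both algebras have the Hom spaces `C_A`, hence they are equivalent.
  exact ⟨h, ((Tannaka.TannakaAlgebra.isWoronowicz _).equivalent_iff hu).2 h.homSpaces_eq⟩
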